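/- **Notation.** Let $q$ be a prime power, $\tilde t$ a variable, $t=-\tilde t^{\,q-1}$, $A=\mathbb F_q[t]$, and let $\mathbb C_\infty$ be the completion of an algebraic closure of $\mathbb F_q((1/\tilde t))$. For $f=\sum f_iT^i\in\mathbb C_\infty[[T]]$ and $n\in\mathbb Z$ put $f^{(n)}=\sum f_i^{q^n}T^i$ (entrywise for matrices). Let $\Omega(T)=\tilde t^{-q}\prod_{i\ge1}(1-T/t^{q^i})$ and $\tilde\pi=1/\Omega(t)$. Let $D_i=\prod_{j<i}(t^{q^i}-t^{q^j})$, and $\Gamma_{n+1}=\prod_iD_i^{n_i}$ for $n=\sum_i n_iq^i$ in base $q$. Let $H_n(T)\in A[T]$ be the polynomials defined by $$\sum_{n\ge0}\frac{H_n(T)}{\Gamma_{n+1}|_{t=T}}x^n=\Bigl(1-\sum_{i\ge0}\prod_{j=1}^i\frac{T^{q^i}-t^{q^j}}{T^{q^i}-T^{q^{j-1}}}\,x^{q^i}\Bigr)^{-1}.$$ Put $S_d(m)=\sum 1/a^m$, over the monic $a\in A$ of degree $d$. For $s=(s_1,\dots,s_r)\in\mathbb Z_{+}^r$ and $I\subseteq\{1,\dots,r-1\}$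 let $$\zeta_I(s)=\sum S_{d_1}(s_1)\cdots S_{d_r}(s_r)$$ over all $d_1\ge\cdots\ge d_r\ge0$ with $d_i>d_{i+1}$ for $i\in I$ and $d_i=d_{i+1}$ for $i\notin I$. Let $\zeta_{\ge I}(s)$ be the same sum over all $d_1\ge\cdots\ge d_r\ge 0$ with $d_i>d_{i+1}$ for $i\in I$ and no condition for $i\notin I$, so that $\zeta_{\ge I}=\sum_{J\supseteq I}\zeta_J$. A dual $t$-motive is a free $\mathbb C_\infty[T]$-module $M$ of finite rank with an additive map $\sigma$ such that $\sigma(fm)=f^{(-1)}\sigma(m)$ and $(T-t)^NM\subseteq\sigma M$ for some $N$. (The unit object and its extensions are allowed.) A square matrix $\Phi$ over $\mathbb C_\infty[T]$ defines $\sigma v=v^{(-1)}\Phi$ on row vectors. A trivialization of $\Phi$ is a matrix $\Psi$ of everywhere convergent power series, invertible over the Tate algebra and at $T=t$, with $\Phi\Psi=\Psi^{(-1)}$. The matrix $\Psi^{-1}|_{T=t}$ is its period matrix and the entries of that matrix are periods. **Statement.** Let $s\in\mathbb Z_+^r$ and $I\subseteq\{1,\dots,r-1\}$. For $1\le k\le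 r$ let $w_k$ be the number of $j\in\{k,\dots,r-1\}\setminus I$, and let $w=r-1-|I|$ be the total number of positions without a jump. Define the delayed polynomials $$Q_{k+1,k}=H_{s_k-1}^{(-w_k)}\bigl[(T-t)^{(0)}(T-t)^{(-1)}\cdots(T-t)^{(-w_k+1)}\bigr]^{s_k}$$ (so $Q_{k+1,k}=H_{s_k-1}$ when $w_k=0$). Let $Q$ be the $(r+1)\times(r+1)$ lower triangular matrix with $1$'s on the diagonal, these entries just below the diagonal, and $0$ elsewhere. For $X=T-t$ and $X=\Omega$ let $[[X]]$ be the diagonal matrix with entries $X^{s_1+\cdots+s_r},X^{s_2+\cdots+s_r},\dots,X^{s_r},1$. Put $\Phi_I=Q^{(-1)}[[T-t]]$ and $\Psi_I=[[\Omega]]L$, where $L$ is lower triangular with $$L_{ab}=\sum_{e_b>\cdots>e_{a-1}\ge0}\ \prod_{k=b}^{a-1}\bigl(\Omega^{s_k}Q_{k+1,k}\bigr)^{(e_k)}\qquad(b\le a).$$ Then the series defining $\zeta_I(s)$ and $\zeta_{\ge I}(s)$ converge, and: 1. $\Phi_I$ has entries in $\mathbb F_q[t^{1/q^w}][T]$ and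 defines a dual $t$-motive of rank $r+1$, and $\Psi_I$ is a trivialization of $\Phi_I$. 2. For $1\le b\le a\le r+1$, the $(a,b)$ entry of $\Psi_I|_{T=t}$ (the inverse of the period matrix) is $$\frac{\Gamma_{s_b}\cdots\Gamma_{s_{a-1}}\ \zeta_{\ge I}(s_b,\dots,s_{a-1})}{\tilde\pi^{\,s_b+\cdots+s_r}},$$ where in $\zeta_{\ge I}(s_b,\dots,s_{a-1})$ the strict inequalities are imposed at the positions of $I$ in $\{b,\dots,a-2\}$. 3. The degenerate multizeta value $\zeta_I(s)$ itself is obtained from the direct sum of the motives $\Phi_J$, $I\subseteq J\subseteq\{1,\dots,r-1\}$. There are invertible matrices $U,V$ over $\mathbb F_q$ such that $\Phi=U\bigl(\bigoplus_J\Phi_J\bigr)U^{-1}$ has entries in $\mathbb F_q[t^{1/q^w}][T]$, defines a dual $t$-motive, and has the trivialization $\Psi=U\bigl(\bigoplus_J\Psi_J\bigr)V$, and such that for some indices $(a,b)$ the inverse of the period matrix has the entry $$\Psi_{ab}|_{T=t}=\Gamma_{s_1}\cdots\Gamma_{s_r}\,\zeta_I(s)/\tilde\pi^{\,s_1+\cdots+s_r}.$$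 Moreover, the matrix $\Phi'=(T-t)^{s_1+\cdots+s_r}(\Phi^{-1})^{\mathsf T}$ (the dual, twisted by a tensor power of the Carlitz motive) has entries in $\mathbb F_q[t^{1/q^w}][T]$, defines a dual $t$-motive, and has a trivialization whose period matrix has the $(b,a)$ entry $$\Gamma_{s_1}\cdots\Gamma_{s_r}\,\zeta_I(s).$$ Thus every $\zeta_I(s)$, multiplied by gamma factors, is a period of a dual $t$-motive defined over $\mathbb F_q[t^{1/q^w}][T]$. -/

import Mathlib

noncomputable section

namespace CarlitzMZV

open scoped NNReal WithZero
open Polynomial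

/-! ### The field `ℂ_∞` -/

section CInfinity

variable (F : Type*) [Field F]

/-- `𝔽_q((1/t̃))`: the completion of `𝔽_q(t̃)` at the place at infinity. -/
abbrev KInf : Type _ := @RatFunc.CompletionAtInfty F _ (Classical.decEq _)

theorem valuation_X : Valued.v (algebraMap (RatFunc F) (KInf F) RatFunc.X) = WithZero.exp (1 : ℤ) := by
  rw [RatFunc.valuedCompletionAtInfty.def]
  let := Classical.decEq (RatFunc F)
  let := RatFunc.inftyValued F
  have := Valued.extensionValuation_apply_coe (K := RatFunc F) RatFunc.X
  refine this.trans ?_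
  exact RatFunc.inftyValuation.X F

variable [Fintype F]

/-- The absolute value normalised by `|t̃| = q`. -/
instance : (Valued.v : Valuation (KInf F) ℤᵐ⁰).RankOne where
  hom' := (WithZeroMulInt.toNNReal (e := (Fintype.card F : ℝ≥0)) (by simp)).comp
    MonoidWithZeroHom.ValueGroup₀.embedding
  strictMono' := (WithZeroMulInt.toNNReal_strictMono
    (by exact_mod_cast Fintype.one_lt_card)).comp
      MonoidWithZeroHom.ValueGroup₀.embedding_strictMono
  exists_val_nontrivial := ⟨algebraMap (RatFunc F) (KInf F) RatFunc.X, by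
    rw [valuation_X]; exact ⟨by simp, by simp⟩⟩

instance : NontriviallyNormedField (KInf F) := Valued.toNontriviallyNormedField (KInf F) ℤᵐ⁰

instance : IsUltrametricDist (KInf F) :=
  Valued.instIsUltrametricDist (KInf F) ℤᵐ⁰

instance : CompleteSpace (KInf F) :=
  inferInstanceAs (@CompleteSpace (@UniformSpace.Completion (RatFunc F) (@RatFunc.inftyValued F _ (Classical.decEq _)).toUniformSpace) _)

/-- An algebraic closure of `𝔽_q((1/t̃))`, with the unique extension of the absolute value. -/
def KBar : Type _ := AlgebraicClosure (KInf F)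
instance : Field (KBar F) := inferInstanceAs (Field (AlgebraicClosure (KInf F)))
instance : Algebra (KInf F) (KBar F) := inferInstanceAs (Algebra (KInf F) (AlgebraicClosure (KInf F)))
instance : IsAlgClosed (KBar F) := inferInstanceAs (IsAlgClosed (AlgebraicClosure (KInf F)))
instance : Algebra.IsAlgebraic (KInf F) (KBar F) := inferInstanceAs (Algebra.IsAlgebraic (KInf F) (AlgebraicClosure (KInf F)))
instance : NormedField (KBar F) := spectralNorm.normedField (KInf F) (KBar F)
instance : NormedAlgebra (KInf F) (KBar F) := spectralNorm.normedAlgebra (KInf F) (KBar F)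

/-- `ℂ_∞`: the completion of the algebraic closure of `𝔽_q((1/t̃))`. -/
def CInf : Type _ := UniformSpace.Completion (KBar F)
instance : NormedField (CInf F) := inferInstanceAs (NormedField (UniformSpace.Completion (KBar F)))
instance : CompleteSpace (CInf F) := inferInstanceAs (CompleteSpace (UniformSpace.Completion (KBar F)))

/-- The embedding of the algebraic closure into `ℂ_∞`. -/
def ofKBar : KBar F →+* CInf F :=
  (UniformSpace.Completion.coeRingHom : KBar F →+* UniformSpace.Completion (KBar F))
/-- The embedding of `𝔽_q(t̃)` into `ℂ_∞`. -/
def ofRatFunc : RatFunc F →+* CInf F := (ofKBar F).comp ((algebraMap (KInf F) (KBar F)).comp (algebraMap (RatFunc F) (KInf F)))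

instance : Algebra F (CInf F) := ((ofRatFunc F).comp RatFunc.C).toAlgebra

theorem norm_sub_pow (x y : CInf F) : ‖x ^ Fintype.card F - y ^ Fintype.card F‖ = ‖x - y‖ ^ Fintype.card F := by
  rw [← norm_pow]
  congr 1
  exact (map_sub (FiniteField.frobeniusAlgHom F (CInf F)) x y).symm

theorem bijective_frobenius : Function.Bijective (FiniteField.frobeniusAlgHom F (CInf F)) := by
  refine ⟨(FiniteField.frobeniusAlgHom F (CInf F)).toRingHom.injective, ?_⟩
  have hq : Fintype.card F ≠ 0 := Fintype.card_ne_zero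
  have hui : IsUniformInducing (fun x : CInf F => x ^ Fintype.card F) := by
    rw [Metric.isUniformInducing_iff]
    constructor
    · rw [Metric.uniformContinuous_iff]
      intro ε hε
      refine ⟨min ε 1, by positivity, fun {a b} h => ?_⟩
      rw [dist_eq_norm] at h ⊢
      rw [norm_sub_pow]
      have h1 : ‖a - b‖ < 1 := h.trans_le (min_le_right _ _)
      exact (pow_le_of_le_one (norm_nonneg _) h1.le hq).trans_lt (h.trans_le (min_le_left _ _))
    · intro δ hδ
      refine ⟨δ ^ Fintype.card F, by positivity, fun {a b} h => ?_⟩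
      rw [dist_eq_norm] at h ⊢
      rw [norm_sub_pow] at h
      exact lt_of_pow_lt_pow_left₀ _ hδ.le h
  have hcl : IsClosed (Set.range (fun x : CInf F => x ^ Fintype.card F)) :=
    hui.isComplete_range.isClosed
  have hd : DenseRange (ofKBar F) :=
    UniformSpace.Completion.denseRange_coe (α := KBar F)
  intro y
  have : y ∈ Set.range (fun x : CInf F => x ^ Fintype.card F) := by
    refine hd.induction_on (p := fun y => y ∈ Set.range (fun x : CInf F => x ^ Fintype.card F)) y hcl ?_
    intro a
    obtain ⟨z, hz⟩ := IsAlgClosed.exists_pow_nat_eq a (Nat.pos_of_ne_zero hq)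
    exact ⟨ofKBar F z, by simp [← hz]⟩
  exact this

end CInfinity

/-! ### Carlitz gamma values and the polynomials `H_s` -/

section Interpolation

variable (F : Type*) [Field F] [Fintype F]

/-- `D_n = ∏_{i<n} (t^{q^n} - t^{q^i})`, in `𝔽_q[t]`. -/
def carlitzD (n : ℕ) : F[X] :=
  ∏ i ∈ Finset.range n, (X ^ Fintype.card F ^ n - X ^ Fintype.card F ^ i)

/-- The Carlitz factorial `Π_n = ∏ D_i^{n_i}`, where `n = ∑ n_i q^i` in base `q`. -/
def carlitzPi (n : ℕ) : F[X] :=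
  ∏ i ∈ Finset.range (n + 1), carlitzD F i ^ (n / Fintype.card F ^ i % Fintype.card F)

/-- The Carlitz gamma values `Γ_n = Π_{n-1}` for `n ≥ 1`. -/
def carlitzGamma (n : ℕ) : F[X] := carlitzPi F (n - 1)

/-- The fraction field `𝔽_q(t, T)`.  In `F[X][X]` the outer variable `X` is `T`, and `C X` is `t`. -/
abbrev BiFrac : Type _ := FractionRing F[X][X]

/-- `∏_{j=1}^i (T^{q^i} - t^{q^j}) / (T^{q^i} - T^{q^{j-1}})`. -/
def genCoeff (i : ℕ) : BiFrac F :=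
  ∏ j ∈ Finset.Icc 1 i,
    algebraMap F[X][X] (BiFrac F) (X ^ Fintype.card F ^ i - C (X ^ Fintype.card F ^ j)) /
      algebraMap F[X][X] (BiFrac F) (X ^ Fintype.card F ^ i - X ^ Fintype.card F ^ (j - 1))

/-- `(1 - ∑_i (∏_{j=1}^i (T^{q^i} - t^{q^j}) / (T^{q^i} - T^{q^{j-1}})) x^{q^i})⁻¹`, a power series
in `x`. -/
def genSeries : PowerSeries (BiFrac F) :=
  (1 - PowerSeries.mk fun n =>
    ∑ i ∈ Finset.range (n + 1), if Fintype.card F ^ i = n then genCoeff F i else 0)⁻¹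

theorem carlitzD_succ (n : ℕ) : carlitzD F (n + 1) =
    (X ^ Fintype.card F ^ (n + 1) - X) * carlitzD F n ^ Fintype.card F := by
  rw [carlitzD, Finset.prod_range_succ', mul_comm, carlitzD, ← Finset.prod_pow]
  congr 1
  · simp
  · refine Finset.prod_congr rfl fun i _ => ?_
    have := map_sub (FiniteField.frobeniusAlgHom F F[X])
      (X ^ Fintype.card F ^ n) (X ^ Fintype.card F ^ i)
    simp only [FiniteField.coe_frobeniusAlgHom] at this
    rw [this, ← pow_mul, ← pow_mul, pow_succ, pow_succ]

theorem prod_carlitzD (N m : ℕ) :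
    (∏ i ∈ Finset.range N, carlitzD F i ^ (m / Fintype.card F ^ i % Fintype.card F)) *
      carlitzD F N ^ (m / Fintype.card F ^ N) =
    ∏ k ∈ Finset.range N,
      (X ^ Fintype.card F ^ (k + 1) - X : F[X]) ^ (m / Fintype.card F ^ (k + 1)) := by
  induction N with
  | zero => simp [carlitzD]
  | succ N ih =>
    rw [Finset.prod_range_succ (fun k => (X ^ Fintype.card F ^ (k + 1) - X : F[X]) ^
      (m / Fintype.card F ^ (k + 1))), ← ih, Finset.prod_range_succ, carlitzD_succ, mul_pow,
      ← pow_mul]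
    have h : m / Fintype.card F ^ N = m / Fintype.card F ^ N % Fintype.card F +
        Fintype.card F * (m / Fintype.card F ^ (N + 1)) := by
      rw [pow_succ, ← Nat.div_div_eq_div_mul, Nat.mod_add_div]
    have h2 : carlitzD F N ^ (m / Fintype.card F ^ N) =
        carlitzD F N ^ (m / Fintype.card F ^ N % Fintype.card F) *
        carlitzD F N ^ (Fintype.card F * (m / Fintype.card F ^ (N + 1))) := by
      rw [← pow_add, ← h]
    rw [h2]
    ring

theorem carlitzPi_eq {m M : ℕ} (h : m < M) : carlitzPi F m =
    ∏ k ∈ Finset.range M,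
      (X ^ Fintype.card F ^ (k + 1) - X : F[X]) ^ (m / Fintype.card F ^ (k + 1)) := by
  have hq : 1 < Fintype.card F := Fintype.one_lt_card
  have h0 : ∀ k, m < k → m / Fintype.card F ^ k = 0 := fun k hk =>
    Nat.div_eq_of_lt (hk.trans (Nat.lt_pow_self hq))
  have h1 := prod_carlitzD F (m + 1) m
  rw [h0 _ (Nat.lt_succ_self m), pow_zero, mul_one] at h1
  rw [carlitzPi, h1]
  refine Finset.prod_subset (Finset.range_mono h) fun k _ hk => ?_
  rw [h0, pow_zero]
  simp at hk
  omega

theorem carlitzD_eq {i M : ℕ} (h : i ≤ M) : carlitzD F i =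
    ∏ k ∈ Finset.range M,
      (X ^ Fintype.card F ^ (k + 1) - X : F[X]) ^
        (Fintype.card F ^ i / Fintype.card F ^ (k + 1)) := by
  have hq : 1 < Fintype.card F := Fintype.one_lt_card
  have h1 := prod_carlitzD F i (Fintype.card F ^ i)
  rw [Nat.div_self (by positivity), pow_one, Finset.prod_eq_one, one_mul] at h1
  · rw [h1]
    refine Finset.prod_subset (Finset.range_mono h) fun k _ hk => ?_
    rw [Nat.div_eq_of_lt, pow_zero]
    simp at hk
    exact Nat.pow_lt_pow_right hq (by omega)
  · intro j hj
    have hj : j < i := by simpa using hj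
    rw [Nat.pow_div hj.le (by omega)]
    have : Fintype.card F ^ (i - j) % Fintype.card F = 0 :=
      Nat.mod_eq_zero_of_dvd (dvd_pow_self _ (by omega))
    rw [this, pow_zero]

theorem carlitzD_mul_carlitzPi_dvd (i m : ℕ) :
    carlitzD F i * carlitzPi F m ∣ carlitzPi F (Fintype.card F ^ i + m) := by
  have hq : 1 < Fintype.card F := Fintype.one_lt_card
  have hi : i < Fintype.card F ^ i := Nat.lt_pow_self hq
  rw [carlitzD_eq F (M := Fintype.card F ^ i + m + 1) (by omega),
    carlitzPi_eq F (m := m) (M := Fintype.card F ^ i + m + 1) (by omega),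
    carlitzPi_eq F (M := Fintype.card F ^ i + m + 1) (by omega), ← Finset.prod_mul_distrib]
  refine Finset.prod_dvd_prod_of_dvd _ _ fun k _ => ?_
  rw [← pow_add]
  exact pow_dvd_pow _ Nat.div_add_div_le_add_div

theorem carlitzD_mul_genCoeff (i : ℕ) :
    algebraMap F[X][X] (BiFrac F) ((carlitzD F i).map C) * genCoeff F i =
      algebraMap F[X][X] (BiFrac F)
        (∏ j ∈ Finset.Icc 1 i, (X ^ Fintype.card F ^ i - C (X ^ Fintype.card F ^ j))) := by
  have hq : 1 < Fintype.card F := Fintype.one_lt_card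
  have h : (carlitzD F i).map C = ∏ j ∈ Finset.Icc 1 i,
      (X ^ Fintype.card F ^ i - X ^ Fintype.card F ^ (j - 1) : F[X][X]) := by
    rw [carlitzD, Polynomial.map_prod, Finset.range_eq_Ico,
      ← Finset.Ico_add_one_right_eq_Icc, Finset.prod_Ico_eq_prod_range,
      Finset.prod_Ico_eq_prod_range]
    simp
  rw [genCoeff, h, map_prod, map_prod, ← Finset.prod_mul_distrib]
  refine Finset.prod_congr rfl fun j hj => ?_
  rw [mul_div_cancel₀]
  rw [Ne, IsFractionRing.to_map_eq_zero_iff, sub_eq_zero]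
  intro h
  have := congrArg natDegree h
  simp only [natDegree_X_pow] at this
  have := Nat.pow_right_injective hq this
  simp at hj
  omega

/-- `Π_s(T)` times the coefficient of `x^s` in the generating series is a polynomial in `t, T`;
`map C` substitutes `T` for `t`. -/
theorem exists_interpolation (s : ℕ) : ∃ P : F[X][X], algebraMap F[X][X] (BiFrac F) P =
    algebraMap F[X][X] (BiFrac F) ((carlitzPi F s).map C) *
      PowerSeries.coeff s (genSeries F) := by
  have hq : 1 < Fintype.card F := Fintype.one_lt_card
  induction s using Nat.strong_induction_on with
  | _ s ih =>
  set E : PowerSeries (BiFrac F) := PowerSeries.mk fun n =>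
    ∑ i ∈ Finset.range (n + 1), if Fintype.card F ^ i = n then genCoeff F i else 0 with hE
  have hG : genSeries F = 1 + E * genSeries F := by
    have : (1 - E) * genSeries F = 1 := by
      refine PowerSeries.mul_inv_cancel _ ?_
      simp [hE]
    linear_combination this
  change _ ∈ (algebraMap F[X][X] (BiFrac F)).range
  rw [hG, map_add, mul_add, PowerSeries.coeff_mul, Finset.mul_sum]
  refine add_mem (mul_mem ⟨_, rfl⟩ ?_) (sum_mem fun ab hab => ?_)
  · rw [PowerSeries.coeff_one]
    split_ifs
    · exact one_mem _
    · exact zero_mem _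
  · rw [hE, PowerSeries.coeff_mk, Finset.sum_mul, Finset.mul_sum]
    refine sum_mem fun i _ => ?_
    split_ifs with hi
    · have hab : ab.1 + ab.2 = s := by simpa using hab
      have hpos : 0 < Fintype.card F ^ i := by positivity
      obtain ⟨e, he⟩ := carlitzD_mul_carlitzPi_dvd F i ab.2
      rw [hi, hab] at he
      obtain ⟨P, hP⟩ := ih ab.2 (by omega)
      refine ⟨(∏ j ∈ Finset.Icc 1 i, (X ^ Fintype.card F ^ i - C (X ^ Fintype.card F ^ j))) *
        P * e.map C, ?_⟩
      rw [he, map_mul, map_mul, hP, ← carlitzD_mul_genCoeff]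
      simp only [Polynomial.map_mul, map_mul]
      ring
    · simp

/-- The polynomial `H_s(T) ∈ 𝔽_q[t][T]`: the unique polynomial such that `H_s(T) / Γ_{s+1}(T)` is the
coefficient of `x^s` in the generating series. -/
def interpPoly (s : ℕ) : F[X][X] := (exists_interpolation F s).choose

theorem interpPoly_spec (s : ℕ) : algebraMap F[X][X] (BiFrac F) (interpPoly F s) =
    algebraMap F[X][X] (BiFrac F) ((carlitzPi F s).map C) *
      PowerSeries.coeff s (genSeries F) :=
  (exists_interpolation F s).choose_spec

end Interpolation

/-! ### Twisting, and the function `Ω` -/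

section Twist

variable (F : Type*) [Field F] [Fintype F]

/-- The automorphism `x ↦ x^q` of `ℂ_∞`. -/
def frob : RingAut (CInf F) :=
  RingEquiv.ofBijective (FiniteField.frobeniusAlgHom F (CInf F)).toRingHom (bijective_frobenius F)

/-- The automorphism `x ↦ x^{q^n}` of `ℂ_∞`, for an integer `n`. -/
def frobPow (n : ℤ) : CInf F ≃+* CInf F := frob F ^ n

/-- The twist `f ↦ f^{(n)}` of power series: coefficients are raised to the power `q^n`. -/
def twist (n : ℤ) : PowerSeries (CInf F) →+* PowerSeries (CInf F) :=
  PowerSeries.map (frobPow F n : CInf F →+* CInf F)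

/-- The twist `f ↦ f^{(n)}` of polynomials. -/
def twistPoly (n : ℤ) : (CInf F)[X] →+* (CInf F)[X] :=
  Polynomial.mapRingHom (frobPow F n : CInf F →+* CInf F)

/-- The element `t̃` of `ℂ_∞`. -/
def tTilde : CInf F := ofRatFunc F RatFunc.X

/-- The element `t = -t̃^{q-1}` of `ℂ_∞`. -/
def tElt : CInf F := -tTilde F ^ (Fintype.card F - 1)

open scoped PowerSeries.WithPiTopology in
/-- `Ω(T) = t̃^{-q} ∏_{i≥1} (1 - T / t^{q^i})`, the product being taken coefficientwise. -/
def Omega : PowerSeries (CInf F) :=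
  PowerSeries.C ((tTilde F ^ Fintype.card F)⁻¹) *
    ∏' i : ℕ, (1 - PowerSeries.C ((tElt F ^ Fintype.card F ^ (i + 1))⁻¹) * PowerSeries.X)

/-- The value at `T = t` of a power series in `T`. -/
def evalAtT (f : PowerSeries (CInf F)) : CInf F :=
  ∑' n : ℕ, PowerSeries.coeff n f * tElt F ^ n

/-- `π̃ = 1 / Ω(t)`. -/
def piTilde : CInf F := (evalAtT F (Omega F))⁻¹

/-- `Γ_n` as an element of `ℂ_∞`. -/
def gammaC (n : ℕ) : CInf F := aeval (tElt F) (carlitzGamma F n)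

/-- `H_s(T)` as an element of `ℂ_∞[T]`. -/
def HPoly (s : ℕ) : (CInf F)[X] :=
  (interpPoly F s).map (aeval (tElt F) : F[X] →ₐ[F] CInf F).toRingHom

end Twist

/-! ### Multizeta values -/

section Multizeta

variable (F : Type*) [Field F] [Fintype F]

/-- `S_d(s) = ∑ 1/a^s` over the monic `a ∈ 𝔽_q[t]` of degree `d`. -/
def powerSum (d s : ℕ) : CInf F :=
  ∑ᶠ a ∈ {a : F[X] | a.Monic ∧ a.natDegree = d}, (aeval (tElt F) a ^ s)⁻¹

/-- The tuple `d` is monotonically decreasing and jumps exactly at the positions in `I`: for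
consecutive indices `i, j` one has `d i > d j` if `i ∈ I`, and `d i = d j` otherwise. -/
def HasJumps {ι : Type*} [LinearOrder ι] (I : Set ι) (d : ι → ℕ) : Prop :=
  ∀ i j, i ⋖ j → d j ≤ d i ∧ (d j < d i ↔ i ∈ I)

/-- The tuple `d` is monotonically decreasing and jumps at least at the positions in `I`. -/
def HasJumpsAtLeast {ι : Type*} [LinearOrder ι] (I : Set ι) (d : ι → ℕ) : Prop :=
  ∀ i j, i ⋖ j → d j ≤ d i ∧ (i ∈ I → d j < d i)

/-- The multizeta value `ζ_I(s) = ∑ S_{d_1}(s_1) ⋯ S_{d_r}(s_r)`, over the decreasing tuples `d` with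
jumps exactly in positions in `I`. -/
def multizeta {ι : Type*} [LinearOrder ι] [Fintype ι] (s : ι → ℕ) (I : Set ι) : CInf F :=
  ∑' d : {d : ι → ℕ // HasJumps I d}, ∏ i, powerSum F (d.1 i) (s i)

/-- The variant of `ζ_I(s)` in which the conditions `d_i = d_{i+1}` for `i ∉ I` are weakened to
`d_i ≥ d_{i+1}`. -/
def weakMultizeta {ι : Type*} [LinearOrder ι] [Fintype ι] (s : ι → ℕ) (I : Set ι) : CInf F :=
  ∑' d : {d : ι → ℕ // HasJumpsAtLeast I d}, ∏ i, powerSum F (d.1 i) (s i)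

end Multizeta

/-! ### Dual `t`-motives, their trivializations and periods -/

section Motive

variable (F : Type*) [Field F] [Fintype F]

/-- A dual `t`-motive: a free `ℂ_∞[T]`-module `M` of finite rank, with an additive map `σ` satisfying
`σ (f m) = f^{(-1)} σ m` and `(T - t)^N M ⊆ σ M` for some `N`.  Finite generation over `ℂ_∞[σ]` is not
required, so that the trivial motive `C^{⊗0}` and its extensions are included. -/
structure IsDualTMotive {M : Type*} [AddCommGroup M] [Module (CInf F)[X] M]
    (σ : M →ₛₗ[twistPoly F (-1)] M) : Prop where
  free : Module.Free (CInf F)[X] M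
  finite : Module.Finite (CInf F)[X] M
  exists_pow_smul : ∃ N : ℕ, ∀ m : M, ∃ m' : M, σ m' = (X - C (tElt F)) ^ N • m

variable {ι : Type*} [Fintype ι] [DecidableEq ι]

/-- The operator `σ` on row vectors defined by a matrix `Φ`: `σ v = v^{(-1)} Φ`. -/
def sigma (Φ : Matrix ι ι (CInf F)[X]) :
    (ι → (CInf F)[X]) →ₛₗ[twistPoly F (-1)] (ι → (CInf F)[X]) where
  toFun v := Matrix.vecMul (fun i => twistPoly F (-1) (v i)) Φ
  map_add' v w := by
    rw [← Matrix.add_vecMul]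
    congr 1
    funext i
    simp
  map_smul' c v := by
    rw [← Matrix.smul_vecMul]
    congr 1
    funext i
    simp

/-- The entries of `Φ` lie in `𝔽_q[t^{1/q^w}][T]`. -/
def IsDefinedOver (w : ℕ) (Φ : Matrix ι ι (CInf F)[X]) : Prop :=
  ∀ i j n, (Φ i j).coeff n ∈ Algebra.adjoin F {frobPow F (-(w : ℤ)) (tElt F)}

/-- The power series `f` converges on all of `ℂ_∞`. -/
def IsEntire (f : PowerSeries (CInf F)) : Prop :=
  ∀ ρ : ℝ, Filter.Tendsto (fun n => ‖PowerSeries.coeff n f‖ * ρ ^ n) Filter.atTop (nhds 0)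

/-- The power series `f` belongs to the Tate algebra: it converges on the closed unit disc. -/
def IsTate (f : PowerSeries (CInf F)) : Prop :=
  Filter.Tendsto (fun n => ‖PowerSeries.coeff n f‖) Filter.atTop (nhds 0)

/-- `Ψ` is a rigid analytic trivialization of `Φ`: it has entire entries, is invertible over the Tate
algebra and at `T = t`, and satisfies `Φ Ψ = Ψ^{(-1)}`. -/
structure IsTrivialization (Φ : Matrix ι ι (CInf F)[X]) (Ψ : Matrix ι ι (PowerSeries (CInf F))) :
    Prop where
  entire : ∀ i j, IsEntire F (Ψ i j)
  invertible : ∃ Θ : Matrix ι ι (PowerSeries (CInf F)), (∀ i j, IsTate F (Θ i j)) ∧ Ψ * Θ = 1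
  det_ne_zero : (Ψ.map (evalAtT F)).det ≠ 0
  eqn : Φ.map (fun p => (p : PowerSeries (CInf F))) * Ψ = Ψ.map (twist F (-1))

/-- The period matrix: the value of `Ψ⁻¹` at `T = t`. -/
def periodMatrix (Ψ : Matrix ι ι (PowerSeries (CInf F))) : Matrix ι ι (CInf F) :=
  (Ψ.map (evalAtT F))⁻¹

/-- An invertible matrix over `𝔽_q` as a matrix over an `𝔽_q`-algebra. -/
def constMatrix {F : Type*} [Field F] (R : Type*) [CommRing R] [Algebra F R]
    (U : Matrix.GeneralLinearGroup ι F) : Matrix ι ι R :=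
  (U : Matrix ι ι F).map (algebraMap F R)

end Motive

/-! ### The motives with delayed interpolation -/

section Construction

/-- The positions `1, …, r - 1` of an `r`-tuple. -/
def positions (r : ℕ) : Finset (Fin r) := {k | k.1 + 1 < r}

/-- The delay `w_k` at the index `k`: the number of positions from `k` on without a jump. -/
def delay {r : ℕ} (I : Finset (Fin r)) (k : Fin r) : ℕ :=
  ((positions r \ I).filter fun j => k ≤ j).card

/-- The sum `s_a + ⋯ + s_r`. -/
def tailSum {r : ℕ} (s : Fin r → ℕ) (a : Fin (r + 1)) : ℕ :=
  ∑ k with a ≤ Fin.castSucc k, s k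

/-- The indices `k` with `b ≤ k < a`. -/
abbrev Between {r : ℕ} (b a : Fin (r + 1)) : Type :=
  {k : Fin r // b ≤ Fin.castSucc k ∧ Fin.castSucc k < a}

variable (F : Type*) [Field F] [Fintype F]

/-- The polynomial `H_{s-1}^{(-w)} [(T-t)^{(0)} ⋯ (T-t)^{(-w+1)}]^s`. -/
def delayedH (s w : ℕ) : (CInf F)[X] :=
  twistPoly F (-(w : ℤ)) (HPoly F (s - 1)) *
    (∏ m ∈ Finset.range w, twistPoly F (-(m : ℤ)) (X - C (tElt F))) ^ s

variable {r : ℕ} (s : Fin r → ℕ) (I : Finset (Fin r))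

/-- The unipotent matrix `Q` whose only nonzero entries off the diagonal are the `Q_{k+1,k}`, the
delayed polynomials. -/
def QMatrix : Matrix (Fin (r + 1)) (Fin (r + 1)) (CInf F)[X] :=
  1 + ∑ k : Fin r, Matrix.single k.succ k.castSucc (delayedH F (s k) (delay I k))

/-- The diagonal matrix `D = [[T - t]]`. -/
def DMatrix : Matrix (Fin (r + 1)) (Fin (r + 1)) (CInf F)[X] :=
  Matrix.diagonal fun a => (X - C (tElt F)) ^ tailSum s a

/-- `Φ = Q^{(-1)} D`. -/
def PhiMatrix : Matrix (Fin (r + 1)) (Fin (r + 1)) (CInf F)[X] :=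
  (QMatrix F s I).map (twistPoly F (-1)) * DMatrix F s

open scoped PowerSeries.WithPiTopology in
/-- The lower triangular matrix `L`, with
`L_{ab} = ∑_{e_b > ⋯ > e_{a-1} ≥ 0} ∏_{b ≤ k < a} (Ω^{s_k} Q_{k+1,k})^{(e_k)}` for `b ≤ a`. -/
def LMatrix : Matrix (Fin (r + 1)) (Fin (r + 1)) (PowerSeries (CInf F)) :=
  Matrix.of fun a b =>
    if b ≤ a then
      ∑' e : {e : Between b a → ℕ // StrictAnti e}, ∏ k : Between b a,
        twist F (e.1 k) (Omega F ^ s k * (delayedH F (s k) (delay I k) : PowerSeries (CInf F)))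
    else 0

/-- `Ψ = Λ L`, where `Λ = [[Ω]]`. -/
def PsiMatrix : Matrix (Fin (r + 1)) (Fin (r + 1)) (PowerSeries (CInf F)) :=
  Matrix.diagonal (fun a => Omega F ^ tailSum s a) * LMatrix F s I

/-- The matrix of the direct sum of the motives `Φ_J`, for `I ⊆ J ⊆ {1, …, r-1}`. -/
def sumPhi : Matrix (Fin (r + 1) × ↥(Finset.Icc I (positions r)))
    (Fin (r + 1) × ↥(Finset.Icc I (positions r))) (CInf F)[X] :=
  Matrix.blockDiagonal fun J => PhiMatrix F s J.1

/-- The matrix of the direct sum of the trivializations `Ψ_J`, for `I ⊆ J ⊆ {1, …, r-1}`. -/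
def sumPsi : Matrix (Fin (r + 1) × ↥(Finset.Icc I (positions r)))
    (Fin (r + 1) × ↥(Finset.Icc I (positions r))) (PowerSeries (CInf F)) :=
  Matrix.blockDiagonal fun J => PsiMatrix F s J.1

end Construction

end CarlitzMZV

end

open Polynomial CarlitzMZV

noncomputable section

namespace CarlitzMZV

open scoped NNReal WithZero
open Polynomial

/-! ### The absolute value and the Frobenius powers on `CInf`. -/

section FieldFacts

variable (F : Type*) [Field F] [Fintype F]

/-! The proof rests on the values at $T=t$ of the twists of $\Omega^sH_{s-1}$ (`OmegaH`). The $d$-th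
twist takes the value $\Gamma_sS_d(s)/\tilde\pi^s$ for $d\ge0$ (`evalAtT_twist_OmegaH_natCast`, due
to Anderson and Thakur), and $0$ for $d<0$, because $\Omega^{(-1)}=(T-t)\Omega$ (`twist_Omega`). The
same functional equation shows that $\Omega^s$ times the polynomial delayed by $w$ is the $(-w)$-th
twist of $\Omega^sH_{s-1}$ (`Omega_pow_mul_delayedH`). Hence $L_{ab}(t)$ is a sum over strictly
decreasing $e$ of products of these values at $d_k=e_k-w_k$, and a tuple with some $d_k<0$
contributes nothing. Since $w_k$ drops by one exactly at the positions outside $I$, strict decrease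
of $e$ says that $d$ decreases weakly, and strictly at the positions of $I$
(`strictAnti_add_delay_iff`). This sum is $\zeta_{\ge I}$.

The interpolation formula holds because both sides satisfy one recursion in $s$. For $H_s$ it comes
from the generating series. For power sums it comes from the logarithmic derivative of
$\prod(X-a)=D_d(E_d-1)$, the product over monic $a$ of degree $d$, where $E_d$ is the Carlitz
polynomial (`prod_monicValues`). The coefficients match by `prod_eq_carlitzECoeff`.

The equation $\Phi\Psi=\Psi^{(-1)}$ reduces to a recursion for $L$, obtained by separating the
tuples with last exponent $0$ from the others (`twist_LMatrix_succ`). Convergence follows from one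
estimate: $\Omega^sH_{s-1}$ has Gauss norm below $1$ on a disc of radius above $1$
(`exists_gaussBound_OmegaH`), so its twists tend to zero on every disc. Only $w$ and not $w+1$
Frobenius roots of $t$ are needed, because $H_s$ involves only powers of $t^q$.

Finally $\zeta_I=\sum_{J\supseteq I}(-1)^{|J\setminus I|}\zeta_{\ge J}$ (`sum_weakMultizeta`). The
signs lie in $\mathbb F_q$, so a constant change of basis of the direct sum produces $\zeta_I$ as
one entry. The remaining properties are carried by `Uniformized`, which records inverses of $\Phi$
and $\Psi$ up to powers of $T-t$ and $\Omega$. It is stable under direct sums, constant base change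
and twisted duality, and duality turns the inverse of the period matrix into a period matrix. -/

theorem norm_add_le_max_KBar (x y : KBar F) : ‖x + y‖ ≤ max ‖x‖ ‖y‖ :=
  isNonarchimedean_spectralNorm (K := KInf F) (L := KBar F) x y

theorem norm_ofKBar (x : KBar F) : ‖ofKBar F x‖ = ‖x‖ :=
  UniformSpace.Completion.norm_coe x

/-- The spectral norm is nonarchimedean on the dense subfield `KBar F`, and the inequality is a
closed condition. -/
instance : IsUltrametricDist (CInf F) := by
  refine IsUltrametricDist.isUltrametricDist_of_forall_norm_add_le_max_norm fun x y => ?_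
  refine UniformSpace.Completion.induction_on₂ (α := KBar F) (β := KBar F)
    (p := fun x y : CInf F => ‖x + y‖ ≤ max ‖x‖ ‖y‖) x y ?_ ?_
  · exact isClosed_le (α := ℝ) (f := fun p : CInf F × CInf F => ‖p.1 + p.2‖)
      (g := fun p : CInf F × CInf F => max ‖p.1‖ ‖p.2‖) (by fun_prop) (by fun_prop)
  · intro a b
    have := norm_add_le_max_KBar F a b
    rw [← norm_ofKBar F (a + b), ← norm_ofKBar F a, ← norm_ofKBar F b, map_add] at this
    exact this

theorem one_lt_norm_tTilde : 1 < ‖tTilde F‖ := by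
  rw [tTilde, ofRatFunc, RingHom.comp_apply, norm_ofKBar, RingHom.comp_apply,
    norm_algebraMap', Valued.toNormedField.one_lt_norm_iff, valuation_X, ← WithZero.exp_zero, WithZero.exp_lt_exp]
  exact zero_lt_one

theorem norm_algebraMap_eq_one {c : F} (hc : c ≠ 0) : ‖algebraMap F (CInf F) c‖ = 1 := by
  have h := FiniteField.pow_card_sub_one_eq_one c hc
  have h2 := congrArg (fun c => ‖algebraMap F (CInf F) c‖) h
  simp only [map_pow, norm_pow, map_one, norm_one] at h2
  have := Fintype.one_lt_card (α := F)
  exact (pow_eq_one_iff_of_nonneg (norm_nonneg _) (by omega)).1 h2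

theorem norm_algebraMap_le_one (c : F) : ‖algebraMap F (CInf F) c‖ ≤ 1 := by
  rcases eq_or_ne c 0 with rfl | hc
  · simp
  · exact (norm_algebraMap_eq_one F hc).le

theorem norm_tElt : ‖tElt F‖ = ‖tTilde F‖ ^ (Fintype.card F - 1) := by
  rw [tElt, norm_neg, norm_pow]

theorem one_lt_norm_tElt : 1 < ‖tElt F‖ := by
  rw [norm_tElt]
  have := Fintype.one_lt_card (α := F)
  exact one_lt_pow₀ (one_lt_norm_tTilde F) (by omega)

theorem tTilde_ne_zero : tTilde F ≠ 0 :=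
  norm_pos_iff.1 (zero_lt_one.trans (one_lt_norm_tTilde F))

theorem tElt_ne_zero : tElt F ≠ 0 :=
  norm_pos_iff.1 (zero_lt_one.trans (one_lt_norm_tElt F))

/-- As $|t|>1$ and nonzero constants have norm one, the leading term strictly dominates. This gives
both the transcendence of $t$ and the decay of the power sums. -/
theorem norm_aeval_of_monic {a : F[X]} (ha : a.Monic) :
    ‖aeval (tElt F) a‖ = ‖tElt F‖ ^ a.natDegree := by
  have h1 := one_lt_norm_tElt F
  rw [aeval_eq_sum_range, Finset.sum_range_succ, ha.coeff_natDegree, one_smul]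
  rw [IsUltrametricDist.norm_add_eq_max_of_norm_ne_norm, max_eq_right, norm_pow]
  · refine IsUltrametricDist.norm_sum_le_of_forall_le_of_nonneg (norm_nonneg _) fun i hi => ?_
    rw [Algebra.smul_def, norm_mul, norm_pow, norm_pow]
    refine (mul_le_of_le_one_left (by positivity) (norm_algebraMap_le_one F _)).trans ?_
    exact pow_le_pow_right₀ h1.le (by simpa using (Finset.mem_range.1 hi).le)
  · refine ne_of_lt ?_
    rw [norm_pow]
    rcases Nat.eq_zero_or_pos a.natDegree with h | h
    · simp [h]
    refine (IsUltrametricDist.norm_sum_le_of_forall_le_of_nonneg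
      (C := ‖tElt F‖ ^ (a.natDegree - 1)) (by positivity) fun i hi => ?_).trans_lt
      (pow_lt_pow_right₀ h1 (by omega))
    rw [Algebra.smul_def, norm_mul, norm_pow]
    refine (mul_le_of_le_one_left (by positivity) (norm_algebraMap_le_one F _)).trans ?_
    have := Finset.mem_range.1 hi
    exact pow_le_pow_right₀ h1.le (by omega)

theorem aeval_tElt_injective : Function.Injective (aeval (tElt F) : F[X] →ₐ[F] CInf F) := by
  rw [injective_iff_map_eq_zero]
  intro a ha
  by_contra h
  have hm := norm_aeval_of_monic F (monic_mul_leadingCoeff_inv h)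
  rw [map_mul, ha, zero_mul, norm_zero] at hm
  exact (pow_pos (zero_lt_one.trans (one_lt_norm_tElt F)) _).ne hm

/-! Frobenius powers -/

theorem frob_apply (x : CInf F) : frob F x = x ^ Fintype.card F := rfl

theorem frobPow_natCast (n : ℕ) (x : CInf F) :
    frobPow F n x = x ^ Fintype.card F ^ n := by
  rw [frobPow, zpow_natCast]
  induction n with
  | zero => simp
  | succ n ih =>
    rw [pow_succ', RingAut.mul_apply, ih, frob_apply, ← pow_mul, pow_succ]

theorem frobPow_add (m n : ℤ) (x : CInf F) :
    frobPow F (m + n) x = frobPow F m (frobPow F n x) := by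
  simp only [frobPow, zpow_add, RingAut.mul_apply]

theorem frobPow_zero (x : CInf F) : frobPow F 0 x = x := by simp [frobPow]

theorem frobPow_neg_natCast_pow (n : ℕ) (x : CInf F) :
    frobPow F (-(n : ℤ)) x ^ Fintype.card F ^ n = x := by
  rw [← frobPow_natCast, ← frobPow_add, add_neg_cancel, frobPow_zero]

theorem frobPow_algebraMap (n : ℤ) (c : F) :
    frobPow F n (algebraMap F (CInf F) c) = algebraMap F (CInf F) c := by
  have h : ∀ n : ℕ, frobPow F n (algebraMap F (CInf F) c) = algebraMap F (CInf F) c := by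
    intro n
    rw [frobPow_natCast, ← map_pow, FiniteField.pow_card_pow]
  obtain ⟨m, rfl | rfl⟩ := n.eq_nat_or_neg
  · exact h m
  · conv_lhs => rw [← h m]
    rw [← frobPow_add, neg_add_cancel, frobPow_zero]

theorem norm_frobPow_natCast (n : ℕ) (x : CInf F) :
    ‖frobPow F n x‖ = ‖x‖ ^ Fintype.card F ^ n := by
  rw [frobPow_natCast, norm_pow]

/-- For a negative exponent $-m$, additivity shows that the $q^m$-th power of the distance of the
images is the distance of the arguments, whence $\delta=\varepsilon^{q^m}$. -/
theorem continuous_frobPow (n : ℤ) : Continuous (frobPow F n) := by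
  obtain ⟨m, rfl | rfl⟩ := n.eq_nat_or_neg
  · have : (frobPow F (m : ℤ) : CInf F → CInf F) = fun x => x ^ Fintype.card F ^ m :=
      funext (frobPow_natCast F m)
    rw [this]
    fun_prop
  · rw [Metric.continuous_iff]
    intro x ε hε
    refine ⟨ε ^ Fintype.card F ^ m, by positivity, fun y hy => ?_⟩
    rw [dist_eq_norm] at hy ⊢
    rw [← map_sub]
    refine lt_of_pow_lt_pow_left₀ (Fintype.card F ^ m) hε.le ?_
    rwa [← norm_pow, frobPow_neg_natCast_pow]

end FieldFacts

/-! ### Gauss norms and entire power series over an ultrametric field. -/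

section GaussBound

variable {K : Type*} [NormedField K]

/-- The power series `f` has Gauss norm at most `C` on the disc of radius `ρ`. -/
def GaussBound (ρ C : ℝ) (f : PowerSeries K) : Prop :=
  ∀ n, ‖PowerSeries.coeff n f‖ * ρ ^ n ≤ C

theorem GaussBound.nonneg {ρ C : ℝ} {f : PowerSeries K} (h : GaussBound ρ C f) : 0 ≤ C := by
  have := h 0
  rw [pow_zero, mul_one] at this
  exact (norm_nonneg _).trans this

theorem GaussBound.mono {ρ C D : ℝ} {f : PowerSeries K} (h : GaussBound ρ C f) (hCD : C ≤ D) :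
    GaussBound ρ D f := fun n => (h n).trans hCD

theorem GaussBound.mono_radius {ρ ρ' C : ℝ} {f : PowerSeries K} (h : GaussBound ρ' C f)
    (h0 : 0 ≤ ρ) (hρ : ρ ≤ ρ') : GaussBound ρ C f := fun n =>
  (mul_le_mul_of_nonneg_left (pow_le_pow_left₀ h0 hρ n) (norm_nonneg _)).trans (h n)

theorem GaussBound.C (ρ : ℝ) (c : K) : GaussBound ρ ‖c‖ (PowerSeries.C c) := by
  intro n
  rw [PowerSeries.coeff_C]
  split_ifs with h
  · simp [h]
  · simp

theorem GaussBound.one (ρ : ℝ) : GaussBound ρ 1 (1 : PowerSeries K) := by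
  simpa using GaussBound.C ρ (1 : K)

theorem GaussBound.zero (ρ : ℝ) : GaussBound ρ 0 (0 : PowerSeries K) := by
  simpa using GaussBound.C ρ (0 : K)

theorem GaussBound.neg {ρ C : ℝ} {f : PowerSeries K} (hf : GaussBound ρ C f) :
    GaussBound ρ C (-f) := fun n => by
  rw [map_neg, norm_neg]
  exact hf n

theorem GaussBound.X {ρ : ℝ} (hρ : 0 ≤ ρ) : GaussBound ρ ρ (PowerSeries.X : PowerSeries K) := by
  intro n
  rw [PowerSeries.coeff_X]
  split_ifs with h
  · simp [h]
  · simpa using hρ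

theorem GaussBound.of_tendsto {ι : Type*} {l : Filter ι} [l.NeBot] {ρ C : ℝ}
    {g : ι → PowerSeries K} {f : PowerSeries K} (hg : ∀ i, GaussBound ρ C (g i))
    (h : ∀ n, Filter.Tendsto (fun i => PowerSeries.coeff n (g i)) l
      (nhds (PowerSeries.coeff n f))) : GaussBound ρ C f := fun n =>
  le_of_tendsto (((h n).norm).mul_const _) (Filter.Eventually.of_forall fun i => hg i n)

theorem GaussBound.tendsto {ρ ρ' C : ℝ} {f : PowerSeries K} (h : GaussBound ρ' C f)
    (h0 : 0 ≤ ρ) (hρ : ρ < ρ') :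
    Filter.Tendsto (fun n => ‖PowerSeries.coeff n f‖ * ρ ^ n) Filter.atTop (nhds 0) := by
  have hp : 0 < ρ' := h0.trans_lt hρ
  refine squeeze_zero (fun n => by positivity) (g := fun n => C * (ρ / ρ') ^ n) (fun n => ?_) ?_
  · have : ρ ^ n = ρ' ^ n * (ρ / ρ') ^ n := by
      rw [← mul_pow]
      congr 1
      field_simp
    rw [this, ← mul_assoc]
    exact mul_le_mul_of_nonneg_right (h n) (by positivity)
  · have := (tendsto_pow_atTop_nhds_zero_of_lt_one (r := ρ / ρ') (by positivity)
      ((div_lt_one hp).2 hρ)).const_mul C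
    simpa using this

theorem GaussBound.norm_coeff_mul_pow_le {R C : ℝ} {f : PowerSeries K} (h : GaussBound R C f)
    (hR : 0 < R) (x : K) (n : ℕ) :
    ‖PowerSeries.coeff n f * x ^ n‖ ≤ C * (‖x‖ / R) ^ n := by
  have : ‖x‖ ^ n = R ^ n * (‖x‖ / R) ^ n := by
    rw [← mul_pow]
    congr 1
    field_simp
  rw [norm_mul, norm_pow, this, ← mul_assoc]
  exact mul_le_mul_of_nonneg_right (h n) (by positivity)

theorem GaussBound.summable_norm {R C : ℝ} {f : PowerSeries K} {x : K} (h : GaussBound R C f)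
    (hx : ‖x‖ < R) : Summable fun n => ‖PowerSeries.coeff n f * x ^ n‖ := by
  have hR : 0 < R := (norm_nonneg _).trans_lt hx
  refine Summable.of_nonneg_of_le (fun n => norm_nonneg _)
    (h.norm_coeff_mul_pow_le hR x) ?_
  exact (summable_geometric_of_lt_one (by positivity) ((div_lt_one hR).2 hx)).mul_left C

theorem exists_gaussBound_polynomial {ρ : ℝ} (hρ : 0 ≤ ρ) (p : K[X]) :
    ∃ C, GaussBound ρ C (p : PowerSeries K) := by
  refine ⟨∑ n ∈ p.support, ‖p.coeff n‖ * ρ ^ n, fun n => ?_⟩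
  rw [Polynomial.coeff_coe]
  by_cases h : n ∈ p.support
  · exact Finset.single_le_sum (f := fun n => ‖p.coeff n‖ * ρ ^ n)
      (fun i _ => by positivity) h
  · rw [Polynomial.notMem_support_iff.1 h, norm_zero, zero_mul]
    exact Finset.sum_nonneg fun i _ => by positivity

variable [IsUltrametricDist K]

theorem norm_sum_mul_le {ι : Type*} {s : Finset ι} {f : ι → K} {c D : ℝ} (hc : 0 ≤ c) (hD : 0 ≤ D)
    (h : ∀ i ∈ s, ‖f i‖ * c ≤ D) : ‖∑ i ∈ s, f i‖ * c ≤ D := by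
  rcases eq_or_lt_of_le hc with rfl | hc
  · simpa using hD
  rw [← le_div_iff₀ hc]
  exact IsUltrametricDist.norm_sum_le_of_forall_le_of_nonneg (by positivity) fun i hi =>
    (le_div_iff₀ hc).2 (h i hi)

theorem GaussBound.add {ρ C : ℝ} (hρ : 0 ≤ ρ) {f g : PowerSeries K} (hf : GaussBound ρ C f)
    (hg : GaussBound ρ C g) : GaussBound ρ C (f + g) := fun n => by
  rw [map_add]
  refine (mul_le_mul_of_nonneg_right (IsUltrametricDist.norm_add_le_max _ _) (by positivity)).trans ?_
  rw [max_mul_of_nonneg _ _ (by positivity)]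
  exact max_le (hf n) (hg n)

theorem GaussBound.mul {ρ C D : ℝ} (hρ : 0 ≤ ρ) {f g : PowerSeries K} (hf : GaussBound ρ C f)
    (hg : GaussBound ρ D g) : GaussBound ρ (C * D) (f * g) := fun n => by
  have hC := hf.nonneg
  have hD := hg.nonneg
  rw [PowerSeries.coeff_mul]
  refine norm_sum_mul_le (by positivity) (by positivity) fun ij hij => ?_
  rw [norm_mul, ← Finset.HasAntidiagonal.mem_antidiagonal.1 hij, pow_add]
  calc _ = (‖PowerSeries.coeff ij.1 f‖ * ρ ^ ij.1) * (‖PowerSeries.coeff ij.2 g‖ * ρ ^ ij.2) := by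
        ring
    _ ≤ _ := mul_le_mul (hf _) (hg _) (by positivity) hC

theorem GaussBound.prod {ι : Type*} {ρ : ℝ} (hρ : 0 ≤ ρ) (s : Finset ι) {C : ι → ℝ}
    {f : ι → PowerSeries K} (h : ∀ i ∈ s, GaussBound ρ (C i) (f i)) :
    GaussBound ρ (∏ i ∈ s, C i) (∏ i ∈ s, f i) := by
  classical
  induction s using Finset.induction_on with
  | empty => simpa using GaussBound.one ρ
  | insert i s hi ih =>
    rw [Finset.prod_insert hi, Finset.prod_insert hi]
    exact (h i (by simp)).mul hρ (ih fun j hj => h j (by simp [hj]))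

theorem GaussBound.pow {ρ C : ℝ} (hρ : 0 ≤ ρ) {f : PowerSeries K} (hf : GaussBound ρ C f) (n : ℕ) :
    GaussBound ρ (C ^ n) (f ^ n) := by
  simpa using GaussBound.prod hρ (Finset.range n) (C := fun _ => C) (f := fun _ => f) fun _ _ => hf

theorem GaussBound.sum {ι : Type*} {ρ C : ℝ} (hρ : 0 ≤ ρ) (hC : 0 ≤ C) (s : Finset ι)
    {f : ι → PowerSeries K} (h : ∀ i ∈ s, GaussBound ρ C (f i)) :
    GaussBound ρ C (∑ i ∈ s, f i) := by
  classical
  induction s using Finset.induction_on with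
  | empty => simpa using (GaussBound.zero ρ).mono hC
  | insert i s hi ih =>
    rw [Finset.sum_insert hi]
    exact (h i (by simp)).add hρ (ih fun j hj => h j (by simp [hj]))

/-- A power series with constant coefficient one and Gauss norm at most one has an inverse with Gauss
norm at most one. -/
theorem GaussBound.inv {ρ : ℝ} (hρ : 0 ≤ ρ) {f : PowerSeries K} (hf : GaussBound ρ 1 f)
    (h0 : PowerSeries.constantCoeff f = 1) : GaussBound ρ 1 f⁻¹ := by
  intro n
  induction n using Nat.strong_induction_on with
  | _ n ih =>
  rw [PowerSeries.coeff_inv]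
  split_ifs with hn
  · simp [hn, h0]
  rw [h0, inv_one, neg_one_mul, norm_neg]
  refine norm_sum_mul_le (by positivity) zero_le_one fun ij hij => ?_
  split_ifs with hlt
  · rw [norm_mul, ← Finset.HasAntidiagonal.mem_antidiagonal.1 hij, pow_add]
    calc _ = (‖PowerSeries.coeff ij.1 f‖ * ρ ^ ij.1) * (‖PowerSeries.coeff ij.2 f⁻¹‖ * ρ ^ ij.2) := by
          ring
      _ ≤ 1 * 1 := mul_le_mul (hf _) (ih _ hlt) (by positivity) zero_le_one
      _ = 1 := one_mul 1
  · simp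

variable (K) in
/-- The power series which are bounded on the disc of radius `ρ`. -/
def boundedOn {ρ : ℝ} (hρ : 0 ≤ ρ) : Subring (PowerSeries K) where
  carrier := {f | ∃ C, GaussBound ρ C f}
  one_mem' := ⟨1, GaussBound.one ρ⟩
  zero_mem' := ⟨0, GaussBound.zero ρ⟩
  mul_mem' := fun ⟨C, hC⟩ ⟨D, hD⟩ => ⟨C * D, hC.mul hρ hD⟩
  add_mem' := fun ⟨C, hC⟩ ⟨D, hD⟩ => ⟨max C D, (hC.mono (le_max_left _ _)).add hρ
    (hD.mono (le_max_right _ _))⟩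
  neg_mem' := fun ⟨C, hC⟩ => ⟨C, hC.neg⟩

variable (K) in
/-- The everywhere convergent power series. -/
def entire : Subring (PowerSeries K) := ⨅ ρ : ℝ≥0, boundedOn K ρ.2

theorem mem_entire {f : PowerSeries K} :
    f ∈ entire K ↔ ∀ ρ : ℝ, 0 ≤ ρ → ∃ C, GaussBound ρ C f := by
  rw [entire, Subring.mem_iInf]
  exact ⟨fun h ρ hρ => h ⟨ρ, hρ⟩, fun h ρ => h ρ ρ.2⟩

theorem entire_le_boundedOn {ρ : ℝ} (hρ : 0 ≤ ρ) : entire K ≤ boundedOn K hρ := fun _ hf =>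
  mem_entire.1 hf ρ hρ

theorem coe_mem_entire (p : K[X]) : (p : PowerSeries K) ∈ entire K :=
  mem_entire.2 fun _ hρ => exists_gaussBound_polynomial hρ p

theorem C_mem_entire (c : K) : PowerSeries.C c ∈ entire K :=
  mem_entire.2 fun ρ _ => ⟨_, GaussBound.C ρ c⟩

theorem entire.exists_gaussBound_gt {f : PowerSeries K} (hf : f ∈ entire K) (x : K) :
    ∃ R C, ‖x‖ < R ∧ GaussBound R C f := by
  obtain ⟨C, hC⟩ := mem_entire.1 hf (‖x‖ + 1) (by positivity)
  exact ⟨_, C, lt_add_one _, hC⟩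

variable [CompleteSpace K]

/-- Evaluation of everywhere convergent power series. -/
def evalEntire (x : K) : entire K →+* K where
  toFun f := ∑' n, PowerSeries.coeff n f.1 * x ^ n
  map_one' := by
    rw [tsum_eq_single 0]
    · simp
    · intro n hn
      simp [PowerSeries.coeff_one, hn]
  map_zero' := by simp
  map_add' f g := by
    obtain ⟨R, C, hR, hC⟩ := entire.exists_gaussBound_gt f.2 x
    obtain ⟨R', C', hR', hC'⟩ := entire.exists_gaussBound_gt g.2 x
    rw [← (hC.summable_norm hR).of_norm.tsum_add (hC'.summable_norm hR').of_norm]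
    simp [add_mul]
  map_mul' f g := by
    obtain ⟨R, C, hR, hC⟩ := entire.exists_gaussBound_gt f.2 x
    obtain ⟨R', C', hR', hC'⟩ := entire.exists_gaussBound_gt g.2 x
    rw [tsum_mul_tsum_eq_tsum_sum_antidiagonal_of_summable_norm (hC.summable_norm hR)
      (hC'.summable_norm hR')]
    refine tsum_congr fun n => ?_
    rw [Subring.coe_mul, PowerSeries.coeff_mul, Finset.sum_mul]
    refine Finset.sum_congr rfl fun ij hij => ?_
    rw [← Finset.HasAntidiagonal.mem_antidiagonal.1 hij, pow_add]
    ring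

theorem summable_of_norm_le {ι : Type*} {f : ι → K} {c : ι → ℝ} (hf : ∀ i, ‖f i‖ ≤ c i)
    (hc : Filter.Tendsto c Filter.cofinite (nhds 0)) : Summable f :=
  NonarchimedeanAddGroup.summable_of_tendsto_cofinite_zero (squeeze_zero_norm hf hc)

/-- The double family is bounded by $c_i(\|x\|/R)^n$, which tends to zero along the cofinite filter.
In a complete ultrametric field this already gives summability, so the two orders of summation
agree. -/
theorem hasSum_eval {ι : Type*} {f : ι → PowerSeries K} {g : PowerSeries K} {c : ι → ℝ} {R : ℝ}
    {x : K} (hx : ‖x‖ < R) (hf : ∀ i, GaussBound R (c i) (f i))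
    (hc : Filter.Tendsto c Filter.cofinite (nhds 0))
    (hg : ∀ n, HasSum (fun i => PowerSeries.coeff n (f i)) (PowerSeries.coeff n g)) :
    HasSum (fun i => ∑' n, PowerSeries.coeff n (f i) * x ^ n)
      (∑' n, PowerSeries.coeff n g * x ^ n) := by
  have hR : 0 < R := (norm_nonneg _).trans_lt hx
  have hs : Summable fun p : ι × ℕ => PowerSeries.coeff p.2 (f p.1) * x ^ p.2 := by
    refine summable_of_norm_le (fun p => (hf p.1).norm_coeff_mul_pow_le hR x p.2) ?_
    refine tendsto_mul_cofinite_nhds_zero hc (g := fun n => (‖x‖ / R) ^ n) ?_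
    rw [Nat.cofinite_eq_atTop]
    exact tendsto_pow_atTop_nhds_zero_of_lt_one (by positivity) ((div_lt_one hR).2 hx)
  have h1 := hs.hasSum.prod_fiberwise fun i => (((hf i).summable_norm hx).of_norm).hasSum
  have h2 := hs.prod_symm.hasSum.prod_fiberwise fun n => (hg n).mul_right (x ^ n)
  rw [h2.tsum_eq]
  have h3 := (Equiv.prodComm ℕ ι).tsum_eq fun p : ι × ℕ =>
    PowerSeries.coeff p.2 (f p.1) * x ^ p.2
  rw [← h3] at h1
  exact h1

end GaussBound

/-! ### Twisting and evaluation at $T=t$. -/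

section TwistBounds

variable (F : Type*) [Field F] [Fintype F]

theorem isEntire_of_mem {f : PowerSeries (CInf F)} (hf : f ∈ entire (CInf F)) : IsEntire F f := by
  intro ρ
  obtain ⟨C, hC⟩ := mem_entire.1 hf (|ρ| + 1) (by positivity)
  rw [tendsto_zero_iff_norm_tendsto_zero]
  simpa using hC.tendsto (abs_nonneg ρ) (lt_add_one _)

theorem isTate_of_mem {ρ : ℝ} (hρ : 1 < ρ) {f : PowerSeries (CInf F)}
    (hf : f ∈ boundedOn (CInf F) (zero_le_one.trans hρ.le)) : IsTate F f := by
  obtain ⟨C, hC⟩ := hf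
  simpa [IsTate] using hC.tendsto zero_le_one hρ

variable {F}

theorem coeff_twist (k : ℤ) (f : PowerSeries (CInf F)) (n : ℕ) :
    PowerSeries.coeff n (twist F k f) = frobPow F k (PowerSeries.coeff n f) := by
  simp [twist]

theorem twist_coe (k : ℤ) (p : (CInf F)[X]) :
    twist F k (p : PowerSeries (CInf F)) = (twistPoly F k p : PowerSeries (CInf F)) := by
  ext n
  simp [coeff_twist, twistPoly]

theorem twist_add (m n : ℤ) (f : PowerSeries (CInf F)) :
    twist F (m + n) f = twist F m (twist F n f) := by
  ext i
  simp only [coeff_twist, frobPow_add]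

theorem twist_zero (f : PowerSeries (CInf F)) : twist F 0 f = f := by
  ext i
  simp only [coeff_twist, frobPow_zero]

theorem twistPoly_add (m n : ℤ) (f : (CInf F)[X]) :
    twistPoly F (m + n) f = twistPoly F m (twistPoly F n f) := by
  ext i
  simp [twistPoly, frobPow_add]

theorem twistPoly_zero (f : (CInf F)[X]) : twistPoly F 0 f = f := by
  ext i
  simp [twistPoly, frobPow_zero]

/-- Twisting raises the coefficients to the power $q^k$ but leaves $T$ alone, so the radius has to
be raised to the same power. -/
theorem GaussBound.twist {ρ C : ℝ} {f : PowerSeries (CInf F)} (hf : GaussBound ρ C f)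
    (hρ : 0 ≤ ρ) (k : ℕ) :
    GaussBound (ρ ^ Fintype.card F ^ k) (C ^ Fintype.card F ^ k) (twist F k f) := fun n => by
  rw [coeff_twist, norm_frobPow_natCast, ← pow_mul, mul_comm _ n, pow_mul, ← mul_pow]
  exact pow_le_pow_left₀ (by positivity) (hf n) _

theorem twist_mem_entire {f : PowerSeries (CInf F)} (hf : f ∈ entire (CInf F)) (k : ℤ) :
    twist F k f ∈ entire (CInf F) := by
  refine mem_entire.2 fun ρ hρ => ?_
  obtain ⟨m, rfl | rfl⟩ := k.eq_nat_or_neg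
  -- The radius is taken at least $1$ so that its $q^m$-th power still exceeds $\rho$.
  · obtain ⟨C, hC⟩ := mem_entire.1 hf (max ρ 1) (by positivity)
    refine ⟨_, (hC.twist (by positivity) m).mono_radius hρ ?_⟩
    refine (le_max_left ρ 1).trans (le_self_pow₀ (le_max_right _ _) ?_)
    exact (pow_pos Fintype.card_pos _).ne'
  · obtain ⟨C, hC⟩ := mem_entire.1 hf (ρ ^ Fintype.card F ^ m) (by positivity)
    have hC0 := hC.nonneg
    -- Only a $q^m$-th root of $C$ is needed; `max C 1` dominates it without taking roots.
    refine ⟨max C 1, fun n => ?_⟩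
    have hq : Fintype.card F ^ m ≠ 0 := (pow_pos Fintype.card_pos _).ne'
    refine le_of_pow_le_pow_left₀ hq (by positivity) ?_
    rw [mul_pow, ← norm_pow, coeff_twist, frobPow_neg_natCast_pow, ← pow_mul, mul_comm n, pow_mul]
    exact (hC n).trans ((le_max_left _ _).trans (le_self_pow₀ (le_max_right _ _) hq))

theorem evalAtT_eq {f : PowerSeries (CInf F)} (hf : f ∈ entire (CInf F)) :
    evalAtT F f = evalEntire (tElt F) ⟨f, hf⟩ := rfl

theorem evalAtT_coe (p : (CInf F)[X]) :
    evalAtT F (p : PowerSeries (CInf F)) = p.eval (tElt F) := by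
  rw [evalAtT, Polynomial.eval_eq_sum_range, tsum_eq_sum (s := Finset.range (p.natDegree + 1))]
  · simp
  · intro n hn
    rw [Polynomial.coeff_coe, Polynomial.coeff_eq_zero_of_natDegree_lt, zero_mul]
    simpa using hn

theorem evalAtT_mul {f g : PowerSeries (CInf F)} (hf : f ∈ entire (CInf F))
    (hg : g ∈ entire (CInf F)) : evalAtT F (f * g) = evalAtT F f * evalAtT F g := by
  rw [evalAtT_eq hf, evalAtT_eq hg, ← map_mul]
  rfl

theorem evalAtT_add {f g : PowerSeries (CInf F)} (hf : f ∈ entire (CInf F))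
    (hg : g ∈ entire (CInf F)) : evalAtT F (f + g) = evalAtT F f + evalAtT F g := by
  rw [evalAtT_eq hf, evalAtT_eq hg, ← map_add]
  rfl

theorem evalAtT_pow {f : PowerSeries (CInf F)} (hf : f ∈ entire (CInf F)) (n : ℕ) :
    evalAtT F (f ^ n) = evalAtT F f ^ n := by
  rw [evalAtT_eq hf, ← map_pow]
  rfl

theorem evalAtT_prod {ι : Type*} {f : ι → PowerSeries (CInf F)}
    (hf : ∀ i, f i ∈ entire (CInf F)) (s : Finset ι) :
    evalAtT F (∏ i ∈ s, f i) = ∏ i ∈ s, evalAtT F (f i) := by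
  classical
  induction s using Finset.induction_on with
  | empty =>
    rw [Finset.prod_empty, Finset.prod_empty, evalAtT_eq (one_mem _)]
    exact map_one _
  | insert i s hi ih =>
    rw [Finset.prod_insert hi, Finset.prod_insert hi, evalAtT_mul (hf i) (prod_mem fun i _ => hf i),
      ih]

end TwistBounds

/-! ### The function $\Omega$: functional equation, growth, zeros. -/

section OmegaFacts

variable (F : Type*) [Field F] [Fintype F]

/-- The `i`-th factor of the product defining `Ω`. -/
def omegaFactor (i : ℕ) : PowerSeries (CInf F) :=
  1 - PowerSeries.C ((tElt F ^ Fintype.card F ^ i)⁻¹) * PowerSeries.X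

open scoped PowerSeries.WithPiTopology in
theorem continuous_twist (k : ℤ) : Continuous (twist F k) := by
  refine continuous_iff_continuousAt.2 fun f => ?_
  refine (PowerSeries.WithPiTopology.tendsto_iff_coeff_tendsto _ _ _ _).2 fun n => ?_
  simp only [coeff_twist]
  exact ((continuous_frobPow F k).comp
    (PowerSeries.WithPiTopology.continuous_coeff (CInf F) n)).continuousAt

theorem le_card_pow (i : ℕ) : i ≤ Fintype.card F ^ i :=
  (Nat.lt_pow_self Fintype.one_lt_card).le

theorem summable_norm_inv_pow :
    Summable fun i : ℕ => ‖(tElt F ^ Fintype.card F ^ (i + 1))⁻¹‖ := by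
  have h1 := one_lt_norm_tElt F
  refine Summable.of_nonneg_of_le (fun _ => norm_nonneg _) (f := fun i => ‖tElt F‖⁻¹ ^ i)
    (fun i => ?_) (summable_geometric_of_lt_one (by positivity) (inv_lt_one_of_one_lt₀ h1))
  rw [norm_inv, norm_pow, inv_pow]
  refine inv_anti₀ (by positivity) (pow_le_pow_right₀ h1.le ?_)
  exact (Nat.le_succ i).trans (le_card_pow F (i + 1))

-- Expanding the product over finite sets of indices, each coefficient is dominated by the expansion
-- of $\prod(1+|t|^{-q^{i+1}})$, which converges.
open scoped PowerSeries.WithPiTopology in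
theorem multipliable_omegaFactor : Multipliable fun i : ℕ => omegaFactor F (i + 1) := by
  have h := multipliable_one_add_of_summable_prod (α := PowerSeries (CInf F))
    (f := fun i : ℕ => -(PowerSeries.C ((tElt F ^ Fintype.card F ^ (i + 1))⁻¹) * PowerSeries.X)) ?_
  · simpa only [omegaFactor, sub_eq_add_neg] using h
  rw [PowerSeries.WithPiTopology.summable_iff_summable_coeff]
  intro n
  refine Summable.of_norm_bounded
    (summable_finsetProd_of_summable_nonneg (fun _ => norm_nonneg _) (summable_norm_inv_pow F))
    fun s => ?_
  rw [Finset.prod_neg, Finset.prod_mul_distrib, ← map_prod, Finset.prod_const, ← norm_prod,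
    ← map_one PowerSeries.C, ← map_neg, ← map_pow, ← mul_assoc, ← map_mul,
    PowerSeries.coeff_C_mul_X_pow]
  split_ifs
  · rw [norm_mul, norm_pow, norm_neg, norm_one, one_pow, one_mul]
  · rw [norm_zero]
    exact norm_nonneg _

open scoped PowerSeries.WithPiTopology in
/-- The infinite product in the definition of `Ω`. -/
def omegaProd : PowerSeries (CInf F) := ∏' i : ℕ, omegaFactor F (i + 1)

theorem Omega_eq : Omega F = PowerSeries.C ((tTilde F ^ Fintype.card F)⁻¹) * omegaProd F := rfl

open scoped PowerSeries.WithPiTopology in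
theorem hasProd_omegaProd : HasProd (fun i : ℕ => omegaFactor F (i + 1)) (omegaProd F) :=
  (multipliable_omegaFactor F).hasProd

open scoped PowerSeries.WithPiTopology in
theorem tendsto_coeff_omegaProd (n : ℕ) : Filter.Tendsto
    (fun N => PowerSeries.coeff n (∏ i ∈ Finset.range N, omegaFactor F (i + 1))) Filter.atTop
    (nhds (PowerSeries.coeff n (omegaProd F))) :=
  (PowerSeries.WithPiTopology.tendsto_iff_coeff_tendsto _ _ _ _).1
    (hasProd_omegaProd F).tendsto_prod_nat n

theorem constantCoeff_omegaProd : PowerSeries.constantCoeff (omegaProd F) = 1 := by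
  have h := tendsto_coeff_omegaProd F 0
  simp only [PowerSeries.coeff_zero_eq_constantCoeff, map_prod, omegaFactor, map_sub, map_mul,
    PowerSeries.constantCoeff_X, mul_zero, map_one, sub_zero, Finset.prod_const_one] at h
  exact tendsto_nhds_unique h tendsto_const_nhds

/-- The radius is the norm of the smallest zero $t^q$; up to there every factor has Gauss norm at
most one. -/
theorem gaussBound_omegaProd : GaussBound (‖tElt F‖ ^ Fintype.card F) 1 (omegaProd F) := by
  have h1 := one_lt_norm_tElt F
  refine GaussBound.of_tendsto (fun N => ?_) (tendsto_coeff_omegaProd F)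
  have := GaussBound.prod (K := CInf F) (ρ := ‖tElt F‖ ^ Fintype.card F) (by positivity)
    (Finset.range N) (C := fun _ => 1) (f := fun i => omegaFactor F (i + 1)) fun i _ => ?_
  · simpa using this
  rw [omegaFactor, sub_eq_add_neg]
  refine (GaussBound.one _).add (by positivity) ?_
  refine (((GaussBound.C _ _).mul (by positivity) (GaussBound.X (by positivity))).neg).mono ?_
  rw [norm_inv, norm_pow, inv_mul_le_one₀ (by positivity)]
  exact pow_le_pow_right₀ h1.le (Nat.le_self_pow (by omega) _)

theorem frobPow_neg_one_pow (x : CInf F) (i : ℕ) :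
    frobPow F (-1) (x ^ Fintype.card F ^ (i + 1)) = x ^ Fintype.card F ^ i := by
  rw [← frobPow_natCast, ← frobPow_add, ← frobPow_natCast]
  congr 2
  push_cast
  ring

theorem twist_omegaFactor (i : ℕ) :
    twist F (-1) (omegaFactor F (i + 1)) = omegaFactor F i := by
  rw [omegaFactor, omegaFactor, map_sub, map_mul, map_one]
  simp only [twist, PowerSeries.map_C, PowerSeries.map_X, RingEquiv.coe_toRingHom, map_inv₀,
    frobPow_neg_one_pow]

-- The twist moves every factor down by one index, so the only change is a new factor $1-T/t$ at
-- index $0$.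
open scoped PowerSeries.WithPiTopology in
theorem twist_omegaProd : twist F (-1) (omegaProd F) = omegaFactor F 0 * omegaProd F := by
  have h1 := (hasProd_omegaProd F).map (twist F (-1)) (continuous_twist F (-1))
  have h2 := (hasProd_omegaProd F).zero_mul
  have h3 : twist F (-1) ∘ (fun i => omegaFactor F (i + 1)) = omegaFactor F :=
    funext (twist_omegaFactor F)
  rw [h3] at h1
  exact h1.unique h2

/-- The polynomial `T - t` as a power series. -/
theorem coe_X_sub_C (x : CInf F) : ((X - Polynomial.C x : (CInf F)[X]) : PowerSeries (CInf F)) =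
    PowerSeries.X - PowerSeries.C x := by simp

theorem twist_Omega : twist F (-1) (Omega F) =
    ((X - Polynomial.C (tElt F) : (CInf F)[X]) : PowerSeries (CInf F)) * Omega F := by
  rw [Omega_eq, map_mul, twist_omegaProd, ← mul_assoc, ← mul_assoc]
  congr 1
  have ht := tElt_ne_zero F
  have ht' := tTilde_ne_zero F
  have hq := Fintype.one_lt_card (α := F)
  have h1 : twist F (-1) (PowerSeries.C (tTilde F ^ Fintype.card F)⁻¹) =
      PowerSeries.C (tTilde F)⁻¹ := by
    have := frobPow_neg_one_pow F (tTilde F) 0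
    simp only [zero_add, pow_one, pow_zero] at this
    simp [twist, this]
  -- Here the normalisation $t=-\tilde t^{\,q-1}$ enters: it makes the constant $-t$, which turns
  -- the new factor $1-T/t$ into $T-t$.
  have h2 : (tTilde F)⁻¹ = - tElt F * (tTilde F ^ Fintype.card F)⁻¹ := by
    rw [tElt, neg_neg, eq_mul_inv_iff_mul_eq₀ (pow_ne_zero _ ht')]
    rw [← mul_right_inj' ht', ← mul_assoc, mul_inv_cancel₀ ht', one_mul, ← pow_succ',
      Nat.sub_add_cancel hq.le]
  have h3 : - tElt F * (tElt F)⁻¹ = -1 := by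
    rw [neg_mul, mul_inv_cancel₀ ht]
  rw [h1, h2, omegaFactor, coe_X_sub_C, map_mul]
  have h4 : PowerSeries.C (-tElt F) * PowerSeries.C (tElt F)⁻¹ = -1 := by
    rw [← map_mul, h3, map_neg, map_one]
  rw [pow_zero, pow_one]
  rw [map_neg] at h4 ⊢
  linear_combination (-PowerSeries.C (tTilde F ^ Fintype.card F)⁻¹ * PowerSeries.X) * h4

theorem twist_twist_Omega (k : ℤ) : twist F (k - 1) (Omega F) =
    (twistPoly F k (X - Polynomial.C (tElt F)) : PowerSeries (CInf F)) * twist F k (Omega F) := by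
  rw [sub_eq_add_neg, twist_add, twist_Omega, map_mul, twist_coe]

/-- This is the origin of the product $(T-t)^{(0)}\cdots(T-t)^{(-w+1)}$ in the delayed polynomials.
-/
theorem twist_neg_Omega (w : ℕ) : twist F (-(w : ℤ)) (Omega F) =
    ((∏ m ∈ Finset.range w, twistPoly F (-(m : ℤ)) (X - Polynomial.C (tElt F)) : (CInf F)[X]) :
      PowerSeries (CInf F)) * Omega F := by
  induction w with
  | zero => simp [twist_zero]
  | succ w ih =>
    have h : (-((w + 1 : ℕ) : ℤ)) = -(w : ℤ) - 1 := by push_cast; ring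
    rw [h, twist_twist_Omega, ih, Finset.prod_range_succ, Polynomial.coe_mul]
    ring

/-- Splits off the first $d$ zeros $t^q,\dots,t^{q^d}$. The remaining factor is bounded on a disc
growing with $d$, and the polynomial takes the value $\ell_d$ at $T=t$. -/
theorem Omega_eq_twist (d : ℕ) : Omega F =
    ((∏ m ∈ Finset.range d, twistPoly F ((m + 1 : ℕ) : ℤ) (X - Polynomial.C (tElt F)) : (CInf F)[X]) :
      PowerSeries (CInf F)) * twist F d (Omega F) := by
  induction d with
  | zero => simp [twist_zero]
  | succ d ih =>
    conv_lhs => rw [ih]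
    have h : ((d : ℕ) : ℤ) = ((d + 1 : ℕ) : ℤ) - 1 := by push_cast; ring
    rw [h, twist_twist_Omega, Finset.prod_range_succ, Polynomial.coe_mul]
    ring

theorem gaussBound_Omega :
    GaussBound (‖tElt F‖ ^ Fintype.card F) (‖tTilde F‖ ^ Fintype.card F)⁻¹ (Omega F) := by
  rw [Omega_eq]
  simpa using (GaussBound.C (‖tElt F‖ ^ Fintype.card F) ((tTilde F ^ Fintype.card F)⁻¹)).mul
    (by positivity) (gaussBound_omegaProd F)

theorem Omega_mem_entire : Omega F ∈ entire (CInf F) := by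
  refine mem_entire.2 fun ρ hρ => ?_
  have h1 := one_lt_norm_tElt F
  -- Any $d$ with $|t|^d>\rho$ works, since $\Omega^{(d)}$ is bounded on the disc of radius
  -- $|t|^{q\cdot q^d}$.
  obtain ⟨d, hd⟩ := pow_unbounded_of_one_lt ρ h1
  rw [Omega_eq_twist F d]
  obtain ⟨C, hC⟩ := exists_gaussBound_polynomial (K := CInf F) hρ
    (∏ m ∈ Finset.range d, twistPoly F ((m + 1 : ℕ) : ℤ) (X - Polynomial.C (tElt F)))
  refine ⟨_, hC.mul hρ (((gaussBound_Omega F).twist (by positivity) d).mono_radius hρ ?_)⟩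
  rw [← pow_mul]
  refine hd.le.trans (pow_le_pow_right₀ h1.le ?_)
  exact (le_card_pow F d).trans (Nat.le_mul_of_pos_left _ Fintype.card_pos)

/-- Constant term one and Gauss norm at most one pass to the inverse of the product. As the radius
$|t|^q$ exceeds one, the inverse lies in the Tate algebra. -/
theorem exists_inv_Omega : ∃ f ∈ boundedOn (CInf F) (ρ := ‖tElt F‖ ^ Fintype.card F)
    (by positivity), Omega F * f = 1 := by
  refine ⟨PowerSeries.C (tTilde F ^ Fintype.card F) * (omegaProd F)⁻¹,
    mul_mem ⟨_, GaussBound.C _ _⟩ ⟨1, (gaussBound_omegaProd F).inv (by positivity)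
      (constantCoeff_omegaProd F)⟩, ?_⟩
  have h1 : omegaProd F * (omegaProd F)⁻¹ = 1 := by
    refine PowerSeries.mul_inv_cancel _ ?_
    rw [constantCoeff_omegaProd]
    exact one_ne_zero
  have h2 : PowerSeries.C (tTilde F ^ Fintype.card F)⁻¹ *
      PowerSeries.C (tTilde F ^ Fintype.card F) = 1 := by
    rw [← map_mul, inv_mul_cancel₀ (pow_ne_zero _ (tTilde_ne_zero F)), map_one]
  rw [Omega_eq]
  linear_combination h1 * PowerSeries.C (tTilde F ^ Fintype.card F)⁻¹ *
      PowerSeries.C (tTilde F ^ Fintype.card F) + h2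

/-- The constant term $1$ dominates: every other term is at most a positive power of
$|t|^{1-q}\le|t|^{-1}<1$. -/
theorem evalAtT_omegaProd_ne_zero : evalAtT F (omegaProd F) ≠ 0 := by
  have h1 := one_lt_norm_tElt F
  have hq := Fintype.one_lt_card (α := F)
  have hb := gaussBound_omegaProd F
  have hs := (hb.summable_norm (x := tElt F) (lt_self_pow₀ h1 hq)).of_norm
  rw [evalAtT, hs.tsum_eq_zero_add, PowerSeries.coeff_zero_eq_constantCoeff_apply,
    constantCoeff_omegaProd, pow_zero, mul_one]
  intro h
  have h2 : ‖∑' n, PowerSeries.coeff (n + 1) (omegaProd F) * tElt F ^ (n + 1)‖ ≤ ‖tElt F‖⁻¹ := by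
    refine IsUltrametricDist.norm_tsum_le_of_forall_le_of_nonneg (by positivity) fun n => ?_
    refine (hb.norm_coeff_mul_pow_le (by positivity) (tElt F) (n + 1)).trans ?_
    have h3 : ‖tElt F‖ / ‖tElt F‖ ^ Fintype.card F ≤ ‖tElt F‖⁻¹ := by
      rw [div_le_iff₀ (by positivity)]
      refine le_of_mul_le_mul_left (a := ‖tElt F‖) ?_ (by positivity)
      rw [← mul_assoc, mul_inv_cancel₀ (by positivity), one_mul, ← sq]
      exact pow_le_pow_right₀ h1.le hq
    rw [one_mul]
    refine (pow_le_pow_left₀ (by positivity) h3 _).trans ?_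
    exact pow_le_of_le_one (by positivity) (inv_le_one_of_one_le₀ h1.le) (by omega)
  rw [← neg_eq_of_add_eq_zero_right h, norm_neg, norm_one] at h2
  exact (inv_lt_one_of_one_lt₀ h1).not_ge h2

theorem evalAtT_Omega_ne_zero : evalAtT F (Omega F) ≠ 0 := by
  have h : evalAtT F (Omega F) = (tTilde F ^ Fintype.card F)⁻¹ * evalAtT F (omegaProd F) := by
    simp only [evalAtT, Omega_eq, PowerSeries.coeff_C_mul, mul_assoc]
    exact tsum_mul_left
  rw [h]
  exact mul_ne_zero (inv_ne_zero (pow_ne_zero _ (tTilde_ne_zero F)))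
    (evalAtT_omegaProd_ne_zero F)

theorem piTilde_eq : piTilde F = (evalAtT F (Omega F))⁻¹ := rfl

theorem piTilde_ne_zero : piTilde F ≠ 0 := inv_ne_zero (evalAtT_Omega_ne_zero F)

/-- `Ω^{(-n)}` vanishes at `T = t` for `n > 0`. -/
theorem evalAtT_twist_Omega_of_neg {k : ℤ} (hk : k < 0) :
    evalAtT F (twist F k (Omega F)) = 0 := by
  obtain ⟨n, rfl⟩ : ∃ n : ℕ, k = -((n + 1 : ℕ) : ℤ) := ⟨(-k - 1).toNat, by omega⟩
  rw [twist_neg_Omega, evalAtT_mul (coe_mem_entire _) (Omega_mem_entire F), evalAtT_coe,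
    Polynomial.eval_prod, Finset.prod_eq_zero (i := 0) (by simp), zero_mul]
  simp [twistPoly_zero]

/-- `ℓ_d = ∏_{j=1}^d (t - t^{q^j})`. -/
def carlitzL (d : ℕ) : CInf F :=
  ∏ j ∈ Finset.range d, (tElt F - tElt F ^ Fintype.card F ^ (j + 1))

theorem evalAtT_twist_Omega (d : ℕ) :
    carlitzL F d * evalAtT F (twist F d (Omega F)) = evalAtT F (Omega F) := by
  conv_rhs => rw [Omega_eq_twist F d]
  rw [evalAtT_mul (coe_mem_entire _) (twist_mem_entire (Omega_mem_entire F) _), evalAtT_coe,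
    Polynomial.eval_prod, carlitzL]
  congr 1
  refine Finset.prod_congr rfl fun j _ => ?_
  simp [twistPoly, ← frobPow_natCast]

end OmegaFacts

/-! ### The polynomials $H_s$: recursion, size and field of definition. -/

/-- Serves both generating series, that of the $H_s$ and that of the power sums. The range of $i$
can be enlarged harmlessly because $i<q^i$. -/
theorem coeff_mk_pow_mul {R : Type*} [CommSemiring R] {q : ℕ} (hq : 1 < q) (e : ℕ → R)
    (B : PowerSeries R) (s : ℕ) :
    PowerSeries.coeff s ((PowerSeries.mk fun n =>
      ∑ i ∈ Finset.range (n + 1), if q ^ i = n then e i else 0) * B) =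
    ∑ i ∈ Finset.range (s + 1), if q ^ i ≤ s then e i * PowerSeries.coeff (s - q ^ i) B else 0 := by
  rw [PowerSeries.coeff_mul, Finset.Nat.sum_antidiagonal_eq_sum_range_succ fun a b =>
    PowerSeries.coeff a (PowerSeries.mk fun n =>
      ∑ i ∈ Finset.range (n + 1), if q ^ i = n then e i else 0) * PowerSeries.coeff b B]
  have h : ∀ a ∈ Finset.range (s + 1), PowerSeries.coeff a (PowerSeries.mk fun n =>
      ∑ i ∈ Finset.range (n + 1), if q ^ i = n then e i else 0) * PowerSeries.coeff (s - a) B =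
      ∑ i ∈ Finset.range (s + 1), if a = q ^ i then e i * PowerSeries.coeff (s - a) B else 0 := by
    intro a ha
    rw [PowerSeries.coeff_mk, Finset.sum_mul]
    rw [Finset.sum_subset (Finset.range_mono (Nat.succ_le_of_lt (Finset.mem_range.1 ha)))]
    · refine Finset.sum_congr rfl fun i _ => ?_
      rw [ite_mul, zero_mul]
      simp only [eq_comm]
    · intro i _ hi
      rw [if_neg, zero_mul]
      have : i < q ^ i := Nat.lt_pow_self hq
      simp at hi
      omega
  rw [Finset.sum_congr rfl h, Finset.sum_comm]
  refine Finset.sum_congr rfl fun i _ => ?_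
  rw [Finset.sum_ite_eq']
  simp

/-- With $q=p+1$ this is the estimate $q^{i+1}-q\le q^{i+1}$ after summing the geometric series. -/
theorem mul_sum_pow_le (p i : ℕ) :
    p * ∑ j ∈ Finset.Icc 1 i, (p + 1) ^ j ≤ (p + 1) * (p + 1) ^ i := by
  induction i with
  | zero => simp
  | succ i ih =>
    rw [Finset.sum_Icc_succ_top (by omega), mul_add]
    calc _ ≤ (p + 1) * (p + 1) ^ i + p * (p + 1) ^ (i + 1) := Nat.add_le_add_right ih _
      _ = _ := by ring

/-- The polynomials with coefficients in a subring. -/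
def coeffsIn {R : Type*} [CommRing R] (A : Subring R) : Subring R[X] where
  carrier := {p | ∀ n, p.coeff n ∈ A}
  one_mem' n := by
    rw [Polynomial.coeff_one]
    split_ifs
    · exact one_mem _
    · exact zero_mem _
  zero_mem' n := by
    rw [Polynomial.coeff_zero]
    exact zero_mem _
  add_mem' hp hq n := by
    rw [Polynomial.coeff_add]
    exact add_mem (hp n) (hq n)
  neg_mem' hp n := by
    rw [Polynomial.coeff_neg]
    exact neg_mem (hp n)
  mul_mem' hp hq n := by
    rw [Polynomial.coeff_mul]
    exact sum_mem fun ij _ => mul_mem (hp _) (hq _)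

section InterpolationPolynomials

variable (F : Type*) [Field F] [Fintype F]

theorem carlitzPi_zero : carlitzPi F 0 = 1 := by simp [carlitzPi]

theorem genSeries_eq : genSeries F = 1 + (PowerSeries.mk fun n =>
    ∑ i ∈ Finset.range (n + 1), if Fintype.card F ^ i = n then genCoeff F i else 0) *
      genSeries F := by
  set E : PowerSeries (BiFrac F) := PowerSeries.mk fun n =>
    ∑ i ∈ Finset.range (n + 1), if Fintype.card F ^ i = n then genCoeff F i else 0 with hE
  have : (1 - E) * genSeries F = 1 := by
    refine PowerSeries.mul_inv_cancel _ ?_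
    simp [hE]
  linear_combination this

/-- `∏_{j=1}^i (T^{q^i} - t^{q^j})`. -/
def genNumerator (i : ℕ) : F[X][X] :=
  ∏ j ∈ Finset.Icc 1 i, (X ^ Fintype.card F ^ i - C (X ^ Fintype.card F ^ j))

/-- Obtained from $G=1+EG$ by clearing denominators. The $c_i$ are quotients of Carlitz factorials,
polynomials by `carlitzD_mul_carlitzPi_dvd`; `map C` reads them in the variable $T$. -/
theorem interpPoly_recursion (s : ℕ) : ∃ c : ℕ → F[X],
    (∀ i, Fintype.card F ^ i ≤ s →
      carlitzD F i * carlitzPi F (s - Fintype.card F ^ i) * c i = carlitzPi F s) ∧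
    interpPoly F s = (if s = 0 then 1 else 0) + ∑ i ∈ Finset.range (s + 1),
      if Fintype.card F ^ i ≤ s then
        genNumerator F i * interpPoly F (s - Fintype.card F ^ i) * (c i).map C else 0 := by
  have hc : ∀ i, ∃ c : F[X], Fintype.card F ^ i ≤ s →
      carlitzD F i * carlitzPi F (s - Fintype.card F ^ i) * c = carlitzPi F s := by
    intro i
    by_cases h : Fintype.card F ^ i ≤ s
    · obtain ⟨c, hc⟩ := carlitzD_mul_carlitzPi_dvd F i (s - Fintype.card F ^ i)
      refine ⟨c, fun _ => ?_⟩
      rw [← hc, Nat.add_sub_cancel' h]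
    · exact ⟨0, fun h' => absurd h' h⟩
  choose c hc using hc
  refine ⟨c, hc, IsFractionRing.injective F[X][X] (BiFrac F) ?_⟩
  rw [interpPoly_spec, genSeries_eq, map_add, coeff_mk_pow_mul Fintype.one_lt_card, mul_add,
    map_add, Finset.mul_sum, map_sum]
  congr 1
  · rw [PowerSeries.coeff_one]
    split_ifs with h
    · simp [h, carlitzPi_zero]
    · simp
  · refine Finset.sum_congr rfl fun i _ => ?_
    split_ifs with h
    · rw [map_mul, map_mul, interpPoly_spec, genNumerator, ← carlitzD_mul_genCoeff, ← hc i h]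
      simp only [Polynomial.map_mul, map_mul]
      ring
    · simp

/-- Only powers of `t^q` occur in `H_s`. -/
theorem exists_interpPoly_eq_map_expand (s : ℕ) :
    ∃ P : F[X][X], interpPoly F s = P.map (expand F (Fintype.card F)).toRingHom := by
  suffices interpPoly F s ∈ (mapRingHom (expand F (Fintype.card F)).toRingHom).range by
    obtain ⟨P, hP⟩ := this
    exact ⟨P, hP.symm⟩
  induction s using Nat.strong_induction_on with
  | _ s ih =>
  obtain ⟨c, -, h⟩ := interpPoly_recursion F s
  rw [h]
  refine add_mem ?_ (sum_mem fun i _ => ?_)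
  · split_ifs
    · exact one_mem _
    · exact zero_mem _
  · split_ifs with hi
    · have : 0 < Fintype.card F ^ i := pow_pos Fintype.card_pos _
      have hX : X ∈ (mapRingHom (expand F (Fintype.card F)).toRingHom).range := ⟨X, by simp⟩
      refine mul_mem (mul_mem (prod_mem fun j hj => ?_) (ih _ (by omega))) ?_
      -- The variable $t$ enters the recursion only through $t^{q^j}$ with $j\ge1$, a power of
      -- $t^q$; the $c_i$ involve $T$ alone.
      · refine sub_mem (pow_mem hX _) ⟨C (X ^ Fintype.card F ^ (j - 1)), ?_⟩
        have hj : 1 ≤ j := (Finset.mem_Icc.1 hj).1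
        have : Fintype.card F * Fintype.card F ^ (j - 1) = Fintype.card F ^ j := by
          rw [← pow_succ', Nat.sub_add_cancel hj]
        simp [← pow_mul, this]
      · refine ⟨(c i).map C, ?_⟩
        rw [coe_mapRingHom, Polynomial.map_map]
        congr 1
        ext a
        simp
    · exact zero_mem _

theorem HPoly_recursion (s : ℕ) : ∃ c : ℕ → F[X],
    (∀ i, Fintype.card F ^ i ≤ s →
      carlitzD F i * carlitzPi F (s - Fintype.card F ^ i) * c i = carlitzPi F s) ∧
    HPoly F s = (if s = 0 then 1 else 0) + ∑ i ∈ Finset.range (s + 1),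
      if Fintype.card F ^ i ≤ s then
        (∏ j ∈ Finset.Icc 1 i, (X ^ Fintype.card F ^ i - C (tElt F ^ Fintype.card F ^ j))) *
          HPoly F (s - Fintype.card F ^ i) * (c i).map (algebraMap F (CInf F)) else 0 := by
  obtain ⟨c, hc, h⟩ := interpPoly_recursion F s
  refine ⟨c, hc, ?_⟩
  rw [HPoly, h, Polynomial.map_add, Polynomial.map_sum]
  congr 1
  · split_ifs <;> simp
  · refine Finset.sum_congr rfl fun i _ => ?_
    split_ifs with hi
    · rw [Polynomial.map_mul, Polynomial.map_mul, Polynomial.map_map, genNumerator,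
        Polynomial.map_prod]
      refine congrArg₂ _ (congrArg₂ _ (by simp) rfl)
        (congrArg (fun f => Polynomial.map f (c i)) ?_)
      ext a
      simp
    · simp

/-- In each step of the recursion the numerator contributes at most $|t|^{q+\cdots+q^i}\le|\tilde
t|^{q\cdot q^i}$, and $s$ drops by $q^i$; so the exponent $qs$ is preserved. It is just small enough
to be beaten by the bound $|\tilde t|^{-q}$ for $\Omega$. -/
theorem gaussBound_HPoly (s : ℕ) :
    GaussBound 1 (‖tTilde F‖ ^ (Fintype.card F * s)) (HPoly F s : PowerSeries (CInf F)) := by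
  have h1 := one_lt_norm_tTilde F
  have ht := one_lt_norm_tElt F
  have hq := Fintype.one_lt_card (α := F)
  induction s using Nat.strong_induction_on with
  | _ s ih =>
  obtain ⟨c, -, h⟩ := HPoly_recursion F s
  rw [h, Polynomial.coe_add]
  refine GaussBound.add zero_le_one ?_ ?_
  · split_ifs with hs
    · simpa [hs] using GaussBound.one (K := CInf F) 1
    · simpa using (GaussBound.zero (K := CInf F) 1).mono (by positivity)
  · rw [← Polynomial.coeToPowerSeries.ringHom_apply, map_sum]
    refine GaussBound.sum zero_le_one (by positivity) _ fun i _ => ?_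
    split_ifs with hi
    · have hpos : 0 < Fintype.card F ^ i := pow_pos Fintype.card_pos _
      have e1 : GaussBound 1 (∏ j ∈ Finset.Icc 1 i, ‖tElt F‖ ^ Fintype.card F ^ j)
          (Polynomial.coeToPowerSeries.ringHom (∏ j ∈ Finset.Icc 1 i,
            (X ^ Fintype.card F ^ i - C (tElt F ^ Fintype.card F ^ j)))) := by
        rw [map_prod]
        refine GaussBound.prod zero_le_one _ fun j _ => ?_
        rw [map_sub, map_pow, sub_eq_add_neg, Polynomial.coeToPowerSeries.ringHom_apply,
          Polynomial.coeToPowerSeries.ringHom_apply, Polynomial.coe_X, Polynomial.coe_C]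
        refine GaussBound.add zero_le_one ?_ ?_
        · refine ((GaussBound.X zero_le_one).pow zero_le_one _).mono ?_
          rw [one_pow]
          exact one_le_pow₀ ht.le
        · have := (GaussBound.C 1 (tElt F ^ Fintype.card F ^ j)).neg
          rwa [norm_pow] at this
      have e2 : GaussBound 1 1 (Polynomial.coeToPowerSeries.ringHom
          ((c i).map (algebraMap F (CInf F)))) := by
        intro n
        simpa using norm_algebraMap_le_one F _
      have e3 := (e1.mul zero_le_one (ih (s - Fintype.card F ^ i) (by omega))).mul zero_le_one e2
      rw [map_mul, map_mul]
      refine e3.mono ?_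
      rw [mul_one, Finset.prod_pow_eq_pow_sum, norm_tElt, ← pow_mul, ← pow_add]
      refine pow_le_pow_right₀ h1.le ?_
      have h3 : (Fintype.card F - 1) * ∑ j ∈ Finset.Icc 1 i, Fintype.card F ^ j ≤
          Fintype.card F * Fintype.card F ^ i := by
        obtain ⟨p, hp⟩ : ∃ p, Fintype.card F = p + 1 := ⟨Fintype.card F - 1, by omega⟩
        rw [hp, Nat.add_sub_cancel]
        exact mul_sum_pow_le p i
      calc _ ≤ Fintype.card F * Fintype.card F ^ i +
            Fintype.card F * (s - Fintype.card F ^ i) := by gcongr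
        _ = Fintype.card F * s := by rw [← mul_add, Nat.add_sub_cancel' hi]
    · rw [map_zero]
      exact (GaussBound.zero 1).mono (by positivity)

/-- The ring `𝔽_q[t^{1/q^w}][T]`. -/
def definedOver (w : ℕ) : Subring (CInf F)[X] :=
  coeffsIn (Algebra.adjoin F {frobPow F (-(w : ℤ)) (tElt F)}).toSubring

theorem frobPow_tElt_mem {w m : ℕ} (h : m ≤ w) :
    frobPow F (-(m : ℤ)) (tElt F) ∈ Algebra.adjoin F {frobPow F (-(w : ℤ)) (tElt F)} := by
  have : (-(m : ℤ)) = ((w - m : ℕ) : ℤ) + (-(w : ℤ)) := by omega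
  rw [this, frobPow_add, frobPow_natCast]
  exact Subalgebra.pow_mem _ (Algebra.self_mem_adjoin_singleton F _) _

theorem C_mem_definedOver {w : ℕ} {x : CInf F}
    (h : x ∈ Algebra.adjoin F {frobPow F (-(w : ℤ)) (tElt F)}) : C x ∈ definedOver F w := by
  intro n
  rw [Polynomial.coeff_C]
  split_ifs
  · exact h
  · exact zero_mem _

theorem X_mem_definedOver (w : ℕ) : (X : (CInf F)[X]) ∈ definedOver F w := by
  intro n
  rw [Polynomial.coeff_X]
  split_ifs
  · exact one_mem _
  · exact zero_mem _

theorem twistPoly_X_sub_C (k : ℤ) :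
    twistPoly F k (X - C (tElt F)) = X - C (frobPow F k (tElt F)) := by
  simp [twistPoly]

theorem twistPoly_X_sub_C_mem {w m : ℕ} (h : m ≤ w) :
    twistPoly F (-(m : ℤ)) (X - C (tElt F)) ∈ definedOver F w := by
  rw [twistPoly_X_sub_C]
  exact sub_mem (X_mem_definedOver F w) (C_mem_definedOver F (frobPow_tElt_mem F h))

theorem frobPow_aeval (k : ℤ) (x : CInf F) (p : F[X]) :
    frobPow F k (aeval x p) = aeval (frobPow F k x) p := by
  rw [aeval_eq_sum_range, aeval_eq_sum_range, map_sum]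
  simp only [Algebra.smul_def, map_mul, map_pow, frobPow_algebraMap]

/-- The coefficients of $H_s$ are polynomials in $t^q$, which absorbs the extra twist by $-1$. -/
theorem twistPoly_HPoly_mem {w m : ℕ} (h : m ≤ w) (s : ℕ) :
    twistPoly F (-1) (twistPoly F (-(m : ℤ)) (HPoly F s)) ∈ definedOver F w := by
  intro n
  obtain ⟨P, hP⟩ := exists_interpPoly_eq_map_expand F s
  have : (twistPoly F (-1) (twistPoly F (-(m : ℤ)) (HPoly F s))).coeff n =
      aeval (frobPow F (-(m : ℤ)) (tElt F)) (P.coeff n) := by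
    rw [← twistPoly_add, add_comm, twistPoly_add]
    have h1 := frobPow_neg_one_pow F (tElt F) 0
    simp only [zero_add, pow_one, pow_zero] at h1
    simp [twistPoly, HPoly, hP, frobPow_aeval, expand_aeval, h1]
  rw [this]
  have h2 := Algebra.adjoin_mono (R := F)
    (Set.singleton_subset_iff.2 (frobPow_tElt_mem F h))
  rw [Algebra.adjoin_eq (S := Algebra.adjoin F _)] at h2
  exact h2 (aeval_mem_adjoin_singleton F _)

theorem twistPoly_delayedH_mem {w m : ℕ} (h : m ≤ w) (s : ℕ) :
    twistPoly F (-1) (delayedH F s m) ∈ definedOver F w := by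
  rw [delayedH, map_mul, map_pow, map_prod]
  refine mul_mem (twistPoly_HPoly_mem F h _) (pow_mem (prod_mem fun i hi => ?_) _)
  rw [← twistPoly_add]
  have : (-1 + -(i : ℤ)) = -((i + 1 : ℕ) : ℤ) := by push_cast; ring
  rw [this]
  exact twistPoly_X_sub_C_mem F (by have := Finset.mem_range.1 hi; omega)

end InterpolationPolynomials

/-! ### Carlitz polynomials, power sums and the Anderson–Thakur interpolation. -/

section CarlitzPolynomials

variable (F : Type*) [Field F] [Fintype F]

/-- `D_n` as an element of `ℂ_∞`. -/
def carlitzDC (n : ℕ) : CInf F := aeval (tElt F) (carlitzD F n)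

theorem carlitzDC_zero : carlitzDC F 0 = 1 := by simp [carlitzDC, carlitzD]

theorem carlitzDC_succ (n : ℕ) : carlitzDC F (n + 1) =
    (tElt F ^ Fintype.card F ^ (n + 1) - tElt F) * carlitzDC F n ^ Fintype.card F := by
  simp [carlitzDC, carlitzD_succ]

theorem carlitzL_zero : carlitzL F 0 = 1 := by simp [carlitzL]

theorem carlitzL_succ (n : ℕ) : carlitzL F (n + 1) =
    carlitzL F n * (tElt F - tElt F ^ Fintype.card F ^ (n + 1)) := by
  rw [carlitzL, Finset.prod_range_succ, carlitzL]

theorem tElt_pow_injective : Function.Injective fun n : ℕ => tElt F ^ Fintype.card F ^ n := by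
  intro m n h
  have h2 := congrArg norm h
  simp only [norm_pow] at h2
  exact Nat.pow_right_injective Fintype.one_lt_card
    (pow_right_injective₀ (zero_lt_one.trans (one_lt_norm_tElt F)) (one_lt_norm_tElt F).ne' h2)

theorem tElt_pow_sub_ne_zero (n : ℕ) : tElt F ^ Fintype.card F ^ (n + 1) - tElt F ≠ 0 := by
  intro h
  have := tElt_pow_injective F (a₁ := n + 1) (a₂ := 0) (by simpa [sub_eq_zero] using h)
  omega

theorem carlitzDC_ne_zero (n : ℕ) : carlitzDC F n ≠ 0 := by
  induction n with
  | zero => simp [carlitzDC_zero]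
  | succ n ih =>
    rw [carlitzDC_succ]
    exact mul_ne_zero (tElt_pow_sub_ne_zero F n) (pow_ne_zero _ ih)

theorem carlitzL_ne_zero (n : ℕ) : carlitzL F n ≠ 0 := by
  refine Finset.prod_ne_zero_iff.2 fun j _ => ?_
  rw [← neg_ne_zero, neg_sub]
  exact tElt_pow_sub_ne_zero F j

theorem sub_pow_card_pow (x y : CInf F) (n : ℕ) :
    (x - y) ^ Fintype.card F ^ n = x ^ Fintype.card F ^ n - y ^ Fintype.card F ^ n := by
  simp only [← frobPow_natCast, map_sub]

/-- The coefficient of `z^{q^i}` in the Carlitz polynomial `E_d`. -/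
def carlitzECoeff (d i : ℕ) : CInf F :=
  if i ≤ d then (carlitzDC F i * carlitzL F (d - i) ^ Fintype.card F ^ i)⁻¹ else 0

theorem carlitzECoeff_zero (d : ℕ) : carlitzECoeff F d 0 = (carlitzL F d)⁻¹ := by
  simp [carlitzECoeff, carlitzDC_zero]

theorem carlitzECoeff_self (d : ℕ) : carlitzECoeff F d d = (carlitzDC F d)⁻¹ := by
  simp [carlitzECoeff, carlitzL_zero]

theorem carlitzECoeff_of_lt {d i : ℕ} (h : d < i) : carlitzECoeff F d i = 0 :=
  if_neg h.not_ge

/-- This and the next relation are the coefficientwise forms of the two functional equations of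
$E_d$, `carlitzE_tElt_mul` and `sub_mul_carlitzE`. -/
theorem carlitzECoeff_succ_succ (d i : ℕ) :
    carlitzECoeff F (d + 1) (i + 1) * (tElt F ^ Fintype.card F ^ (i + 1) - tElt F) =
      carlitzECoeff F d i ^ Fintype.card F := by
  rw [carlitzECoeff, carlitzECoeff]
  by_cases h : i ≤ d
  · have h1 := tElt_pow_sub_ne_zero F i
    have h2 := carlitzDC_ne_zero F i
    have h3 := carlitzL_ne_zero F (d - i)
    rw [if_pos h, if_pos (by omega), carlitzDC_succ, Nat.add_sub_add_right, inv_pow, mul_pow,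
      ← pow_mul, ← pow_succ]
    field_simp
  · rw [if_neg h, if_neg (by omega), zero_mul, zero_pow Fintype.card_ne_zero]

theorem sub_mul_carlitzECoeff_succ (d i : ℕ) :
    (tElt F ^ Fintype.card F ^ (d + 1) - tElt F) * carlitzECoeff F (d + 1) (i + 1) =
      carlitzECoeff F d i ^ Fintype.card F - carlitzECoeff F d (i + 1) := by
  rw [← carlitzECoeff_succ_succ]
  rcases lt_trichotomy i d with h | rfl | h
  · obtain ⟨m, rfl⟩ := Nat.exists_eq_add_of_lt h
    have h1 := tElt_pow_sub_ne_zero F i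
    have h2 := carlitzDC_ne_zero F (i + 1)
    have h3 := carlitzL_ne_zero F m
    have h4 := tElt_pow_sub_ne_zero F m
    have h5 : tElt F - tElt F ^ Fintype.card F ^ (m + 1) ≠ 0 := by
      rw [← neg_ne_zero, neg_sub]
      exact h4
    rw [carlitzECoeff, carlitzECoeff, if_pos (by omega), if_pos (by omega),
      show i + m + 1 + 1 - (i + 1) = m + 1 by omega, show i + m + 1 - (i + 1) = m by omega,
      carlitzL_succ, mul_pow]
    have h6 : (tElt F - tElt F ^ Fintype.card F ^ (m + 1)) ^ Fintype.card F ^ (i + 1) =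
        tElt F ^ Fintype.card F ^ (i + 1) - tElt F ^ Fintype.card F ^ (i + m + 1 + 1) := by
      rw [sub_pow_card_pow, ← pow_mul, ← pow_add]
      congr 3
      omega
    have h7 := pow_ne_zero (Fintype.card F ^ (i + 1)) h5
    rw [h6] at h7 ⊢
    field_simp
    ring
  · rw [carlitzECoeff_of_lt F (Nat.lt_succ_self i)]
    ring
  · rw [carlitzECoeff_of_lt F (by omega), carlitzECoeff_of_lt F (by omega)]
    ring

/-- The Carlitz polynomial `E_d`, as an `𝔽_q`-linear map. -/
def carlitzE (d : ℕ) : CInf F →ₗ[F] CInf F where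
  toFun z := ∑ i ∈ Finset.range (d + 1), carlitzECoeff F d i * z ^ Fintype.card F ^ i
  map_add' x y := by
    simp only [← frobPow_natCast, map_add, mul_add, Finset.sum_add_distrib]
  map_smul' c x := by
    simp only [← frobPow_natCast, Algebra.smul_def, map_mul, frobPow_algebraMap, RingHom.id_apply,
      Finset.mul_sum]
    exact Finset.sum_congr rfl fun i _ => by ring

theorem carlitzE_apply (d : ℕ) (z : CInf F) : carlitzE F d z =
    ∑ i ∈ Finset.range (d + 1), carlitzECoeff F d i * z ^ Fintype.card F ^ i := rfl

theorem carlitzE_pow_card (d : ℕ) (z : CInf F) : carlitzE F d z ^ Fintype.card F =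
    ∑ i ∈ Finset.range (d + 1), carlitzECoeff F d i ^ Fintype.card F *
      z ^ Fintype.card F ^ (i + 1) := by
  rw [← frob_apply, carlitzE_apply, map_sum]
  refine Finset.sum_congr rfl fun i _ => ?_
  rw [map_mul, frob_apply, frob_apply, ← pow_mul, pow_succ]

theorem carlitzE_tElt_mul (d : ℕ) (z : CInf F) : carlitzE F (d + 1) (tElt F * z) =
    tElt F * carlitzE F (d + 1) z + carlitzE F d z ^ Fintype.card F := by
  rw [carlitzE_pow_card, carlitzE_apply, carlitzE_apply, Finset.sum_range_succ',
    Finset.sum_range_succ' _ (d + 1), mul_add, Finset.mul_sum, add_right_comm,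
    ← Finset.sum_add_distrib]
  congr 1
  · refine Finset.sum_congr rfl fun i _ => ?_
    rw [← carlitzECoeff_succ_succ]
    ring
  · ring

theorem sub_mul_carlitzE (d : ℕ) (z : CInf F) :
    (tElt F ^ Fintype.card F ^ (d + 1) - tElt F) * carlitzE F (d + 1) z =
      carlitzE F d z ^ Fintype.card F - carlitzE F d z := by
  have h : carlitzE F d z = ∑ i ∈ Finset.range (d + 1),
      carlitzECoeff F d (i + 1) * z ^ Fintype.card F ^ (i + 1) + carlitzECoeff F d 0 * z := by
    rw [Finset.sum_range_succ, carlitzECoeff_of_lt F (Nat.lt_succ_self d), zero_mul, add_zero,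
      carlitzE_apply, Finset.sum_range_succ', pow_zero, pow_one]
  have h0 : (tElt F ^ Fintype.card F ^ (d + 1) - tElt F) * carlitzECoeff F (d + 1) 0 =
      -carlitzECoeff F d 0 := by
    have h1 := carlitzL_ne_zero F d
    have h2 := carlitzL_ne_zero F (d + 1)
    rw [carlitzECoeff_zero, carlitzECoeff_zero]
    field_simp
    rw [carlitzL_succ]
    ring
  rw [carlitzE_pow_card, h, carlitzE_apply, Finset.sum_range_succ', mul_add, Finset.mul_sum,
    ← sub_sub, ← Finset.sum_sub_distrib, sub_eq_add_neg _ (_ * z)]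
  congr 1
  · refine Finset.sum_congr rfl fun i _ => ?_
    rw [← mul_assoc, sub_mul_carlitzECoeff_succ]
    ring
  · rw [← mul_assoc, h0, pow_zero, pow_one, neg_mul]

/-- Induction on $j$. For $j=0$ the relation between $(t^{q^{d+1}}-t)E_{d+1}$ and $E_d^q-E_d$ gives
zero at once, as $E_d(1)\in\{0,1\}$. The step uses the formula for $E_{d+1}(tz)$, whose first
summand vanishes since $j<d+1$. -/
theorem carlitzE_tElt_pow (j : ℕ) :
    ∀ d, j ≤ d → carlitzE F d (tElt F ^ j) = if j = d then 1 else 0 := by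
  have hq : Fintype.card F ≠ 0 := Fintype.card_ne_zero
  induction j with
  | zero =>
    intro d _
    induction d with
    | zero => simp [carlitzE_apply, carlitzECoeff_zero, carlitzL_zero]
    | succ d ih =>
      rw [if_neg (by omega)]
      refine (mul_eq_zero.1 ?_).resolve_left (tElt_pow_sub_ne_zero F d)
      rw [sub_mul_carlitzE, ih (Nat.zero_le d)]
      split_ifs <;> simp [hq]
  | succ j ih =>
    intro d hd
    obtain ⟨d, rfl⟩ : ∃ e, d = e + 1 := ⟨d - 1, by omega⟩
    rw [pow_succ', carlitzE_tElt_mul, ih _ (by omega), ih _ (by omega), if_neg (by omega)]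
    simp [hq, ite_pow]

theorem carlitzE_of_monic {a : F[X]} (ha : a.Monic) :
    carlitzE F a.natDegree (aeval (tElt F) a) = 1 := by
  rw [aeval_eq_sum_range, map_sum, Finset.sum_range_succ, ha.coeff_natDegree, one_smul,
    carlitzE_tElt_pow F _ _ le_rfl, if_pos rfl, Finset.sum_eq_zero, zero_add]
  intro i hi
  have hi := Finset.mem_range.1 hi
  rw [map_smul, carlitzE_tElt_pow F _ _ hi.le, if_neg hi.ne, smul_zero]

/-- The monic polynomials of degree `d`. -/
def monicOfDegree (d : ℕ) : Set F[X] := {a | a.Monic ∧ a.natDegree = d}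

theorem card_monicOfDegree (d : ℕ) : Nat.card (monicOfDegree F d) = Fintype.card F ^ d := by
  refine (Nat.card_congr
    ((monicEquivDegreeLT (R := F) d).trans (degreeLTEquiv F d).toEquiv)).trans ?_
  simp

theorem finite_monicOfDegree (d : ℕ) : (monicOfDegree F d).Finite := by
  refine Set.finite_coe_iff.1 (Nat.finite_of_card_ne_zero ?_)
  rw [card_monicOfDegree]
  exact (pow_pos Fintype.card_pos _).ne'

/-- The values at `t` of the monic polynomials of degree `d`. -/
def monicValues (d : ℕ) : Finset (CInf F) :=
  (finite_monicOfDegree F d).toFinset.map ⟨aeval (tElt F), aeval_tElt_injective F⟩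

theorem card_monicValues (d : ℕ) : (monicValues F d).card = Fintype.card F ^ d := by
  rw [monicValues, Finset.card_map, ← card_monicOfDegree,
    Nat.card_eq_card_finite_toFinset (finite_monicOfDegree F d)]

theorem norm_of_mem_monicValues {d : ℕ} {x : CInf F} (hx : x ∈ monicValues F d) :
    ‖x‖ = ‖tElt F‖ ^ d := by
  obtain ⟨a, ha, rfl⟩ := Finset.mem_map.1 hx
  obtain ⟨hm', rfl⟩ := (finite_monicOfDegree F d).mem_toFinset.1 ha
  exact norm_aeval_of_monic F hm'

theorem ne_zero_of_mem_monicValues {d : ℕ} {x : CInf F} (hx : x ∈ monicValues F d) : x ≠ 0 := by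
  rw [← norm_pos_iff, norm_of_mem_monicValues F hx]
  exact pow_pos (zero_lt_one.trans (one_lt_norm_tElt F)) _

theorem powerSum_eq (d s : ℕ) : powerSum F d s = ∑ x ∈ monicValues F d, (x ^ s)⁻¹ := by
  rw [monicValues, Finset.sum_map, powerSum]
  exact finsum_mem_eq_finite_toFinset_sum _ (finite_monicOfDegree F d)

theorem norm_powerSum_le (d s : ℕ) : ‖powerSum F d s‖ ≤ (‖tElt F‖⁻¹ ^ s) ^ d := by
  rw [powerSum_eq]
  refine IsUltrametricDist.norm_sum_le_of_forall_le_of_nonneg (by positivity) fun x hx => ?_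
  rw [norm_inv, norm_pow, norm_of_mem_monicValues F hx, inv_pow, inv_pow, ← pow_mul, ← pow_mul,
    mul_comm]

/-- The Carlitz polynomial `E_d`. -/
def carlitzEPoly (d : ℕ) : (CInf F)[X] :=
  ∑ i ∈ Finset.range (d + 1), C (carlitzECoeff F d i) * X ^ Fintype.card F ^ i

theorem eval_carlitzEPoly (d : ℕ) (z : CInf F) : (carlitzEPoly F d).eval z = carlitzE F d z := by
  simp [carlitzEPoly, carlitzE_apply, eval_finsetSum]

theorem natCast_card_eq_zero : (Fintype.card F : CInf F) = 0 := by
  have := congrArg (algebraMap F (CInf F)) (FiniteField.cast_card_eq_zero F)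
  rwa [map_natCast, map_zero] at this

/-- In characteristic $p$ only the linear term survives. This makes the logarithmic derivative below
have a constant numerator. -/
theorem derivative_carlitzEPoly (d : ℕ) :
    derivative (carlitzEPoly F d) = C (carlitzL F d)⁻¹ := by
  rw [carlitzEPoly, derivative_sum, Finset.sum_range_succ', carlitzECoeff_zero,
    Finset.sum_eq_zero]
  · simp
  · intro i _
    rw [derivative_C_mul_X_pow, Nat.cast_pow, natCast_card_eq_zero, zero_pow (by omega), mul_zero,
      map_zero, zero_mul]

theorem carlitzEPoly_monic (d : ℕ) :
    (C (carlitzDC F d) * (carlitzEPoly F d - 1)).Monic ∧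
      (C (carlitzDC F d) * (carlitzEPoly F d - 1)).natDegree = Fintype.card F ^ d := by
  have h0 := carlitzDC_ne_zero F d
  have hpos : 0 < Fintype.card F ^ d := pow_pos Fintype.card_pos _
  have h : C (carlitzDC F d) * (carlitzEPoly F d - 1) = X ^ Fintype.card F ^ d +
      C (carlitzDC F d) * (∑ i ∈ Finset.range d,
        C (carlitzECoeff F d i) * X ^ Fintype.card F ^ i - 1) := by
    rw [carlitzEPoly, Finset.sum_range_succ, carlitzECoeff_self, add_comm, add_sub_assoc, mul_add,
      ← mul_assoc, ← map_mul, mul_inv_cancel₀ h0, map_one, one_mul]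
  have hdeg : (C (carlitzDC F d) * (∑ i ∈ Finset.range d,
        C (carlitzECoeff F d i) * X ^ Fintype.card F ^ i - 1)).degree <
      (Fintype.card F ^ d : ℕ) := by
    refine (degree_mul_le _ _).trans_lt ?_
    rw [degree_C h0, zero_add]
    refine (degree_sub_le _ _).trans_lt (max_lt ?_ ?_)
    · refine (degree_sum_le _ _).trans_lt
        ((Finset.sup_lt_iff (WithBot.bot_lt_coe _)).2 fun i hi => ?_)
      refine (degree_C_mul_X_pow_le _ _).trans_lt ?_
      exact_mod_cast Nat.pow_lt_pow_right Fintype.one_lt_card (Finset.mem_range.1 hi)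
    · rw [degree_one]
      exact_mod_cast hpos
  rw [h]
  refine ⟨monic_X_pow_add hdeg, ?_⟩
  rw [natDegree_add_eq_left_of_degree_lt, natDegree_X_pow]
  rwa [degree_X_pow]

/-- Both sides are monic of degree $q^d$, and $E_d$ takes the value one at each of the $q^d$ points
`x`. -/
theorem prod_monicValues (d : ℕ) : ∏ x ∈ monicValues F d, (X - C x) =
    C (carlitzDC F d) * (carlitzEPoly F d - 1) := by
  obtain ⟨hm, hd⟩ := carlitzEPoly_monic F d
  refine (eq_of_monic_of_dvd_of_natDegree_le
    (monic_prod_of_monic _ _ fun x _ => monic_X_sub_C x) hm ?_ ?_).symm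
  · refine Finset.prod_dvd_of_coprime (fun x _ y _ h => ?_) fun x hx => ?_
    · exact isCoprime_X_sub_C_of_isUnit_sub (sub_ne_zero.2 h).isUnit
    · rw [dvd_iff_isRoot, IsRoot.def]
      obtain ⟨a, ha, rfl⟩ := Finset.mem_map.1 hx
      obtain ⟨hm', rfl⟩ := (finite_monicOfDegree F d).mem_toFinset.1 ha
      simp [eval_carlitzEPoly, carlitzE_of_monic F hm']
  · rw [hd, natDegree_prod_of_monic _ _ fun x _ => monic_X_sub_C x]
    simp [card_monicValues]

/-- The generating series of the power sums `S_d(n + 1)`. -/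
theorem carlitzE_mul_powerSum (d : ℕ) :
    (1 - (carlitzEPoly F d : PowerSeries (CInf F))) *
      (PowerSeries.mk fun n => powerSum F d (n + 1)) = PowerSeries.C (carlitzL F d)⁻¹ := by
  classical
  -- The geometric series for $1/(x-X)$.
  have h1 : ∀ x ∈ monicValues F d, ((X - C x : (CInf F)[X]) : PowerSeries (CInf F)) *
      (PowerSeries.mk fun n => (x ^ (n + 1))⁻¹) = -1 := by
    intro x hx
    have hx := ne_zero_of_mem_monicValues F hx
    rw [coe_X_sub_C, sub_mul]
    ext n
    rw [map_sub, PowerSeries.coeff_C_mul]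
    rcases n with _ | n
    · simp [hx]
    · rw [PowerSeries.coeff_succ_X_mul]
      simp [PowerSeries.coeff_one]
      field_simp
      ring
  have h2 : (PowerSeries.mk fun n => powerSum F d (n + 1)) =
      ∑ x ∈ monicValues F d, PowerSeries.mk fun n => (x ^ (n + 1))⁻¹ := by
    ext n
    rw [map_sum]
    simp [powerSum_eq]
  -- The logarithmic derivative of the product: the series on the left is $-\sum_x 1/(X-x)$.
  have h3 : ((∏ x ∈ monicValues F d, (X - C x) : (CInf F)[X]) : PowerSeries (CInf F)) *
      (PowerSeries.mk fun n => powerSum F d (n + 1)) =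
      -((derivative (∏ x ∈ monicValues F d, (X - C x)) : (CInf F)[X]) :
        PowerSeries (CInf F)) := by
    rw [h2, derivative_prod_finset, Finset.mul_sum, ← Polynomial.coeToPowerSeries.ringHom_apply,
      ← Polynomial.coeToPowerSeries.ringHom_apply, map_sum, ← Finset.sum_neg_distrib]
    refine Finset.sum_congr rfl fun x hx => ?_
    rw [← Finset.mul_prod_erase _ _ hx, map_mul, Polynomial.coeToPowerSeries.ringHom_apply,
      mul_right_comm, h1 x hx]
    simp
  have hD : PowerSeries.C (carlitzDC F d) ≠ 0 := by
    rw [Ne, ← map_zero PowerSeries.C, PowerSeries.C_injective.eq_iff]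
    exact carlitzDC_ne_zero F d
  rw [prod_monicValues, derivative_C_mul, map_sub, derivative_one, sub_zero,
    derivative_carlitzEPoly, Polynomial.coe_mul, Polynomial.coe_mul, Polynomial.coe_sub,
    Polynomial.coe_C, Polynomial.coe_C, Polynomial.coe_one] at h3
  refine mul_left_cancel₀ hD ?_
  linear_combination -h3

theorem coe_carlitzEPoly (d : ℕ) : (carlitzEPoly F d : PowerSeries (CInf F)) =
    PowerSeries.mk fun n => ∑ i ∈ Finset.range (n + 1),
      if Fintype.card F ^ i = n then carlitzECoeff F d i else 0 := by
  ext n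
  rw [Polynomial.coeff_coe, PowerSeries.coeff_mk, carlitzEPoly, finsetSum_coeff]
  simp only [coeff_C_mul_X_pow]
  rw [Finset.sum_subset (Finset.range_mono (show d + 1 ≤ max n d + 1 by omega)),
    Finset.sum_subset (Finset.range_mono (show n + 1 ≤ max n d + 1 by omega))]
  · refine Finset.sum_congr rfl fun i _ => ?_
    simp only [eq_comm]
  · intro i _ hi
    rw [if_neg]
    have : i < Fintype.card F ^ i := Nat.lt_pow_self Fintype.one_lt_card
    have : n < i := by simpa using hi
    omega
  · intro i _ hi
    rw [carlitzECoeff_of_lt, ite_self]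
    simpa using hi

theorem powerSum_recursion (d s : ℕ) : powerSum F d (s + 1) =
    (if s = 0 then (carlitzL F d)⁻¹ else 0) + ∑ i ∈ Finset.range (s + 1),
      if Fintype.card F ^ i ≤ s then
        carlitzECoeff F d i * powerSum F d (s - Fintype.card F ^ i + 1) else 0 := by
  have h := congrArg (PowerSeries.coeff s) (carlitzE_mul_powerSum F d)
  rw [sub_mul, one_mul, map_sub, coe_carlitzEPoly, coeff_mk_pow_mul Fintype.one_lt_card,
    PowerSeries.coeff_C] at h
  simp only [PowerSeries.coeff_mk] at h
  rw [← h]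
  ring

/-- For $i\le d$ the product is the $q^i$-th power of $\ell_d/\ell_{d-i}$; for $i>d$ its factor with
$j=i-d$ vanishes. This matches the recursion coefficients of the $H_s$, twisted $d$ times and
evaluated at $t$, with those of the power sums. -/
theorem prod_eq_carlitzECoeff (d i : ℕ) :
    ∏ j ∈ Finset.Icc 1 i, (tElt F ^ Fintype.card F ^ i - tElt F ^ Fintype.card F ^ (j + d)) =
      carlitzDC F i * carlitzL F d ^ Fintype.card F ^ i * carlitzECoeff F d i := by
  rw [carlitzECoeff]
  split_ifs with h
  · obtain ⟨m, rfl⟩ := Nat.exists_eq_add_of_le h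
    have h1 := carlitzDC_ne_zero F i
    have h2 := carlitzL_ne_zero F m
    rw [Nat.add_sub_cancel_left]
    field_simp
    have h3 : ∀ n, carlitzL F (m + n) = carlitzL F m *
        ∏ j ∈ Finset.Icc 1 n, (tElt F - tElt F ^ Fintype.card F ^ (m + j)) := by
      intro n
      induction n with
      | zero => simp
      | succ n ih =>
        rw [← add_assoc, carlitzL_succ, ih, Finset.prod_Icc_succ_top (by omega)]
        ring_nf
    rw [add_comm i m, h3, mul_pow, mul_comm, ← Finset.prod_pow]
    congr 1
    refine Finset.prod_congr rfl fun j _ => ?_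
    rw [sub_pow_card_pow, ← pow_mul, ← pow_add]
    congr 3
    omega
  · rw [mul_zero]
    refine Finset.prod_eq_zero (i := i - d) (by simp; omega) ?_
    rw [Nat.sub_add_cancel (by omega), sub_self]

/-- The Anderson–Thakur interpolation of power sums. -/
theorem eval_twistPoly_HPoly (d s : ℕ) : (twistPoly F d (HPoly F s)).eval (tElt F) =
    aeval (tElt F) (carlitzPi F s) * carlitzL F d ^ (s + 1) * powerSum F d (s + 1) := by
  have hL := carlitzL_ne_zero F d
  induction s using Nat.strong_induction_on with
  | _ s ih =>
  obtain ⟨c, hc, h⟩ := HPoly_recursion F s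
  -- The two recursions are compared term by term; `c i` supplies the quotient of Carlitz
  -- factorials.
  rw [h, powerSum_recursion, mul_add, map_add, eval_add, map_sum, eval_finsetSum, Finset.mul_sum]
  congr 1
  · split_ifs with hs
    · simp [hs, carlitzPi_zero, hL]
    · simp
  · refine Finset.sum_congr rfl fun i _ => ?_
    split_ifs with hi
    · have hpos : 0 < Fintype.card F ^ i := pow_pos Fintype.card_pos _
      have e1 : (twistPoly F d (∏ j ∈ Finset.Icc 1 i,
          (X ^ Fintype.card F ^ i - C (tElt F ^ Fintype.card F ^ j)))).eval (tElt F) =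
          ∏ j ∈ Finset.Icc 1 i,
            (tElt F ^ Fintype.card F ^ i - tElt F ^ Fintype.card F ^ (j + d)) := by
        rw [map_prod, eval_prod]
        refine Finset.prod_congr rfl fun j _ => ?_
        simp [twistPoly, frobPow_natCast, ← pow_mul, ← pow_add, add_comm]
      have e2 : (twistPoly F d ((c i).map (algebraMap F (CInf F)))).eval (tElt F) =
          aeval (tElt F) (c i) := by
        have : twistPoly F d ((c i).map (algebraMap F (CInf F))) =
            (c i).map (algebraMap F (CInf F)) := by
          ext n
          simp [twistPoly, frobPow_algebraMap]
        rw [this, eval_map_algebraMap]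
      rw [map_mul, map_mul, eval_mul, eval_mul, e1, e2, prod_eq_carlitzECoeff,
        ih _ (by omega), ← hc i hi, map_mul, map_mul, carlitzDC]
      have hs : carlitzL F d ^ (s + 1) = carlitzL F d ^ Fintype.card F ^ i *
          carlitzL F d ^ (s - Fintype.card F ^ i + 1) := by
        rw [← pow_add]
        congr 1
        omega
      rw [hs]
      ring
    · simp

/-- The function `Ω^s H_{s-1}`. -/
def OmegaH (s : ℕ) : PowerSeries (CInf F) := Omega F ^ s * (HPoly F (s - 1) : PowerSeries (CInf F))

theorem OmegaH_mem_entire (s : ℕ) : OmegaH F s ∈ entire (CInf F) :=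
  mul_mem (pow_mem (Omega_mem_entire F) _) (coe_mem_entire _)

theorem evalAtT_twist_OmegaH (k : ℤ) (s : ℕ) : evalAtT F (twist F k (OmegaH F s)) =
    evalAtT F (twist F k (Omega F)) ^ s * (twistPoly F k (HPoly F (s - 1))).eval (tElt F) := by
  rw [OmegaH, map_mul, map_pow, twist_coe, evalAtT_mul _ (coe_mem_entire _), evalAtT_pow,
    evalAtT_coe]
  · exact twist_mem_entire (Omega_mem_entire F) k
  · exact pow_mem (twist_mem_entire (Omega_mem_entire F) k) _

/-- The factor $\ell_d^s$ in the interpolation formula cancels against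
$\Omega^{(d)}(t)^s=(\Omega(t)/\ell_d)^s$. -/
theorem evalAtT_twist_OmegaH_natCast (d : ℕ) {s : ℕ} (hs : 0 < s) :
    evalAtT F (twist F d (OmegaH F s)) = gammaC F s * powerSum F d s / piTilde F ^ s := by
  obtain ⟨s, rfl⟩ : ∃ n, s = n + 1 := ⟨s - 1, by omega⟩
  have hL := carlitzL_ne_zero F d
  rw [evalAtT_twist_OmegaH, Nat.add_sub_cancel, eval_twistPoly_HPoly, piTilde_eq,
    ← evalAtT_twist_Omega F d, gammaC, carlitzGamma, Nat.add_sub_cancel, inv_pow, div_inv_eq_mul]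
  ring

theorem evalAtT_twist_OmegaH_of_neg {k : ℤ} (hk : k < 0) {s : ℕ} (hs : 0 < s) :
    evalAtT F (twist F k (OmegaH F s)) = 0 := by
  rw [evalAtT_twist_OmegaH, evalAtT_twist_Omega_of_neg F hk, zero_pow hs.ne', zero_mul]

/-- Explains the shape of the delayed polynomials: their linear factors are those that $\Omega^s$
acquires under the $(-w)$-th twist. -/
theorem Omega_pow_mul_delayedH (s w : ℕ) :
    Omega F ^ s * (delayedH F s w : PowerSeries (CInf F)) = twist F (-(w : ℤ)) (OmegaH F s) := by
  rw [OmegaH, map_mul, map_pow, twist_neg_Omega, delayedH, twist_coe, Polynomial.coe_mul,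
    Polynomial.coe_pow]
  ring

/-- The Gauss norms of `Ω^s H_{s-1}` decay under twisting. -/
theorem exists_gaussBound_OmegaH {s : ℕ} (hs : 0 < s) : ∃ ρ > 1, ∃ c < 1,
    GaussBound ρ c (OmegaH F s) := by
  have h1 := one_lt_norm_tTilde F
  have ht := one_lt_norm_tElt F
  have hq := Fintype.one_lt_card (α := F)
  set N := (HPoly F (s - 1)).natDegree with hN
  -- The choice $\rho=|\tilde t|^{1/(N+1)}$ keeps the cost $\rho^N$ of passing from radius $1$ to
  -- $\rho$ below $|\tilde t|$. The resulting constant is at most $|\tilde t|^{-qs}|\tilde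
  -- t|^{q(s-1)}\rho^N<1$.
  obtain ⟨ρ, hρ1, hρ⟩ : ∃ ρ > 1, ρ ^ (N + 1) = ‖tTilde F‖ := by
    refine ⟨‖tTilde F‖ ^ ((N + 1 : ℕ) : ℝ)⁻¹, Real.one_lt_rpow h1 (by positivity), ?_⟩
    exact Real.rpow_inv_natCast_pow (by positivity) (by omega)
  have hρt : ρ ≤ ‖tElt F‖ ^ Fintype.card F := by
    calc ρ ≤ ρ ^ (N + 1) := le_self_pow₀ hρ1.le (by omega)
      _ = ‖tTilde F‖ := hρ
      _ ≤ ‖tElt F‖ := by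
        rw [norm_tElt]
        exact le_self_pow₀ h1.le (by omega)
      _ ≤ _ := le_self_pow₀ ht.le (by omega)
  have hH : GaussBound ρ (‖tTilde F‖ ^ (Fintype.card F * (s - 1)) * ρ ^ N)
      (HPoly F (s - 1) : PowerSeries (CInf F)) := by
    intro n
    rcases le_or_gt n N with h | h
    · have := gaussBound_HPoly F (s - 1) n
      rw [one_pow, mul_one] at this
      exact mul_le_mul this (pow_le_pow_right₀ hρ1.le h) (by positivity) (by positivity)
    · rw [Polynomial.coeff_coe, coeff_eq_zero_of_natDegree_lt h, norm_zero, zero_mul]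
      positivity
  have hO := (((gaussBound_Omega F).mono_radius (by positivity) hρt).pow (by positivity) s).mul
    (by positivity) hH
  refine ⟨ρ, hρ1, _, ?_, hO⟩
  have hlt : ρ ^ N < ‖tTilde F‖ ^ Fintype.card F := by
    calc ρ ^ N < ρ ^ (N + 1) := pow_lt_pow_right₀ hρ1 (Nat.lt_succ_self N)
      _ = ‖tTilde F‖ := hρ
      _ ≤ _ := le_self_pow₀ h1.le (by omega)
  have hs' : ‖tTilde F‖ ^ (Fintype.card F * (s - 1)) * ‖tTilde F‖ ^ Fintype.card F =
      (‖tTilde F‖ ^ Fintype.card F) ^ s := by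
    rw [← pow_add, ← pow_mul, ← Nat.mul_succ, Nat.succ_eq_add_one, Nat.sub_add_cancel hs]
  rw [inv_pow, inv_mul_lt_one₀ (by positivity), ← hs']
  exact mul_lt_mul_of_pos_left hlt (by positivity)

end CarlitzPolynomials

/-! ### Convergence of sums of twisted products over tuples. -/

/-- If all factors are at most $M$ with $M\ge1$ and the product is at least $\varepsilon$, then each
factor is at least $\varepsilon/M^{|\kappa|}$, which leaves finitely many values for each
coordinate. An empty product would be constantly one. -/
theorem tendsto_prod_cofinite {κ : Type*} [Fintype κ] [Nonempty κ] {a : κ → ℕ → ℝ}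
    (ha : ∀ k, Filter.Tendsto (a k) Filter.cofinite (nhds 0)) :
    Filter.Tendsto (fun e : κ → ℕ => ∏ k, a k (e k)) Filter.cofinite (nhds 0) := by
  classical
  have hb : ∃ M : ℝ, 1 ≤ M ∧ ∀ k n, ‖a k n‖ ≤ M := by
    have h : ∀ k, ∃ M, ∀ n, ‖a k n‖ ≤ M := fun k => by
      obtain ⟨M, hM⟩ := (ha k).norm.bddAbove_range_of_cofinite
      exact ⟨M, fun n => hM ⟨n, rfl⟩⟩
    choose M hM using h
    obtain ⟨N, hN⟩ := Finite.exists_le M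
    exact ⟨max N 1, le_max_right _ _, fun k n => (hM k n).trans ((hN k).trans (le_max_left _ _))⟩
  obtain ⟨M, hM1, hM⟩ := hb
  have hM0 : 0 < M := zero_lt_one.trans_le hM1
  rw [Metric.tendsto_nhds]
  intro ε hε
  have hT : ∀ k, {n | ε / M ^ (Fintype.card κ) ≤ ‖a k n‖}.Finite := by
    intro k
    have := (Metric.tendsto_nhds.1 (ha k)) (ε / M ^ (Fintype.card κ)) (by positivity)
    rw [Filter.eventually_cofinite] at this
    simpa using this
  rw [Filter.eventually_cofinite]
  refine (Set.Finite.pi' hT).subset fun e he => ?_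
  intro k
  by_contra hk
  refine he ?_
  have hk : ‖a k (e k)‖ < ε / M ^ (Fintype.card κ) := not_le.1 hk
  rw [dist_zero_right, ← Finset.mul_prod_erase _ _ (Finset.mem_univ k), norm_mul, norm_prod]
  have h1 : ∏ j ∈ Finset.univ.erase k, ‖a j (e j)‖ ≤ M ^ Fintype.card κ := by
    refine (Finset.prod_le_prod (fun _ _ => norm_nonneg _) fun j _ => hM j (e j)).trans ?_
    rw [Finset.prod_const]
    exact pow_le_pow_right₀ hM1 ((Finset.card_le_card (Finset.erase_subset _ _)))
  calc _ ≤ ‖a k (e k)‖ * M ^ Fintype.card κ := mul_le_mul_of_nonneg_left h1 (norm_nonneg _)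
    _ < ε / M ^ (Fintype.card κ) * M ^ Fintype.card κ :=
      mul_lt_mul_of_pos_right hk (by positivity)
    _ = ε := by field_simp

theorem exists_norm_le_of_tendsto {α : Type*} {c : α → ℝ}
    (hc : Filter.Tendsto c Filter.cofinite (nhds 0)) : ∃ M, 0 ≤ M ∧ ∀ i, c i ≤ M := by
  obtain ⟨M, hM⟩ := hc.norm.bddAbove_range_of_cofinite
  exact ⟨max M 0, le_max_right _ _, fun i =>
    (le_abs_self _).trans ((hM ⟨i, rfl⟩).trans (le_max_left _ _))⟩

section Decaying

variable (F : Type*) [Field F] [Fintype F]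

/-- The twists of `g` tend to zero, uniformly on every disc. -/
def Decaying (g : PowerSeries (CInf F)) : Prop :=
  ∀ R : ℝ, 0 ≤ R → ∃ c : ℕ → ℝ, Filter.Tendsto c Filter.cofinite (nhds 0) ∧
    ∀ e : ℕ, GaussBound R (c e) (twist F e g)

theorem decaying_twist_OmegaH {s : ℕ} (hs : 0 < s) (w : ℕ) :
    Decaying F (twist F (-(w : ℤ)) (OmegaH F s)) := by
  intro R hR
  classical
  have h1 : ∀ e : ℕ, ∃ B, GaussBound R B (twist F e (twist F (-(w : ℤ)) (OmegaH F s))) := fun e =>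
    mem_entire.1 (twist_mem_entire (twist_mem_entire (OmegaH_mem_entire F s) _) _) R hR
  choose B hB using h1
  obtain ⟨ρ, hρ, c, hc, hg⟩ := exists_gaussBound_OmegaH F hs
  have hc0 := hg.nonneg
  -- For large $e$ the twisted Gauss bound reaches radius $R$ and decays like $c^{q^{e-w}}$; for the
  -- finitely many other $e$ any bound will do.
  refine ⟨fun e => if w ≤ e ∧ R ≤ ρ ^ Fintype.card F ^ (e - w) then c ^ Fintype.card F ^ (e - w)
    else B e, ?_, fun e => ?_⟩
  · rw [Nat.cofinite_eq_atTop]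
    have h2 : Filter.Tendsto (fun e => Fintype.card F ^ (e - w)) Filter.atTop Filter.atTop :=
      (tendsto_pow_atTop_atTop_of_one_lt Fintype.one_lt_card).comp
        (Filter.tendsto_sub_atTop_nat w)
    refine Filter.Tendsto.congr' ?_ ((tendsto_pow_atTop_nhds_zero_of_lt_one hc0 hc).comp h2)
    filter_upwards [Filter.eventually_ge_atTop w,
      ((tendsto_pow_atTop_atTop_of_one_lt hρ).comp h2).eventually_ge_atTop R] with e he1 he2
    exact (if_pos ⟨he1, he2⟩).symm
  · dsimp only
    split_ifs with h
    · rw [← twist_add, ← sub_eq_add_neg, ← Nat.cast_sub h.1]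
      exact (hg.twist (by positivity) (e - w)).mono_radius hR h.2
    · exact hB e

variable {F}

theorem exists_gaussBound_prod {κ : Type*} [Fintype κ] {g : κ → PowerSeries (CInf F)}
    (hg : ∀ k, Decaying F (g k)) {R : ℝ} (hR : 0 ≤ R) : ∃ c : (κ → ℕ) → ℝ,
    Filter.Tendsto c Filter.cofinite (nhds 0) ∧
      ∀ e : κ → ℕ, GaussBound R (c e) (∏ k, twist F (e k) (g k)) := by
  choose c hc hb using fun k => hg k R hR
  rcases isEmpty_or_nonempty κ with h | h
  -- For empty `κ` there is a single tuple, so the cofinite filter is trivial and the constant $1$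
  -- tends to zero.
  · refine ⟨fun _ => 1, ?_, fun e => by simpa using GaussBound.one (K := CInf F) R⟩
    rw [Filter.cofinite_eq_bot]
    exact Filter.tendsto_bot
  · exact ⟨_, tendsto_prod_cofinite hc, fun e => GaussBound.prod hR _ fun k _ => hb k (e k)⟩

theorem summable_coeff_prod {κ : Type*} [Fintype κ] {g : κ → PowerSeries (CInf F)}
    (hg : ∀ k, Decaying F (g k)) (p : (κ → ℕ) → Prop) (n : ℕ) :
    Summable fun e : {e // p e} => PowerSeries.coeff n (∏ k, twist F (e.1 k) (g k)) := by
  obtain ⟨c, hc, hb⟩ := exists_gaussBound_prod hg zero_le_one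
  refine summable_of_norm_le (c := fun e : {e // p e} => c e.1) (fun e => ?_)
    (hc.comp Subtype.val_injective.tendsto_cofinite)
  simpa using hb e.1 n

open scoped PowerSeries.WithPiTopology in
theorem summable_prod_twist {κ : Type*} [Fintype κ] {g : κ → PowerSeries (CInf F)}
    (hg : ∀ k, Decaying F (g k)) (p : (κ → ℕ) → Prop) :
    Summable fun e : {e // p e} => ∏ k, twist F (e.1 k) (g k) :=
  PowerSeries.WithPiTopology.summable_iff_summable_coeff _ |>.2 (summable_coeff_prod hg p)

-- On each disc all partial sums satisfy one Gauss bound by the ultrametric inequality, and the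
-- bound survives coefficientwise limits.
open scoped PowerSeries.WithPiTopology in
theorem tsum_prod_twist_mem_entire {κ : Type*} [Fintype κ] {g : κ → PowerSeries (CInf F)}
    (hg : ∀ k, Decaying F (g k)) (p : (κ → ℕ) → Prop) :
    ∑' e : {e // p e}, ∏ k, twist F (e.1 k) (g k) ∈ entire (CInf F) := by
  refine mem_entire.2 fun R hR => ?_
  obtain ⟨c, hc, hb⟩ := exists_gaussBound_prod hg hR
  obtain ⟨M, hM0, hM⟩ := exists_norm_le_of_tendsto hc
  refine ⟨M, GaussBound.of_tendsto (l := Filter.atTop)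
    (g := fun s : Finset {e // p e} => ∑ e ∈ s, ∏ k, twist F (e.1 k) (g k))
    (fun s => GaussBound.sum hR hM0 _ fun e _ => (hb e.1).mono (hM e.1)) fun n => ?_⟩
  have := (summable_prod_twist hg p).hasSum
  exact (PowerSeries.WithPiTopology.tendsto_iff_coeff_tendsto _ _ _ _).1 this n

open scoped PowerSeries.WithPiTopology in
theorem evalAtT_tsum_prod_twist {κ : Type*} [Fintype κ] {g : κ → PowerSeries (CInf F)}
    (hg : ∀ k, Decaying F (g k)) (hg' : ∀ k, g k ∈ entire (CInf F)) (p : (κ → ℕ) → Prop) :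
    evalAtT F (∑' e : {e // p e}, ∏ k, twist F (e.1 k) (g k)) =
      ∑' e : {e // p e}, ∏ k, evalAtT F (twist F (e.1 k) (g k)) := by
  obtain ⟨c, hc, hb⟩ := exists_gaussBound_prod hg (R := ‖tElt F‖ + 1) (by positivity)
  have h := hasSum_eval (x := tElt F) (lt_add_one _) (fun e : {e // p e} => hb e.1)
    (hc.comp Subtype.val_injective.tendsto_cofinite)
    ((PowerSeries.WithPiTopology.hasSum_iff_hasSum_coeff _).1 (summable_prod_twist hg p).hasSum)
  refine h.tsum_eq.symm.trans (tsum_congr fun e => ?_)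
  exact evalAtT_prod (fun k => twist_mem_entire (hg' k) _) _

end Decaying

/-! ### Combinatorics of positions, delays and jumps. -/

section Positions

variable {r : ℕ}

/-- The indices from `b` to `a + 1` are the last one and those from `b` to `a`. -/
def betweenSucc (b : Fin (r + 1)) (a : Fin r) (h : b ≤ a.castSucc) :
    Option (Between b a.castSucc) → Between b a.succ
  | none => ⟨a, h, Fin.castSucc_lt_succ⟩
  | some k => ⟨k.1, k.2.1, k.2.2.trans Fin.castSucc_lt_succ⟩

theorem bijective_betweenSucc (b : Fin (r + 1)) (a : Fin r) (h : b ≤ a.castSucc) :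
    Function.Bijective (betweenSucc b a h) := by
  constructor
  · rintro (_ | x) (_ | y) hxy
    · rfl
    · have h1 : a = y.1 := congrArg Subtype.val hxy
      refine absurd y.2.2 ?_
      rw [← h1]
      exact lt_irrefl _
    · have h1 : x.1 = a := congrArg Subtype.val hxy
      refine absurd x.2.2 ?_
      rw [h1]
      exact lt_irrefl _
    · have h1 : x.1 = y.1 := congrArg (fun z : Between b a.succ => z.1) hxy
      rw [Subtype.ext h1]
  · rintro ⟨k, hk1, hk2⟩
    rcases (Fin.le_castSucc_iff.2 hk2).lt_or_eq with hlt | heq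
    · exact ⟨some ⟨k, hk1, hlt⟩, rfl⟩
    · have : k = a := Fin.castSucc_injective _ heq
      subst this
      exact ⟨none, rfl⟩

theorem tailSum_eq_add (s : Fin r → ℕ) {b a : Fin (r + 1)} (h : b ≤ a) :
    tailSum s b = ∑ k : Between b a, s k + tailSum s a := by
  rw [tailSum, tailSum, ← Finset.sum_filter_add_sum_filter_not (Finset.univ.filter fun k =>
    b ≤ Fin.castSucc k) (fun k => Fin.castSucc k < a), Finset.filter_filter, Finset.filter_filter]
  congr 1
  · exact Finset.sum_subtype _ (by simp) _
  · refine Finset.sum_congr (Finset.filter_congr fun k _ => ?_) fun _ _ => rfl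
    rw [not_lt]
    exact ⟨fun h => h.2, fun h' => ⟨h.trans h', h'⟩⟩

theorem tailSum_castSucc (s : Fin r → ℕ) (a : Fin r) :
    tailSum s a.castSucc = s a + tailSum s a.succ := by
  rw [tailSum_eq_add s Fin.castSucc_lt_succ.le,
    ← (Equiv.ofBijective _ (bijective_betweenSucc a.castSucc a le_rfl)).sum_comp,
    Fintype.sum_option]
  have : IsEmpty (Between a.castSucc a.castSucc) := ⟨fun k => (k.2.1.trans_lt k.2.2).false⟩
  simp [betweenSucc]

theorem tailSum_zero (s : Fin r → ℕ) : tailSum s 0 = ∑ k, s k := by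
  simp [tailSum]

theorem tailSum_le (s : Fin r → ℕ) (a : Fin (r + 1)) : tailSum s a ≤ ∑ k, s k := by
  rw [← tailSum_zero, tailSum_eq_add s (Fin.zero_le a)]
  exact Nat.le_add_left _ _

theorem delay_le (I : Finset (Fin r)) (k : Fin r) : delay I k ≤ (positions r \ I).card :=
  Finset.card_filter_le _ _

/-- The sets counted by the two delays can differ only in the element `i`, which is counted exactly
when it is not in `I`. -/
theorem delay_eq (I : Finset (Fin r)) {i j : Fin r} (hij : i.1 + 1 = j.1) :
    delay I i = delay I j + if i ∈ I then 0 else 1 := by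
  have hi : i ∈ positions r := by
    rw [positions, Finset.mem_filter]
    exact ⟨Finset.mem_univ _, by omega⟩
  have h : (positions r \ I).filter (fun k => i ≤ k) = (positions r \ I).filter (fun k => j ≤ k) ∪
      if i ∈ I then ∅ else {i} := by
    ext k
    have h1 : i ≤ k ↔ j ≤ k ∨ k = i := by
      rw [Fin.le_def, Fin.le_def, Fin.ext_iff]
      omega
    rw [Finset.mem_union, Finset.mem_filter, Finset.mem_filter, Finset.mem_sdiff, h1]
    split_ifs with hI
    · simp only [Finset.notMem_empty, or_false]
      constructor
      · rintro ⟨⟨h2, h3⟩, h4 | rfl⟩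
        · exact ⟨⟨h2, h3⟩, h4⟩
        · exact absurd hI h3
      · rintro ⟨h2, h3⟩
        exact ⟨h2, Or.inl h3⟩
    · rw [Finset.mem_singleton]
      constructor
      · rintro ⟨h2, h4 | rfl⟩
        · exact Or.inl ⟨h2, h4⟩
        · exact Or.inr rfl
      · rintro (⟨h2, h3⟩ | rfl)
        · exact ⟨h2, Or.inl h3⟩
        · exact ⟨⟨hi, hI⟩, Or.inr rfl⟩
  rw [delay, h, Finset.card_union_of_disjoint, delay]
  · split_ifs <;> simp
  · rw [Finset.disjoint_left]
    intro k hk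
    have hk := (Finset.mem_filter.1 hk).2
    split_ifs
    · simp
    · rw [Finset.mem_singleton]
      rintro rfl
      rw [Fin.le_def] at hk
      omega

theorem Between.covBy {b a : Fin (r + 1)} {i j : Between b a} (h : i ⋖ j) :
    i.1.1 + 1 = j.1.1 := by
  have hlt : i.1.1 < j.1.1 := h.1
  by_contra hne
  have hj := j.1.2
  let k : Between b a := ⟨⟨i.1.1 + 1, by omega⟩, by
    have h1 := i.2.1
    have h2 := j.2.2
    rw [Fin.le_def] at h1 ⊢
    rw [Fin.lt_def] at h2 ⊢
    simp only [Fin.val_castSucc] at h1 h2 ⊢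
    omega⟩
  refine h.2 (c := k) ?_ ?_
  · change i.1.1 < i.1.1 + 1
    omega
  · change i.1.1 + 1 < j.1.1
    omega

/-- The combinatorial core. For consecutive positions $e_i>e_j$ reads $d_i+w_i-w_j>d_j$, where
$w_i-w_j$ is $0$ for $i\in I$ and $1$ otherwise; so a jump of $d$ is forced in the first case and
only $d_i\ge d_j$ in the second. -/
theorem strictAnti_add_delay_iff (I : Finset (Fin r)) {b a : Fin (r + 1)} (d : Between b a → ℕ) :
    StrictAnti (fun k => d k + delay I k.1) ↔ HasJumpsAtLeast {k | k.1 ∈ I} d := by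
  let := Fintype.toLocallyFiniteOrder (α := Between b a)
  rw [strictAnti_iff_forall_covBy, HasJumpsAtLeast]
  refine forall_congr' fun i => forall_congr' fun j => forall_congr' fun h => ?_
  have hmem : i ∈ {k : Between b a | k.1 ∈ I} ↔ i.1 ∈ I := Iff.rfl
  rw [delay_eq I (Between.covBy h), hmem]
  split_ifs with hI
  · simp only [hI, true_imp_iff]
    omega
  · simp only [hI, false_imp_iff]
    rw [and_true]
    omega

end Positions

/-! ### The matrices $L$ and $\Psi$: functional equation and values at $T=t$. -/

section LFacts

variable {F : Type*} [Field F] [Fintype F] {r : ℕ} {s : Fin r → ℕ} (I : Finset (Fin r))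

/-- The function `Ω^{s_k} Q_{k+1,k}`. -/
def delayedOmegaH (F : Type*) [Field F] [Fintype F] {r : ℕ} (s : Fin r → ℕ) (I : Finset (Fin r))
    (k : Fin r) : PowerSeries (CInf F) :=
  twist F (-(delay I k : ℤ)) (OmegaH F (s k))

theorem delayedOmegaH_mem_entire (k : Fin r) : delayedOmegaH F s I k ∈ entire (CInf F) :=
  twist_mem_entire (OmegaH_mem_entire F _) _

open scoped PowerSeries.WithPiTopology in
theorem LMatrix_of_le {a b : Fin (r + 1)} (h : b ≤ a) : LMatrix F s I a b =
    ∑' e : {e : Between b a → ℕ // StrictAnti e}, ∏ k : Between b a,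
        twist F (e.1 k) (delayedOmegaH F s I k) := by
  simp only [LMatrix, Matrix.of_apply, if_pos h, delayedOmegaH, Omega_pow_mul_delayedH]

theorem LMatrix_of_not_le {a b : Fin (r + 1)} (h : ¬ b ≤ a) : LMatrix F s I a b = 0 := by
  simp only [LMatrix, Matrix.of_apply, if_neg h]

open scoped PowerSeries.WithPiTopology in
theorem LMatrix_self (a : Fin (r + 1)) : LMatrix F s I a a = 1 := by
  have : IsEmpty (Between a a) := ⟨fun k => (k.2.1.trans_lt k.2.2).false⟩
  rw [LMatrix_of_le I le_rfl]
  have h : StrictAnti (isEmptyElim : Between a a → ℕ) := fun i => isEmptyElim i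
  have : Unique {e : Between a a → ℕ // StrictAnti e} :=
    ⟨⟨⟨isEmptyElim, h⟩⟩, fun e => Subtype.ext (Subsingleton.elim _ _)⟩
  rw [tsum_fintype]
  simp

open scoped PowerSeries.WithPiTopology in
theorem LMatrix_mem_entire (hs : ∀ k, 0 < s k) (a b : Fin (r + 1)) :
    LMatrix F s I a b ∈ entire (CInf F) := by
  by_cases h : b ≤ a
  · rw [LMatrix_of_le I h]
    exact tsum_prod_twist_mem_entire
      (g := fun k : Between b a => delayedOmegaH F s I k)
      (fun k => decaying_twist_OmegaH F (hs k) _) _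
  · rw [LMatrix_of_not_le I h]
    exact zero_mem _

-- The twist by $-1$ lowers all exponents by one. Tuples with positive last exponent then reproduce
-- the whole sum; tuples with last exponent $0$ split off its factor, twisted to $-1$, and leave the
-- sum with one index fewer.
open scoped PowerSeries.WithPiTopology in
theorem twist_LMatrix_succ (hs : ∀ k, 0 < s k) (a : Fin r) (b : Fin (r + 1)) :
    twist F (-1) (LMatrix F s I a.succ b) = LMatrix F s I a.succ b +
      twist F (-1) (delayedOmegaH F s I a) * LMatrix F s I a.castSucc b := by
  rcases lt_trichotomy b a.succ with h | rfl | h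
  · have hb : b ≤ a.castSucc := Fin.le_castSucc_iff.2 h
    set φ := Equiv.ofBijective _ (bijective_betweenSucc b a hb) with hφ
    have hlast : ∀ k, k ≤ φ none := fun k => Fin.castSucc_le_castSucc_iff.1
      (Fin.le_castSucc_iff.2 k.2.2)
    have hlast' : ∀ k, φ (some k) < φ none := fun k => Fin.castSucc_lt_castSucc_iff.1 k.2.2
    have hmono : ∀ j k, j < k ↔ φ (some j) < φ (some k) := fun j k => Iff.rfl
    have hshift : ∀ n : ℕ, (-1 + ((n + 1 : ℕ) : ℤ)) = n := fun n => by
      push_cast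
      ring
    -- `α` parametrises the tuples whose last exponent, hence every exponent, is positive.
    let α : {e : Between b a.succ → ℕ // StrictAnti e} →
        {e : Between b a.succ → ℕ // StrictAnti e} := fun e =>
      ⟨fun k => e.1 k + 1, fun i j hij => Nat.succ_lt_succ (e.2 hij)⟩
    -- `β'` appends a last exponent $0$ after raising the others by one.
    let β' : (Between b a.castSucc → ℕ) → Between b a.succ → ℕ := fun e k =>
      (φ.symm k).elim 0 fun k => e k + 1
    have hβ0 : ∀ e, β' e (φ none) = 0 := fun e => by simp [β']
    have hβ1 : ∀ e k, β' e (φ (some k)) = e k + 1 := fun e k => by simp [β']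
    have hβ : ∀ e, StrictAnti e → StrictAnti (β' e) := by
      intro e he i j hij
      obtain ⟨i, rfl⟩ := φ.surjective i
      obtain ⟨j, rfl⟩ := φ.surjective j
      rcases i with _ | i
      · exact absurd (hlast _) hij.not_ge
      rcases j with _ | j
      · rw [hβ0, hβ1]
        exact Nat.succ_pos _
      · rw [hβ1, hβ1]
        exact Nat.succ_lt_succ (he ((hmono _ _).2 hij))
    let β : {e : Between b a.castSucc → ℕ // StrictAnti e} →
        {e : Between b a.succ → ℕ // StrictAnti e} := fun e => ⟨β' e.1, hβ _ e.2⟩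
    have hα_inj : Function.Injective α := by
      intro e e' h
      refine Subtype.ext (funext fun k => ?_)
      have := congrFun (congrArg Subtype.val h) k
      exact Nat.succ_injective this
    have hβ_inj : Function.Injective β := by
      intro e e' h
      refine Subtype.ext (funext fun k => ?_)
      have : β' e.1 (φ (some k)) = β' e'.1 (φ (some k)) :=
        congrFun (congrArg Subtype.val h) (φ (some k))
      rw [hβ1, hβ1] at this
      omega
    have hcompl : IsCompl (Set.range α) (Set.range β) := by
      constructor
      · rw [Set.disjoint_left]
        rintro _ ⟨e, rfl⟩ ⟨e', h⟩
        have : β' e'.1 (φ none) = e.1 (φ none) + 1 :=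
          congrFun (congrArg Subtype.val h) (φ none)
        rw [hβ0] at this
        omega
      · rw [codisjoint_iff_le_sup]
        intro e _
        rcases Nat.eq_zero_or_pos (e.1 (φ none)) with h0 | h0
        · right
          have hpos : ∀ k, 0 < e.1 (φ (some k)) := fun k =>
            (Nat.zero_le _).trans_lt (e.2 (hlast' k))
          refine ⟨⟨fun k => e.1 (φ (some k)) - 1, fun i j hij => ?_⟩, Subtype.ext (funext fun k => ?_)⟩
          · have h1 := e.2 ((hmono _ _).1 hij)
            have h2 := hpos i
            have h3 := hpos j
            change e.1 (φ (some j)) - 1 < e.1 (φ (some i)) - 1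
            omega
          · obtain ⟨k, rfl⟩ := φ.surjective k
            change β' _ _ = _
            rcases k with _ | k
            · rw [hβ0, h0]
            · rw [hβ1]
              exact Nat.sub_add_cancel (hpos k)
        · left
          have hpos : ∀ k, 0 < e.1 k := fun k => h0.trans_le (e.2.antitone (hlast k))
          refine ⟨⟨fun k => e.1 k - 1, fun i j hij => ?_⟩, Subtype.ext (funext fun k => ?_)⟩
          · have h1 := e.2 hij
            have h2 := hpos i
            have h3 := hpos j
            change e.1 j - 1 < e.1 i - 1
            omega
          · exact Nat.sub_add_cancel (hpos k)
    have hdec : ∀ k, Decaying F (delayedOmegaH F s I k) := fun k =>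
      decaying_twist_OmegaH F (hs k) _
    have H := (summable_prod_twist (fun k : Between b a.succ => hdec k) StrictAnti).hasSum
    have H' := (summable_prod_twist (fun k : Between b a.castSucc => hdec k) StrictAnti).hasSum
    rw [← LMatrix_of_le I h.le] at H
    rw [← LMatrix_of_le I hb] at H'
    have H1 := H.map (twist F (-1)) (continuous_twist F (-1))
    refine H1.unique (HasSum.add_isCompl hcompl (hα_inj.hasSum_range_iff.2 ?_)
      (hβ_inj.hasSum_range_iff.2 ?_))
    · convert H using 2 with e
      simp only [Function.comp_apply, map_prod, ← twist_add]
      refine Finset.prod_congr rfl fun k _ => ?_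
      change twist F (-1 + ((e.1 k + 1 : ℕ) : ℤ)) _ = _
      rw [hshift]
    · have H2 := H'.mul_left (twist F (-1) (delayedOmegaH F s I a))
      refine Eq.subst (motive := fun f => HasSum f _) (funext fun e => ?_) H2
      simp only [Function.comp_apply, map_prod, ← twist_add]
      symm
      rw [← φ.prod_comp, Fintype.prod_option]
      change twist F (-1 + (β' e.1 (φ none) : ℤ)) _ *
        ∏ k, twist F (-1 + (β' e.1 (φ (some k)) : ℤ)) _ = _
      simp only [hβ0, hβ1]
      congr 1
      exact Finset.prod_congr rfl fun k _ => by
        rw [hshift]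
        rfl
  · rw [LMatrix_self, LMatrix_of_not_le I (not_le.2 Fin.castSucc_lt_succ), map_one, mul_zero,
      add_zero]
  · rw [LMatrix_of_not_le I h.not_ge,
      LMatrix_of_not_le I (Fin.castSucc_lt_succ.trans h).not_ge, map_zero, mul_zero, add_zero]

theorem twist_LMatrix_zero (b : Fin (r + 1)) :
    twist F (-1) (LMatrix F s I 0 b) = LMatrix F s I 0 b := by
  rcases eq_or_ne b 0 with rfl | hb
  · rw [LMatrix_self, map_one]
  · rw [LMatrix_of_not_le I (fun h => hb (Fin.le_zero_iff.1 h)), map_zero]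

theorem evalAtT_LMatrix (hs : ∀ k, 0 < s k) {a b : Fin (r + 1)} (h : b ≤ a) :
    evalAtT F (LMatrix F s I a b) = (∏ k : Between b a, gammaC F (s k)) *
      weakMultizeta F (fun k : Between b a => s k) {k | k.1 ∈ I} /
        piTilde F ^ (∑ k : Between b a, s k) := by
  rw [LMatrix_of_le I h, evalAtT_tsum_prod_twist
    (g := fun k : Between b a => delayedOmegaH F s I k)
    (fun k => decaying_twist_OmegaH F (hs k) _) (fun k => delayedOmegaH_mem_entire I k)]
  -- The substitution $e_k=d_k+w_k$.
  let δ : {d : Between b a → ℕ // HasJumpsAtLeast {k | k.1 ∈ I} d} →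
      {e : Between b a → ℕ // StrictAnti e} := fun d =>
    ⟨fun k => d.1 k + delay I k.1, (strictAnti_add_delay_iff I d.1).2 d.2⟩
  have hδ : Function.Injective δ := by
    intro d d' h
    refine Subtype.ext (funext fun k => ?_)
    exact Nat.add_right_cancel (congrFun (congrArg Subtype.val h) k)
  rw [← hδ.tsum_eq]
  · rw [weakMultizeta, mul_div_right_comm, ← tsum_mul_left]
    refine tsum_congr fun d => ?_
    rw [← Finset.prod_pow_eq_pow_sum, ← Finset.prod_div_distrib, ← Finset.prod_mul_distrib]
    refine Finset.prod_congr rfl fun k _ => ?_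
    have : ((δ d).1 k : ℤ) + -(delay I k.1 : ℤ) = (d.1 k : ℤ) := by
      simp only [δ]
      push_cast
      ring
    rw [delayedOmegaH, ← twist_add, this, evalAtT_twist_OmegaH_natCast F _ (hs k)]
    ring
  -- A tuple outside the range of `δ` has some $e_k<w_k$, and its term contains a negative twist,
  -- which vanishes at $T=t$.
  · intro e he
    have hle : ∀ k, delay I k.1 ≤ e.1 k := by
      intro k
      by_contra hk
      refine he (Finset.prod_eq_zero (Finset.mem_univ k) ?_)
      rw [delayedOmegaH, ← twist_add]
      exact evalAtT_twist_OmegaH_of_neg F (by omega) (hs k)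
    have heq : (fun k => e.1 k - delay I k.1 + delay I k.1) = e.1 :=
      funext fun k => Nat.sub_add_cancel (hle k)
    refine ⟨⟨fun k => e.1 k - delay I k.1, (strictAnti_add_delay_iff I _).1 ?_⟩, Subtype.ext heq⟩
    rw [heq]
    exact e.2

theorem PsiMatrix_apply (a b : Fin (r + 1)) :
    PsiMatrix F s I a b = Omega F ^ tailSum s a * LMatrix F s I a b := by
  rw [PsiMatrix, Matrix.diagonal_mul]

theorem PsiMatrix_mem_entire (hs : ∀ k, 0 < s k) (a b : Fin (r + 1)) :
    PsiMatrix F s I a b ∈ entire (CInf F) := by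
  rw [PsiMatrix_apply]
  exact mul_mem (pow_mem (Omega_mem_entire F) _) (LMatrix_mem_entire I hs a b)

/-- The factor $\Omega(t)^{s_a+\cdots+s_r}$ completes the exponent of $\tilde\pi$ from the indices
between $b$ and $a$ to the full tail sum from $b$. -/
theorem evalAtT_PsiMatrix (hs : ∀ k, 0 < s k) {a b : Fin (r + 1)} (h : b ≤ a) :
    evalAtT F (PsiMatrix F s I a b) = (∏ k : Between b a, gammaC F (s k)) *
      weakMultizeta F (fun k : Between b a => s k) {k | k.1 ∈ I} / piTilde F ^ tailSum s b := by
  rw [PsiMatrix_apply, evalAtT_mul (pow_mem (Omega_mem_entire F) _) (LMatrix_mem_entire I hs a b),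
    evalAtT_pow (Omega_mem_entire F), evalAtT_LMatrix I hs h, tailSum_eq_add s h, pow_add,
    piTilde_eq]
  have := evalAtT_Omega_ne_zero F
  rw [inv_pow, inv_pow]
  field_simp

end LFacts

/-! ### Matrices over subrings, one-sided inverses, unipotent matrices. -/

section MatrixLemmas

variable {ι R : Type*} [CommRing R]

theorem mul_entries_mem [Fintype ι] (S : Subring R) {A B : Matrix ι ι R} (hA : ∀ i j, A i j ∈ S)
    (hB : ∀ i j, B i j ∈ S) (i j : ι) : (A * B) i j ∈ S := by
  rw [Matrix.mul_apply]
  exact sum_mem fun k _ => mul_mem (hA i k) (hB k j)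

theorem diagonal_entries_mem [DecidableEq ι] (S : Subring R) {d : ι → R} (hd : ∀ i, d i ∈ S) (i j : ι) :
    Matrix.diagonal d i j ∈ S := by
  rw [Matrix.diagonal_apply]
  split_ifs
  · exact hd i
  · exact zero_mem _

theorem blockDiagonal_entries_mem {κ : Type*} [DecidableEq κ] (S : Subring R)
    {A : κ → Matrix ι ι R} (hA : ∀ k i j, A k i j ∈ S) (i j : ι × κ) :
    Matrix.blockDiagonal A i j ∈ S := by
  rw [Matrix.blockDiagonal_apply]
  split_ifs
  · exact hA _ _ _
  · exact zero_mem _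

variable [Fintype ι] [DecidableEq ι]

theorem adjugate_entries_mem (S : Subring R) {A : Matrix ι ι R} (hA : ∀ i j, A i j ∈ S)
    (i j : ι) : A.adjugate i j ∈ S := by
  let A' : Matrix ι ι S := Matrix.of fun i j => ⟨A i j, hA i j⟩
  have h : A = S.subtype.mapMatrix A' := by
    ext i j
    rfl
  rw [h, ← RingHom.map_adjugate]
  exact (A'.adjugate i j).2

/-- Over the fraction field $c^{-1}B$ is a right, hence two-sided, inverse of $A$; the adjugate of
$A$ avoids leaving $R$. -/
theorem mul_eq_smul_one_comm [IsDomain R] {A B : Matrix ι ι R} {c : R} (hc : c ≠ 0)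
    (h : A * B = c • 1) : B * A = c • 1 := by
  have h1 : c • (B * A - c • 1) = 0 := by
    have h2 : (B * A) * (B * A) = c • (B * A) := by
      rw [Matrix.mul_assoc, ← Matrix.mul_assoc A, h, Matrix.smul_mul, Matrix.one_mul,
        Matrix.mul_smul]
    have h3 : A * (B * A - c • 1) = 0 := by
      rw [Matrix.mul_sub, ← Matrix.mul_assoc, h, Matrix.smul_mul, Matrix.one_mul, Matrix.mul_smul,
        Matrix.mul_one, sub_self]
    have hdet : A.det ≠ 0 := by
      intro h0
      have := congrArg Matrix.det h
      rw [Matrix.det_mul, h0, zero_mul, Matrix.det_smul, Matrix.det_one, mul_one] at this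
      exact pow_ne_zero _ hc this.symm
    have h4 : A.adjugate * (A * (B * A - c • 1)) = 0 := by rw [h3, Matrix.mul_zero]
    rw [← Matrix.mul_assoc, Matrix.adjugate_mul, Matrix.smul_mul, Matrix.one_mul] at h4
    rw [(smul_eq_zero.1 h4).resolve_left hdet, smul_zero]
  exact sub_eq_zero.1 ((smul_eq_zero.1 h1).resolve_left hc)

/-- Replacing a column of the identity by `u` gives determinant `u a` by Cramer's rule; then
transpose. -/
theorem exists_GL_row {F : Type*} [Field F] (a : ι) (u : ι → F) (hu : u a = 1) :
    ∃ U : Matrix.GeneralLinearGroup ι F, ∀ j, (U : Matrix ι ι F) a j = u j := by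
  have hdet : (Matrix.updateCol (1 : Matrix ι ι F) a u).transpose.det ≠ 0 := by
    rw [Matrix.det_transpose, ← Matrix.cramer_apply, Matrix.cramer_one]
    simp [hu]
  refine ⟨Matrix.GeneralLinearGroup.mkOfDetNeZero _ hdet, fun j => ?_⟩
  change (Matrix.updateCol (1 : Matrix ι ι F) a u).transpose a j = u j
  rw [Matrix.transpose_apply, Matrix.updateCol_self]

theorem exists_GL_col {F : Type*} [Field F] (b : ι) (v : ι → F) (hv : v b = 1) :
    ∃ V : Matrix.GeneralLinearGroup ι F, ∀ i, (V : Matrix ι ι F) i b = v i := by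
  have hdet : (Matrix.updateCol (1 : Matrix ι ι F) b v).det ≠ 0 := by
    rw [← Matrix.cramer_apply, Matrix.cramer_one]
    simp [hv]
  refine ⟨Matrix.GeneralLinearGroup.mkOfDetNeZero _ hdet, fun i => ?_⟩
  change Matrix.updateCol (1 : Matrix ι ι F) b v i b = v i
  rw [Matrix.updateCol_self]

theorem constMatrix_mul_inv {F : Type*} [Field F] [Algebra F R]
    (U : Matrix.GeneralLinearGroup ι F) : constMatrix R U * constMatrix R U⁻¹ = 1 := by
  rw [constMatrix, constMatrix, ← Matrix.map_mul, ← Units.val_mul, mul_inv_cancel, Units.val_one,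
    Matrix.map_one _ (map_zero _) (map_one _)]

theorem constMatrix_inv_mul {F : Type*} [Field F] [Algebra F R]
    (U : Matrix.GeneralLinearGroup ι F) : constMatrix R U⁻¹ * constMatrix R U = 1 := by
  simpa using constMatrix_mul_inv (R := R) U⁻¹

/-- The unipotent matrix with entries `h k` just below the diagonal. -/
def subdiagonal {r : ℕ} (h : Fin r → R) : Matrix (Fin (r + 1)) (Fin (r + 1)) R :=
  1 + ∑ k : Fin r, Matrix.single k.succ k.castSucc (h k)

theorem subdiagonal_apply_mem {r : ℕ} (S : Subring R) {h : Fin r → R} (hS : ∀ k, h k ∈ S)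
    (i j : Fin (r + 1)) : subdiagonal h i j ∈ S := by
  rw [subdiagonal, Matrix.add_apply, Matrix.sum_apply, Matrix.one_apply]
  refine add_mem ?_ (sum_mem fun k _ => ?_)
  · split_ifs
    · exact one_mem _
    · exact zero_mem _
  · rw [Matrix.single_apply]
    split_ifs
    · exact hS k
    · exact zero_mem _

theorem subdiagonal_mul_zero {r : ℕ} (h : Fin r → R) (M : Matrix (Fin (r + 1)) (Fin (r + 1)) R)
    (b : Fin (r + 1)) : (subdiagonal h * M) 0 b = M 0 b := by
  rw [subdiagonal, Matrix.add_mul, Matrix.one_mul, Matrix.add_apply, Matrix.sum_mul,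
    Matrix.sum_apply, Finset.sum_eq_zero, add_zero]
  intro k _
  rw [Matrix.single_mul_apply_of_ne]
  exact (Fin.succ_ne_zero k).symm

theorem subdiagonal_mul_succ {r : ℕ} (h : Fin r → R) (M : Matrix (Fin (r + 1)) (Fin (r + 1)) R)
    (k : Fin r) (b : Fin (r + 1)) :
    (subdiagonal h * M) k.succ b = M k.succ b + h k * M k.castSucc b := by
  rw [subdiagonal, Matrix.add_mul, Matrix.one_mul, Matrix.add_apply, Matrix.sum_mul,
    Matrix.sum_apply, Finset.sum_eq_single k, Matrix.single_mul_apply_same]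
  · intro j _ hj
    rw [Matrix.single_mul_apply_of_ne]
    exact fun h => hj (Fin.succ_injective _ h).symm
  · simp

theorem subdiagonal_map {r : ℕ} {R' : Type*} [CommRing R'] (f : R →+* R') (h : Fin r → R) :
    (subdiagonal h).map f = subdiagonal fun k => f (h k) := by
  ext i j
  simp only [subdiagonal, Matrix.map_apply, Matrix.add_apply, Matrix.sum_apply, map_add, map_sum,
    Matrix.one_apply, Matrix.single_apply, apply_ite f, map_zero, map_one]

theorem det_subdiagonal {r : ℕ} (h : Fin r → R) : (subdiagonal h).det = 1 := by
  rw [Matrix.det_of_isLowerTriangular]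
  · refine Finset.prod_eq_one fun i _ => ?_
    rw [subdiagonal, Matrix.add_apply, Matrix.one_apply_eq, Matrix.sum_apply, Finset.sum_eq_zero,
      add_zero]
    intro k _
    rw [Matrix.single_apply, if_neg]
    rintro ⟨h1, h2⟩
    exact Fin.castSucc_lt_succ.ne (h2.trans h1.symm)
  · intro i j hij
    have hij : i < j := hij
    rw [subdiagonal, Matrix.add_apply, Matrix.one_apply_ne hij.ne, Matrix.sum_apply,
      Finset.sum_eq_zero, add_zero]
    intro k _
    rw [Matrix.single_apply, if_neg]
    rintro ⟨rfl, rfl⟩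
    exact (Fin.castSucc_lt_succ.trans hij).false

end MatrixLemmas

/-! ### Trivialized motives with complementary matrices. -/

section Uniformization

variable {F : Type*} [Field F] [Fintype F] {ι : Type*}

theorem evalAtT_sum {α : Type*} {f : α → PowerSeries (CInf F)}
    (hf : ∀ i, f i ∈ entire (CInf F)) (s : Finset α) :
    evalAtT F (∑ i ∈ s, f i) = ∑ i ∈ s, evalAtT F (f i) := by
  classical
  induction s using Finset.induction_on with
  | empty =>
    rw [Finset.sum_empty, Finset.sum_empty, evalAtT_eq (zero_mem _)]
    exact map_zero _
  | insert i s hi ih =>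
    rw [Finset.sum_insert hi, Finset.sum_insert hi, evalAtT_add (hf i) (sum_mem fun i _ => hf i),
      ih]

theorem evalAtT_C (c : CInf F) : evalAtT F (PowerSeries.C c) = c := by
  rw [← Polynomial.coe_C, evalAtT_coe, eval_C]

theorem map_evalAtT_mul [Fintype ι] {A B : Matrix ι ι (PowerSeries (CInf F))}
    (hA : ∀ i j, A i j ∈ entire (CInf F)) (hB : ∀ i j, B i j ∈ entire (CInf F)) :
    (A * B).map (evalAtT F) = A.map (evalAtT F) * B.map (evalAtT F) := by
  ext i j
  rw [Matrix.map_apply, Matrix.mul_apply, Matrix.mul_apply,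
    evalAtT_sum fun k => mul_mem (hA i k) (hB k j)]
  exact Finset.sum_congr rfl fun k _ => evalAtT_mul (hA i k) (hB k j)

theorem map_evalAtT_smul_one [DecidableEq ι] (f : PowerSeries (CInf F)) :
    (f • (1 : Matrix ι ι (PowerSeries (CInf F)))).map (evalAtT F) = evalAtT F f • 1 := by
  ext i j
  rw [Matrix.map_apply, Matrix.smul_apply, Matrix.smul_apply, Matrix.one_apply, Matrix.one_apply]
  split_ifs
  · simp
  · rw [smul_zero, smul_zero, ← map_zero PowerSeries.C, evalAtT_C]

theorem Omega_ne_zero : Omega F ≠ 0 := by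
  intro h
  refine evalAtT_Omega_ne_zero F ?_
  rw [h, ← map_zero PowerSeries.C, evalAtT_C]

theorem map_coe_smul_one [DecidableEq ι] (p : (CInf F)[X]) :
    (p • (1 : Matrix ι ι (CInf F)[X])).map (fun p => (p : PowerSeries (CInf F))) =
      (p : PowerSeries (CInf F)) • 1 := by
  ext1 i j
  rw [Matrix.map_apply, Matrix.smul_apply, Matrix.smul_apply, Matrix.one_apply, Matrix.one_apply]
  split_ifs <;> simp

theorem map_coe_mul [Fintype ι] (A B : Matrix ι ι (CInf F)[X]) :
    (A * B).map (fun p => (p : PowerSeries (CInf F))) =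
      A.map (fun p => (p : PowerSeries (CInf F))) *
        B.map (fun p => (p : PowerSeries (CInf F))) :=
  Matrix.map_mul (f := Polynomial.coeToPowerSeries.ringHom (R := CInf F))

theorem map_twist_smul_one [DecidableEq ι] (f : PowerSeries (CInf F)) :
    (f • (1 : Matrix ι ι (PowerSeries (CInf F)))).map (twist F (-1)) = twist F (-1) f • 1 := by
  ext1 i j
  rw [Matrix.map_apply, Matrix.smul_apply, Matrix.smul_apply, smul_eq_mul, smul_eq_mul, map_mul,
    Matrix.one_apply]
  split_ifs <;> simp

variable [Fintype ι] [DecidableEq ι]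

/-- A matrix `Φ` with a trivialization `Ψ`, together with complements `Φ₁` and `Ψ₁`, which are
inverses up to powers of `T - t` and `Ω`. -/
structure Uniformized (N : ℕ) (Φ Φ₁ : Matrix ι ι (CInf F)[X])
    (Ψ Ψ₁ : Matrix ι ι (PowerSeries (CInf F))) : Prop where
  mul_Phi : Φ₁ * Φ = (X - C (tElt F)) ^ N • 1
  mul_Psi : Ψ * Ψ₁ = Omega F ^ N • 1
  eqn : Φ.map (fun p => (p : PowerSeries (CInf F))) * Ψ = Ψ.map (twist F (-1))
  entire_Psi : ∀ i j, Ψ i j ∈ entire (CInf F)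
  entire_Psi' : ∀ i j, Ψ₁ i j ∈ entire (CInf F)

variable {N : ℕ} {Φ Φ₁ : Matrix ι ι (CInf F)[X]} {Ψ Ψ₁ : Matrix ι ι (PowerSeries (CInf F))}

theorem Uniformized.mul_Phi' (h : Uniformized N Φ Φ₁ Ψ Ψ₁) :
    Φ * Φ₁ = (X - C (tElt F)) ^ N • 1 :=
  mul_eq_smul_one_comm (pow_ne_zero _ (X_sub_C_ne_zero _)) h.mul_Phi

theorem Uniformized.mul_Psi' (h : Uniformized N Φ Φ₁ Ψ Ψ₁) : Ψ₁ * Ψ = Omega F ^ N • 1 :=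
  mul_eq_smul_one_comm (pow_ne_zero _ Omega_ne_zero) h.mul_Psi

/-- The dual, twisted by the `N`-th tensor power of the Carlitz motive. -/
theorem Uniformized.dual (h : Uniformized N Φ Φ₁ Ψ Ψ₁) :
    Uniformized N Φ₁.transpose Φ.transpose Ψ₁.transpose Ψ.transpose where
  mul_Phi := by rw [← Matrix.transpose_mul, h.mul_Phi, Matrix.transpose_smul, Matrix.transpose_one]
  mul_Psi := by rw [← Matrix.transpose_mul, h.mul_Psi, Matrix.transpose_smul, Matrix.transpose_one]
  entire_Psi i j := h.entire_Psi' j i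
  entire_Psi' i j := h.entire_Psi j i
  eqn := by
    set c : (CInf F)[X] → PowerSeries (CInf F) := fun p => (p : PowerSeries (CInf F)) with hc
    set Ω' := twist F (-1) (Omega F) ^ N with hΩ'
    have h1 : Ψ₁.map (twist F (-1)) * Ψ.map (twist F (-1)) = Ω' • 1 := by
      rw [← Matrix.map_mul, h.mul_Psi', map_twist_smul_one, map_pow]
    have h2 : Ψ.map (twist F (-1)) * Ψ₁.map (twist F (-1)) = Ω' • 1 := by
      rw [← Matrix.map_mul, h.mul_Psi, map_twist_smul_one, map_pow]
    -- By $\Psi^{(-1)}=\Phi\Psi$ this is $\Phi(\Psi\Psi_1)\Phi_1$, and both inner products are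
    -- scalar. Thus $\Psi_1\Phi_1$ and $\Psi_1^{(-1)}$ are both $(\Omega^{(-1)})^N$ times the
    -- inverse of $\Psi^{(-1)}$ and agree; transposing gives the dual equation.
    have h3 : Ψ.map (twist F (-1)) * (Ψ₁ * Φ₁.map c) = Ω' • 1 := by
      rw [← h.eqn, Matrix.mul_assoc, ← Matrix.mul_assoc Ψ, h.mul_Psi, Matrix.smul_mul,
        Matrix.one_mul, Matrix.mul_smul, ← map_coe_mul, h.mul_Phi', map_coe_smul_one, smul_smul,
        Polynomial.coe_pow, ← mul_pow, mul_comm, hΩ', twist_Omega]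
    have h4 : Ω' • (Ψ₁.map (twist F (-1))) = Ω' • (Ψ₁ * Φ₁.map c) := by
      have := congrArg (fun M => Ψ₁.map (twist F (-1)) * M) (h2.trans h3.symm)
      simp only [← Matrix.mul_assoc, h1] at this
      simpa only [Matrix.mul_assoc, Matrix.smul_mul, Matrix.one_mul] using this
    have hne : Ω' ≠ 0 := by
      refine pow_ne_zero _ ?_
      rw [twist_Omega]
      refine mul_ne_zero ?_ Omega_ne_zero
      rw [Ne, Polynomial.coe_eq_zero_iff]
      exact X_sub_C_ne_zero _
    have h5 := smul_right_injective _ hne h4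
    rw [Matrix.transpose_map, ← Matrix.transpose_mul, Matrix.transpose_map, h5]

theorem Uniformized.isDualTMotive (h : Uniformized N Φ Φ₁ Ψ Ψ₁) :
    IsDualTMotive F (sigma F Φ) where
  free := inferInstance
  finite := inferInstance
  exists_pow_smul := by
    -- The preimage of $(T-t)^Nm$ is the twist by $1$ of $m\Phi_1$, since $\sigma$ undoes the twist
    -- and multiplies by $\Phi$.
    refine ⟨N, fun m => ⟨fun i => twistPoly F 1 (Matrix.vecMul m Φ₁ i), ?_⟩⟩
    change Matrix.vecMul (fun i => twistPoly F (-1) (twistPoly F 1 (Matrix.vecMul m Φ₁ i))) Φ = _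
    simp only [← twistPoly_add, neg_add_cancel, twistPoly_zero]
    rw [Matrix.vecMul_vecMul, h.mul_Phi, Matrix.vecMul_smul, Matrix.vecMul_one]

theorem Uniformized.eval_mul (h : Uniformized N Φ Φ₁ Ψ Ψ₁) :
    Ψ.map (evalAtT F) * Ψ₁.map (evalAtT F) = evalAtT F (Omega F) ^ N • 1 := by
  rw [← map_evalAtT_mul h.entire_Psi h.entire_Psi', h.mul_Psi, map_evalAtT_smul_one,
    evalAtT_pow (Omega_mem_entire F)]

theorem Uniformized.det_ne_zero (h : Uniformized N Φ Φ₁ Ψ Ψ₁) :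
    (Ψ.map (evalAtT F)).det ≠ 0 := by
  intro h0
  have h1 := congrArg Matrix.det h.eval_mul
  rw [Matrix.det_mul, h0, zero_mul, Matrix.det_smul, Matrix.det_one, mul_one] at h1
  exact pow_ne_zero _ (pow_ne_zero _ (evalAtT_Omega_ne_zero F)) h1.symm

theorem Uniformized.isTrivialization (h : Uniformized N Φ Φ₁ Ψ Ψ₁) : IsTrivialization F Φ Ψ where
  entire i j := isEntire_of_mem F (h.entire_Psi i j)
  invertible := by
    obtain ⟨f, hf, hf'⟩ := exists_inv_Omega F
    -- The inverse over the Tate algebra is $\Omega^{-N}\Psi_1$.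
    refine ⟨f ^ N • Ψ₁, fun i j => ?_, ?_⟩
    · refine isTate_of_mem F (one_lt_pow₀ (one_lt_norm_tElt F) (Fintype.card_ne_zero (α := F))) ?_
      rw [Matrix.smul_apply, smul_eq_mul]
      exact mul_mem (pow_mem hf _) (entire_le_boundedOn _ (h.entire_Psi' i j))
    · rw [Matrix.mul_smul, h.mul_Psi, smul_smul, ← mul_pow, mul_comm, hf', one_pow, one_smul]
  det_ne_zero := h.det_ne_zero
  eqn := h.eqn

theorem Uniformized.periodMatrix_inv (h : Uniformized N Φ Φ₁ Ψ Ψ₁) :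
    (periodMatrix F Ψ)⁻¹ = Ψ.map (evalAtT F) :=
  Matrix.nonsing_inv_nonsing_inv _ h.det_ne_zero.isUnit

/-- At $T=t$ the inverse of $\Psi_1$ is $\Omega(t)^{-N}\Psi$. So entries of the inverse of the
original period matrix become periods, and the factor $\tilde\pi^N$ removes the denominator. -/
theorem Uniformized.periodMatrix_dual (h : Uniformized N Φ Φ₁ Ψ Ψ₁) :
    periodMatrix F Ψ₁.transpose = piTilde F ^ N • (Ψ.map (evalAtT F)).transpose := by
  refine Matrix.inv_eq_right_inv ?_
  rw [Matrix.transpose_map, Matrix.mul_smul, ← Matrix.transpose_mul, h.eval_mul,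
    Matrix.transpose_smul, Matrix.transpose_one, smul_smul, ← mul_pow, piTilde_eq,
    inv_mul_cancel₀ (evalAtT_Omega_ne_zero F), one_pow, one_smul]

theorem Uniformized.blockDiagonal {κ : Type*} [Fintype κ] [DecidableEq κ]
    {Φ Φ₁ : κ → Matrix ι ι (CInf F)[X]} {Ψ Ψ₁ : κ → Matrix ι ι (PowerSeries (CInf F))}
    (h : ∀ k, Uniformized N (Φ k) (Φ₁ k) (Ψ k) (Ψ₁ k)) :
    Uniformized N (Matrix.blockDiagonal Φ) (Matrix.blockDiagonal Φ₁) (Matrix.blockDiagonal Ψ)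
      (Matrix.blockDiagonal Ψ₁) where
  mul_Phi := by
    rw [← Matrix.blockDiagonal_mul]
    simp only [(h _).mul_Phi]
    rw [← Matrix.blockDiagonal_one, ← Matrix.blockDiagonal_smul]
    rfl
  mul_Psi := by
    rw [← Matrix.blockDiagonal_mul]
    simp only [(h _).mul_Psi]
    rw [← Matrix.blockDiagonal_one, ← Matrix.blockDiagonal_smul]
    rfl
  eqn := by
    rw [Matrix.blockDiagonal_map _ _ Polynomial.coe_zero, Matrix.blockDiagonal_map _ _ (map_zero _),
      ← Matrix.blockDiagonal_mul]
    simp only [(h _).eqn]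
  entire_Psi := blockDiagonal_entries_mem _ fun k => (h k).entire_Psi
  entire_Psi' := blockDiagonal_entries_mem _ fun k => (h k).entire_Psi'

theorem algebraMap_powerSeries (c : F) : algebraMap F (PowerSeries (CInf F)) c =
    PowerSeries.C (algebraMap F (CInf F) c) := PowerSeries.algebraMap_apply

theorem constMatrix_mem_entire (U : Matrix.GeneralLinearGroup ι F) (i j : ι) :
    constMatrix (PowerSeries (CInf F)) U i j ∈ entire (CInf F) := by
  rw [constMatrix, Matrix.map_apply, algebraMap_powerSeries]
  exact C_mem_entire _

theorem map_evalAtT_constMatrix (U : Matrix.GeneralLinearGroup ι F) :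
    (constMatrix (PowerSeries (CInf F)) U).map (evalAtT F) = constMatrix (CInf F) U := by
  ext i j
  simp only [constMatrix, Matrix.map_apply, algebraMap_powerSeries, evalAtT_C]

theorem map_twist_constMatrix (U : Matrix.GeneralLinearGroup ι F) :
    (constMatrix (PowerSeries (CInf F)) U).map (twist F (-1)) =
      constMatrix (PowerSeries (CInf F)) U := by
  ext1 i j
  simp only [constMatrix, Matrix.map_apply, algebraMap_powerSeries, twist, PowerSeries.map_C]
  exact congrArg _ (frobPow_algebraMap F _ _)

theorem map_coe_constMatrix (U : Matrix.GeneralLinearGroup ι F) :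
    (constMatrix (CInf F)[X] U).map (fun p => (p : PowerSeries (CInf F))) =
      constMatrix (PowerSeries (CInf F)) U := by
  ext1 i j
  simp only [constMatrix, Matrix.map_apply, algebraMap_powerSeries, Polynomial.algebraMap_apply,
    Polynomial.coe_C]

theorem constMatrix_mem_definedOver (w : ℕ) (U : Matrix.GeneralLinearGroup ι F) (i j : ι) :
    constMatrix (CInf F)[X] U i j ∈ definedOver F w := by
  rw [constMatrix, Matrix.map_apply, Polynomial.algebraMap_apply]
  exact C_mem_definedOver F (Subalgebra.algebraMap_mem _ _)

/-- Matrices over $\mathbb F_q$ are fixed by twisting, so $\Psi$ may also be changed on the right,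
by a `V` independent of the change of basis `U`. -/
theorem Uniformized.baseChange (h : Uniformized N Φ Φ₁ Ψ Ψ₁) (U V : Matrix.GeneralLinearGroup ι F) :
    Uniformized N (constMatrix (CInf F)[X] U * Φ * constMatrix (CInf F)[X] U⁻¹)
      (constMatrix (CInf F)[X] U * Φ₁ * constMatrix (CInf F)[X] U⁻¹)
      (constMatrix (PowerSeries (CInf F)) U * Ψ * constMatrix (PowerSeries (CInf F)) V)
      (constMatrix (PowerSeries (CInf F)) V⁻¹ * Ψ₁ * constMatrix (PowerSeries (CInf F)) U⁻¹) where
  mul_Phi := by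
    calc _ = constMatrix (CInf F)[X] U * (Φ₁ * (constMatrix (CInf F)[X] U⁻¹ *
          constMatrix (CInf F)[X] U) * Φ) * constMatrix (CInf F)[X] U⁻¹ := by
          simp only [Matrix.mul_assoc]
      _ = _ := by
          rw [constMatrix_inv_mul, Matrix.mul_one, h.mul_Phi, Matrix.mul_smul, Matrix.mul_one,
            Matrix.smul_mul, constMatrix_mul_inv]
  mul_Psi := by
    calc _ = constMatrix (PowerSeries (CInf F)) U * (Ψ * (constMatrix (PowerSeries (CInf F)) V *
          constMatrix (PowerSeries (CInf F)) V⁻¹) * Ψ₁) *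
            constMatrix (PowerSeries (CInf F)) U⁻¹ := by
          simp only [Matrix.mul_assoc]
      _ = _ := by
          rw [constMatrix_mul_inv, Matrix.mul_one, h.mul_Psi, Matrix.mul_smul, Matrix.mul_one,
            Matrix.smul_mul, constMatrix_mul_inv]
  eqn := by
    rw [Matrix.map_mul, Matrix.map_mul, map_twist_constMatrix, map_twist_constMatrix, ← h.eqn,
      map_coe_mul, map_coe_mul, map_coe_constMatrix, map_coe_constMatrix]
    calc _ = constMatrix (PowerSeries (CInf F)) U * Φ.map (fun p => (p : PowerSeries (CInf F))) *
          (constMatrix (PowerSeries (CInf F)) U⁻¹ * constMatrix (PowerSeries (CInf F)) U) *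
          Ψ * constMatrix (PowerSeries (CInf F)) V := by simp only [Matrix.mul_assoc]
      _ = _ := by
          rw [constMatrix_inv_mul, Matrix.mul_one]
          simp only [Matrix.mul_assoc]
  entire_Psi := mul_entries_mem _ (mul_entries_mem _ (constMatrix_mem_entire U) h.entire_Psi)
    (constMatrix_mem_entire V)
  entire_Psi' := mul_entries_mem _ (mul_entries_mem _ (constMatrix_mem_entire V⁻¹) h.entire_Psi')
    (constMatrix_mem_entire U⁻¹)

end Uniformization

/-! ### The motives $\Phi_I$ and their trivializations. -/

section DelayedMotive

variable {F : Type*} [Field F] [Fintype F] {r : ℕ} {s : Fin r → ℕ} (I : Finset (Fin r))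

theorem QMatrix_map (F : Type*) [Field F] [Fintype F] (s : Fin r → ℕ) (I : Finset (Fin r)) :
    (QMatrix F s I).map (twistPoly F (-1)) =
      subdiagonal fun k => twistPoly F (-1) (delayedH F (s k) (delay I k)) :=
  subdiagonal_map (twistPoly F (-1)) fun k => delayedH F (s k) (delay I k)

/-- The matrix `(T - t)^{s_1 + ⋯ + s_r} Φ⁻¹`. -/
def PhiComplement (F : Type*) [Field F] [Fintype F] (s : Fin r → ℕ) (I : Finset (Fin r)) :
    Matrix (Fin (r + 1)) (Fin (r + 1)) (CInf F)[X] :=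
  (Matrix.diagonal fun a => (X - C (tElt F)) ^ (∑ k, s k - tailSum s a)) *
    ((QMatrix F s I).map (twistPoly F (-1))).adjugate

/-- The matrix `Ω^{s_1 + ⋯ + s_r} Ψ⁻¹`. -/
def PsiComplement (F : Type*) [Field F] [Fintype F] (s : Fin r → ℕ) (I : Finset (Fin r)) :
    Matrix (Fin (r + 1)) (Fin (r + 1)) (PowerSeries (CInf F)) :=
  (LMatrix F s I).adjugate * Matrix.diagonal fun a => Omega F ^ (∑ k, s k - tailSum s a)

theorem diagonal_pow_mul {R : Type*} [CommRing R] (x : R) (s : Fin r → ℕ) :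
    (Matrix.diagonal fun a => x ^ (∑ k, s k - tailSum s a)) *
      (Matrix.diagonal fun a => x ^ tailSum s a) = x ^ (∑ k, s k) • 1 := by
  rw [Matrix.diagonal_mul_diagonal, Matrix.smul_one_eq_diagonal]
  congr 1
  funext a
  rw [← pow_add, Nat.sub_add_cancel (tailSum_le s a)]

theorem det_LMatrix : (LMatrix F s I).det = 1 := by
  rw [Matrix.det_of_isLowerTriangular]
  · exact Finset.prod_eq_one fun a _ => LMatrix_self I a
  · intro i j hij
    have hij : i < j := hij
    exact LMatrix_of_not_le I hij.not_ge

/-- Multiplying by $[[T-t]]$ replaces the powers of $\Omega$ by powers of $\Omega^{(-1)}$. Then the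
subdiagonal entry of $Q^{(-1)}$, with the extra $s_a$ powers of $\Omega^{(-1)}$ from row $a$, is the
coefficient in `twist_LMatrix_succ`. -/
theorem PhiMatrix_mul_PsiMatrix (hs : ∀ k, 0 < s k) :
    (PhiMatrix F s I).map (fun p => (p : PowerSeries (CInf F))) * PsiMatrix F s I =
      (PsiMatrix F s I).map (twist F (-1)) := by
  have hD : (DMatrix F s).map (fun p => (p : PowerSeries (CInf F))) * PsiMatrix F s I =
      Matrix.of fun a b => twist F (-1) (Omega F) ^ tailSum s a * LMatrix F s I a b := by
    ext1 a b
    rw [DMatrix, Matrix.diagonal_map Polynomial.coe_zero, Matrix.diagonal_mul, PsiMatrix_apply,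
      Matrix.of_apply, twist_Omega, Polynomial.coe_pow, mul_pow]
    ring
  have hQ : ((QMatrix F s I).map (twistPoly F (-1))).map
      (fun p => (p : PowerSeries (CInf F))) = subdiagonal fun k =>
        (twistPoly F (-1) (delayedH F (s k) (delay I k)) : PowerSeries (CInf F)) := by
    rw [QMatrix_map]
    exact subdiagonal_map (Polynomial.coeToPowerSeries.ringHom (R := CInf F)) _
  rw [PhiMatrix, map_coe_mul, Matrix.mul_assoc, hD, hQ]
  ext1 a b
  rw [Matrix.map_apply, PsiMatrix_apply, map_mul, map_pow]
  rcases Fin.eq_zero_or_eq_succ a with rfl | ⟨a, rfl⟩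
  · rw [subdiagonal_mul_zero, twist_LMatrix_zero, Matrix.of_apply]
  · rw [subdiagonal_mul_succ, twist_LMatrix_succ I hs, Matrix.of_apply, Matrix.of_apply,
      tailSum_castSucc, delayedOmegaH, ← Omega_pow_mul_delayedH, map_mul, map_pow, twist_coe]
    ring

/-- $Q$ and $L$ are unipotent, so their adjugates are their inverses; they stay polynomial,
respectively entire, and only the diagonal parts call for powers of $T-t$ and $\Omega$. -/
theorem uniformized_PhiMatrix (hs : ∀ k, 0 < s k) :
    Uniformized (∑ k, s k) (PhiMatrix F s I) (PhiComplement F s I) (PsiMatrix F s I)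
      (PsiComplement F s I) where
  mul_Phi := by
    rw [PhiMatrix, PhiComplement, Matrix.mul_assoc, ← Matrix.mul_assoc (Matrix.adjugate _),
      Matrix.adjugate_mul, QMatrix_map, det_subdiagonal, one_smul, Matrix.one_mul, DMatrix,
      diagonal_pow_mul]
  mul_Psi := by
    refine mul_eq_smul_one_comm (pow_ne_zero _ Omega_ne_zero) ?_
    have h : (Matrix.diagonal fun a => Omega F ^ (∑ k, s k - tailSum s a)) *
        PsiMatrix F s I = Omega F ^ (∑ k, s k) • LMatrix F s I := by
      rw [PsiMatrix, ← Matrix.mul_assoc, diagonal_pow_mul, Matrix.smul_mul, Matrix.one_mul]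
    rw [PsiComplement, Matrix.mul_assoc, h, Matrix.mul_smul, Matrix.adjugate_mul, det_LMatrix,
      one_smul]
  eqn := PhiMatrix_mul_PsiMatrix I hs
  entire_Psi := PsiMatrix_mem_entire I hs
  entire_Psi' := mul_entries_mem _ (adjugate_entries_mem _ (LMatrix_mem_entire I hs))
    (diagonal_entries_mem _ fun _ => pow_mem (Omega_mem_entire F) _)

theorem X_sub_C_tElt_mem (w : ℕ) : X - C (tElt F) ∈ definedOver F w := by
  simpa [twistPoly_zero] using twistPoly_X_sub_C_mem F (Nat.zero_le w)

theorem twistPoly_QMatrix_mem {w : ℕ} (hw : ∀ k, delay I k ≤ w) (i j : Fin (r + 1)) :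
    (QMatrix F s I).map (twistPoly F (-1)) i j ∈ definedOver F w := by
  rw [QMatrix_map]
  exact subdiagonal_apply_mem _ (fun k => twistPoly_delayedH_mem F (hw k) _) i j

theorem PhiMatrix_mem {w : ℕ} (hw : ∀ k, delay I k ≤ w) (i j : Fin (r + 1)) :
    PhiMatrix F s I i j ∈ definedOver F w :=
  mul_entries_mem _ (twistPoly_QMatrix_mem I hw)
    (diagonal_entries_mem _ fun _ => pow_mem (X_sub_C_tElt_mem w) _) i j

theorem PhiComplement_mem {w : ℕ} (hw : ∀ k, delay I k ≤ w) (i j : Fin (r + 1)) :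
    PhiComplement F s I i j ∈ definedOver F w :=
  mul_entries_mem _ (diagonal_entries_mem _ fun _ => pow_mem (X_sub_C_tElt_mem w) _)
    (adjugate_entries_mem _ (twistPoly_QMatrix_mem I hw)) i j

end DelayedMotive

/-! ### Degenerate multizeta values by inclusion-exclusion. -/

section InclusionExclusion

variable {r : ℕ}

/-- The surviving $J$ form the interval from $I$ to $A$, that is, the subsets of $A\setminus I$,
whose alternating sum vanishes unless that set is empty. -/
theorem sum_Icc_neg_one_pow {α R : Type*} [DecidableEq α] [CommRing R] {I P A : Finset α}
    (hA : A ⊆ P) : (∑ J ∈ Finset.Icc I P, if J ⊆ A then (-1 : R) ^ (J \ I).card else 0) =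
      if I = A then 1 else 0 := by
  rw [← Finset.sum_filter]
  by_cases hIA : I ⊆ A
  · have h1 : (Finset.Icc I P).filter (fun J => J ⊆ A) = Finset.Icc I A := by
      ext J
      simp only [Finset.mem_filter, Finset.mem_Icc]
      exact ⟨fun h => ⟨h.1.1, h.2⟩, fun h => ⟨⟨h.1, h.2.trans hA⟩, h.2⟩⟩
    have hdisj : ∀ u ∈ (A \ I).powerset, (I ∪ u) \ I = u := fun u hu => by
      rw [Finset.union_sdiff_left, Finset.sdiff_eq_self_iff_disjoint]
      exact Finset.disjoint_of_subset_left (Finset.mem_powerset.1 hu) Finset.sdiff_disjoint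
    rw [h1, Finset.Icc_eq_image_powerset hIA, Finset.sum_image]
    · rw [Finset.sum_congr rfl fun u hu => by rw [hdisj u hu]]
      have h2 := congrArg (Int.cast : ℤ → R)
        (Finset.sum_powerset_neg_one_pow_card (x := A \ I))
      push_cast at h2
      rw [h2]
      congr 1
      rw [Finset.sdiff_eq_empty_iff_subset, eq_iff_iff]
      exact ⟨fun h => hIA.antisymm h, fun h => h.ge⟩
    · intro u hu v hv huv
      rw [← hdisj u hu, ← hdisj v hv]
      exact congrArg (· \ I) huv
  · rw [if_neg (fun h => hIA h.le), Finset.sum_eq_zero]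
    intro J hJ
    rw [Finset.mem_filter, Finset.mem_Icc] at hJ
    exact absurd (hJ.1.1.trans hJ.2) hIA

theorem exists_covBy_of_mem_positions {i : Fin r} (hi : i ∈ positions r) : ∃ j, i ⋖ j := by
  have hi : i.1 + 1 < r := (Finset.mem_filter.1 hi).2
  refine ⟨⟨i.1 + 1, hi⟩, Fin.lt_def.2 (Nat.lt_succ_self _), fun k h1 h2 => ?_⟩
  rw [Fin.lt_def] at h1 h2
  simp only at h2
  omega

theorem mem_positions_of_lt {i j : Fin r} (h : i < j) : i ∈ positions r := by
  rw [positions, Finset.mem_filter]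
  have := Fin.lt_def.1 h
  exact ⟨Finset.mem_univ _, by omega⟩

-- For decreasing $d$ with jump set $A$, the weak condition for $J$ is $J\subseteq A$ and the exact
-- condition is $I=A$; for other $d$ all conditions fail.
open scoped Classical in
theorem sum_hasJumpsAtLeast {R : Type*} [CommRing R] {I : Finset (Fin r)} (hI : I ⊆ positions r)
    (d : Fin r → ℕ) : (∑ J ∈ Finset.Icc I (positions r),
      if HasJumpsAtLeast (J : Set (Fin r)) d then (-1 : R) ^ (J \ I).card else 0) =
      if HasJumps (I : Set (Fin r)) d then 1 else 0 := by
  by_cases hd : ∀ i j, i ⋖ j → d j ≤ d i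
  · set A := (positions r).filter fun i => ∃ j, i ⋖ j ∧ d j < d i with hA
    have hA' : ∀ i j, i ⋖ j → (i ∈ A ↔ d j < d i) := by
      intro i j hij
      rw [hA, Finset.mem_filter]
      constructor
      · rintro ⟨-, j', hij', h⟩
        rwa [hij.unique_right hij']
      · exact fun h => ⟨mem_positions_of_lt hij.1, j, hij, h⟩
    have h1 : ∀ J ∈ Finset.Icc I (positions r),
        (HasJumpsAtLeast (J : Set (Fin r)) d ↔ J ⊆ A) := by
      intro J hJ
      have hJP : J ⊆ positions r := (Finset.mem_Icc.1 hJ).2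
      constructor
      · intro h i hi
        obtain ⟨j, hij⟩ := exists_covBy_of_mem_positions (hJP hi)
        exact (hA' i j hij).2 ((h i j hij).2 hi)
      · exact fun h i j hij => ⟨hd i j hij, fun hi => (hA' i j hij).1 (h hi)⟩
    have h2 : HasJumps (I : Set (Fin r)) d ↔ I = A := by
      constructor
      · intro h
        ext i
        constructor
        · intro hi
          obtain ⟨j, hij⟩ := exists_covBy_of_mem_positions (hI hi)
          exact (hA' i j hij).2 ((h i j hij).2.2 hi)
        · intro hi
          obtain ⟨j, hij⟩ := exists_covBy_of_mem_positions (Finset.mem_filter.1 hi).1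
          exact (h i j hij).2.1 ((hA' i j hij).1 hi)
      · rintro h i j hij
        refine ⟨hd i j hij, ?_⟩
        rw [← hA' i j hij, h, Finset.mem_coe]
    rw [if_congr h2 rfl rfl, ← sum_Icc_neg_one_pow (Finset.filter_subset _ _ : A ⊆ positions r)]
    exact Finset.sum_congr rfl fun J hJ => if_congr (h1 J hJ) rfl rfl
  · rw [if_neg fun h => hd fun i j hij => (h i j hij).1]
    exact Finset.sum_eq_zero fun J _ => if_neg fun h => hd fun i j hij => (h i j hij).1

variable {F : Type*} [Field F] [Fintype F]

/-- From $|S_d(s)|\le|t|^{-sd}$ the terms tend to zero along the cofinite filter, which suffices in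
an ultrametric field. -/
theorem summable_prod_powerSum {ι : Type*} [Fintype ι] {s : ι → ℕ} (hs : ∀ k, 0 < s k) :
    Summable fun d : ι → ℕ => ∏ k, powerSum F (d k) (s k) := by
  have h1 := one_lt_norm_tElt F
  rcases isEmpty_or_nonempty ι with h | h
  · exact (hasSum_fintype _).summable
  · refine summable_of_norm_le (fun d => ?_) (tendsto_prod_cofinite
      (a := fun k n => (‖tElt F‖⁻¹ ^ s k) ^ n) fun k => ?_)
    · rw [norm_prod]
      exact Finset.prod_le_prod (fun _ _ => norm_nonneg _) fun k _ => norm_powerSum_le F _ _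
    · rw [Nat.cofinite_eq_atTop]
      exact tendsto_pow_atTop_nhds_zero_of_lt_one (by positivity)
        (pow_lt_one₀ (by positivity) (inv_lt_one_of_one_lt₀ h1) (hs k).ne')

open scoped Classical in
theorem tsum_subtype_eq_tsum_ite {α : Type*} (p : α → Prop) (f : α → CInf F) :
    ∑' d : {d // p d}, f d.1 = ∑' d, if p d then f d else 0 := by
  have := tsum_subtype {d | p d} f
  refine this.trans (tsum_congr fun d => ?_)
  rw [Set.indicator_apply]
  rfl

theorem summable_ite {α : Type*} (p : α → Prop) [DecidablePred p] {f : α → CInf F}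
    (hf : Summable f) : Summable fun d => if p d then f d else 0 := by
  have := hf.indicator {d | p d}
  refine this.congr fun d => ?_
  rw [Set.indicator_apply]
  rfl

/-- Degenerate multizeta values by inclusion-exclusion. -/
theorem sum_weakMultizeta {s : Fin r → ℕ} (hs : ∀ k, 0 < s k) {I : Finset (Fin r)}
    (hI : I ⊆ positions r) : ∑ J ∈ Finset.Icc I (positions r),
      (-1) ^ (J \ I).card * weakMultizeta F s (J : Set (Fin r)) =
        multizeta F s (I : Set (Fin r)) := by
  classical
  have hf := summable_prod_powerSum (F := F) hs
  have h1 : ∀ J : Finset (Fin r), (-1) ^ (J \ I).card * weakMultizeta F s (J : Set (Fin r)) =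
      ∑' d : Fin r → ℕ, (-1) ^ (J \ I).card * (if HasJumpsAtLeast (J : Set (Fin r)) d then
        ∏ k, powerSum F (d k) (s k) else 0) := fun J => by
    rw [weakMultizeta, tsum_mul_left, tsum_subtype_eq_tsum_ite (HasJumpsAtLeast (J : Set (Fin r)))
      fun d => ∏ k, powerSum F (d k) (s k)]
  simp only [h1]
  rw [← Summable.tsum_finsetSum fun J _ => (summable_ite _ hf).mul_left _, multizeta,
    tsum_subtype_eq_tsum_ite (HasJumps (I : Set (Fin r))) fun d => ∏ k, powerSum F (d k) (s k)]
  refine tsum_congr fun d => ?_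
  have h2 := congrArg (· * ∏ k, powerSum F (d k) (s k)) (sum_hasJumpsAtLeast (R := CInf F) hI d)
  simp only [Finset.sum_mul, ite_mul, one_mul, zero_mul] at h2
  rw [← h2]
  exact Finset.sum_congr rfl fun J _ => by rw [mul_ite, mul_zero]

theorem weakMultizeta_congr {ι κ : Type*} [LinearOrder ι] [Fintype ι] [LinearOrder κ] [Fintype κ]
    (φ : κ ≃o ι) (s : ι → ℕ) (I : Set ι) :
    weakMultizeta F (fun k => s (φ k)) (φ ⁻¹' I) = weakMultizeta F s I := by
  have h : ∀ d : ι → ℕ, HasJumpsAtLeast I d ↔ HasJumpsAtLeast (φ ⁻¹' I) (d ∘ φ) := by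
    intro d
    constructor
    · exact fun h i j hij => h _ _ ((apply_covBy_apply_iff φ).2 hij)
    · intro h i j hij
      have := h (φ.symm i) (φ.symm j) ((apply_covBy_apply_iff φ.symm).2 hij)
      simpa using this
  let e : {d : ι → ℕ // HasJumpsAtLeast I d} ≃
      {d : κ → ℕ // HasJumpsAtLeast (φ ⁻¹' I) d} :=
    (φ.symm.toEquiv.arrowCongr (Equiv.refl ℕ)).subtypeEquiv h
  rw [weakMultizeta, weakMultizeta, ← e.tsum_eq]
  refine tsum_congr fun d => ?_
  exact φ.toEquiv.prod_comp fun i => powerSum F (d.1 i) (s i)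

/-- All indices lie between the first and the last one. -/
def betweenZeroLast (r : ℕ) : Between (0 : Fin (r + 1)) (Fin.last r) ≃o Fin r where
  toFun k := k.1
  invFun k := ⟨k, Fin.zero_le _, Fin.castSucc_lt_last k⟩
  left_inv _ := rfl
  right_inv _ := rfl
  map_rel_iff' := Iff.rfl

theorem evalAtT_PsiMatrix_last_zero {s : Fin r → ℕ} (hs : ∀ k, 0 < s k) (I : Finset (Fin r)) :
    evalAtT F (PsiMatrix F s I (Fin.last r) 0) =
      (∏ k, gammaC F (s k)) * weakMultizeta F s (I : Set (Fin r)) / piTilde F ^ (∑ k, s k) := by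
  rw [evalAtT_PsiMatrix I hs (Fin.zero_le _), tailSum_zero,
    ← weakMultizeta_congr (betweenZeroLast r) s, ← (betweenZeroLast r).toEquiv.prod_comp]
  rfl

end InclusionExclusion

/-! ### The direct sum over $J\supseteq I$ and the entry $\zeta_I$. -/

section DirectSum

variable {F : Type*} [Field F] [Fintype F] {r : ℕ} {s : Fin r → ℕ} {I : Finset (Fin r)}

theorem delay_le_of_subset {J : Finset (Fin r)} (h : I ⊆ J) (k : Fin r) :
    delay J k ≤ (positions r \ I).card :=
  (delay_le J k).trans (Finset.card_le_card (Finset.sdiff_subset_sdiff (Finset.Subset.refl _) h))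

theorem uniformized_sumPhi (hs : ∀ k, 0 < s k) :
    Uniformized (∑ k, s k) (sumPhi F s I)
      (Matrix.blockDiagonal fun J : ↥(Finset.Icc I (positions r)) => PhiComplement F s J.1)
      (sumPsi F s I)
      (Matrix.blockDiagonal fun J : ↥(Finset.Icc I (positions r)) => PsiComplement F s J.1) :=
  Uniformized.blockDiagonal fun J => uniformized_PhiMatrix J.1 hs

theorem exists_constMatrix_evalAtT (hs : ∀ k, 0 < s k) (hI : I ⊆ positions r) :
    ∃ U V : Matrix.GeneralLinearGroup (Fin (r + 1) × ↥(Finset.Icc I (positions r))) F, ∃ a b,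
      (constMatrix (PowerSeries (CInf F)) U * sumPsi F s I *
        constMatrix (PowerSeries (CInf F)) V).map (evalAtT F) a b =
        (∏ k, gammaC F (s k)) * multizeta F s (I : Set (Fin r)) / piTilde F ^ (∑ k, s k) := by
  have hII : I ∈ Finset.Icc I (positions r) := Finset.mem_Icc.2 ⟨le_rfl, hI⟩
  -- A row of `U` combines the last rows of all blocks with the inclusion-exclusion signs; its entry
  -- in block `I` is $1$, so it extends to an invertible matrix.
  obtain ⟨U, hU⟩ := exists_GL_row (F := F) (ι := Fin (r + 1) × ↥(Finset.Icc I (positions r)))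
    (Fin.last r, ⟨I, hII⟩)
    (fun x => if x.1 = Fin.last r then (-1) ^ (x.2.1 \ I).card else 0) (by simp)
  -- A column of `V` adds up the first columns of all blocks. Off-diagonal blocks vanish, so only
  -- the bottom left corner of each block contributes.
  obtain ⟨V, hV⟩ := exists_GL_col (F := F) (ι := Fin (r + 1) × ↥(Finset.Icc I (positions r)))
    (0, ⟨I, hII⟩) (fun x => if x.1 = 0 then 1 else 0) (by simp)
  refine ⟨U, V, (Fin.last r, ⟨I, hII⟩), (0, ⟨I, hII⟩), ?_⟩
  have hent := (uniformized_sumPhi (F := F) (I := I) hs).entire_Psi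
  rw [map_evalAtT_mul (mul_entries_mem _ (constMatrix_mem_entire U) hent)
    (constMatrix_mem_entire V), map_evalAtT_mul (constMatrix_mem_entire U) hent,
    map_evalAtT_constMatrix, map_evalAtT_constMatrix, ← sum_weakMultizeta hs hI, Finset.mul_sum,
    Finset.sum_div, ← Finset.sum_coe_sort, Matrix.mul_apply, Fintype.sum_prod_type,
    Finset.sum_eq_single 0]
  · refine Finset.sum_congr rfl fun J _ => ?_
    rw [Matrix.mul_apply, Fintype.sum_prod_type, Finset.sum_eq_single (Fin.last r),
      Finset.sum_eq_single J]
    · simp only [constMatrix, Matrix.map_apply, hU, hV, if_true, map_one, mul_one, map_pow,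
        map_neg, sumPsi, Matrix.blockDiagonal_apply_eq, evalAtT_PsiMatrix_last_zero hs]
      ring
    · intro J' _ hJ'
      rw [Matrix.map_apply, sumPsi, Matrix.blockDiagonal_apply_ne _ _ _ hJ',
        evalAtT_eq (zero_mem _)]
      exact (congrArg _ (map_zero _)).trans (mul_zero _)
    · simp
    · intro i _ hi
      refine Finset.sum_eq_zero fun J' _ => ?_
      rw [constMatrix, Matrix.map_apply, hU, if_neg hi, map_zero, zero_mul]
    · simp
  · intro i _ hi
    refine Finset.sum_eq_zero fun J' _ => ?_
    have hV0 : constMatrix (CInf F) V (i, J') (0, ⟨I, hII⟩) = 0 := by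
      rw [constMatrix, Matrix.map_apply, hV, if_neg hi, map_zero]
    rw [hV0, mul_zero]
  · simp

end DirectSum

end CarlitzMZV
end

/-! ### Assembly. -/

open Polynomial CarlitzMZV
theorem mainTheorem2 (F : Type*) [Field F] [Fintype F] (r : ℕ) (s : Fin r → ℕ)
    (hs : ∀ k, 0 < s k) (I : Finset (Fin r)) (hI : I ⊆ positions r) :
    -- the explicit motive with delayed interpolation
    IsDefinedOver F (positions r \ I).card (PhiMatrix F s I) ∧
    IsDualTMotive F (sigma F (PhiMatrix F s I)) ∧
    IsTrivialization F (PhiMatrix F s I) (PsiMatrix F s I) ∧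
    -- the inverse of its period matrix
    (∀ a b : Fin (r + 1), b ≤ a →
      evalAtT F (PsiMatrix F s I a b) =
        (∏ k : Between b a, gammaC F (s k)) *
          weakMultizeta F (fun k : Between b a => s k) {k | k.1 ∈ I} /
            piTilde F ^ tailSum s b) ∧
    (Summable fun d : {d : Fin r → ℕ // HasJumps (I : Set (Fin r)) d} =>
      ∏ k, powerSum F (d.1 k) (s k)) ∧
    (Summable fun d : {d : Fin r → ℕ // HasJumpsAtLeast (I : Set (Fin r)) d} =>
      ∏ k, powerSum F (d.1 k) (s k)) ∧
    -- the degenerate multizeta value, from the direct sum of the motives for the sets containing `I`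
    ∃ U V : Matrix.GeneralLinearGroup (Fin (r + 1) × ↥(Finset.Icc I (positions r))) F,
    ∃ Φ Ψ,
      Φ = constMatrix (CInf F)[X] U * sumPhi F s I * constMatrix (CInf F)[X] U⁻¹ ∧
      Ψ = constMatrix (PowerSeries (CInf F)) U * sumPsi F s I *
        constMatrix (PowerSeries (CInf F)) V ∧
      IsDefinedOver F (positions r \ I).card Φ ∧
      IsDualTMotive F (sigma F Φ) ∧
      IsTrivialization F Φ Ψ ∧
      ∃ a b,
        (periodMatrix F Ψ)⁻¹ a b =
          (∏ k, gammaC F (s k)) * multizeta F s (I : Set (Fin r)) / piTilde F ^ (∑ k, s k) ∧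
        -- the same value as an entry of a period matrix itself
        ∃ Φ' Ψ',
          Φ' * Φ.transpose = (X - C (tElt F)) ^ (∑ k, s k) • 1 ∧
          IsDefinedOver F (positions r \ I).card Φ' ∧
          IsDualTMotive F (sigma F Φ') ∧
          IsTrivialization F Φ' Ψ' ∧
          periodMatrix F Ψ' b a =
            (∏ k, gammaC F (s k)) * multizeta F s (I : Set (Fin r)) := by
  have hU := uniformized_PhiMatrix (F := F) I hs
  have hsum := summable_prod_powerSum (F := F) hs
  refine ⟨PhiMatrix_mem I (delay_le I), hU.isDualTMotive, hU.isTrivialization,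
    fun a b h => evalAtT_PsiMatrix I hs h, hsum.subtype _, hsum.subtype _, ?_⟩
  obtain ⟨U, V, a, b, hab⟩ := exists_constMatrix_evalAtT (F := F) hs hI
  have h := (uniformized_sumPhi (F := F) (I := I) hs).baseChange U V
  have hJ : ∀ (J : ↥(Finset.Icc I (positions r))) (k : Fin r),
      delay J.1 k ≤ (positions r \ I).card := fun J k =>
    delay_le_of_subset (Finset.mem_Icc.1 J.2).1 k
  -- The dual matrix `Φ'` is the transpose of the complement of `Φ` carried by `h`; its entries are
  -- controlled through `PhiComplement_mem`.
  refine ⟨U, V, _, _, rfl, rfl, ?_, h.isDualTMotive, h.isTrivialization, a, b, ?_, _, _,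
    h.dual.mul_Phi', ?_, h.dual.isDualTMotive, h.dual.isTrivialization, ?_⟩
  · exact mul_entries_mem (definedOver F _) (mul_entries_mem _ (constMatrix_mem_definedOver _ U)
      (blockDiagonal_entries_mem _ fun J => PhiMatrix_mem J.1 (hJ J)))
      (constMatrix_mem_definedOver _ U⁻¹)
  · rw [h.periodMatrix_inv, hab]
  · intro i j
    exact mul_entries_mem (definedOver F _) (mul_entries_mem _ (constMatrix_mem_definedOver _ U)
      (blockDiagonal_entries_mem _ fun J => PhiComplement_mem J.1 (hJ J)))
      (constMatrix_mem_definedOver _ U⁻¹) j i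
  · rw [h.periodMatrix_dual, Matrix.smul_apply, Matrix.transpose_apply, hab, smul_eq_mul,
      mul_div_cancel₀ _ (pow_ne_zero _ (piTilde_ne_zero F))]
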